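/- Let $\mathcal V$ be a Grothendieck category with a closed symmetric monoidal structure (tensor product $\otimes$, unit $e$, internal Hom $\underline{\mathcal V}(-,-)$) such that $e$ is finitely presented and $\mathcal V$ has a (small) family of dualizable generators. Here an object $P$ of a category is finitely presented if $\operatorname{Hom}(P,-)$ preserves small filtered colimits. Let $\mathcal A$ be a (skeletally) small $\mathcal V$-category. Right $\mathcal A$-modules are $\mathcal V$-functors $\mathcal A^{op}\to\mathcal V$, left $\mathcal A$-modules are $\mathcal V$-functors $\mathcal A\to\mathcal V$; in both cases the morphisms are the $\mathcal V$-natural transformations, and the $\mathcal V$-object of morphisms from $F$ to $G$ is the end $[F,G]=\int_c\underline{\mathcal V}(F(c),G(c))$. Let $\operatorname{mod}\mathcal A$ be the full $\mathcal V$-subcategory of finitely presented objects in the $\mathcal V$-category of right $\mathcal A$-modules, and let ${}_{\mathcal A}\mathcal C$ be the category of generalised $\mathcal A$-modules, that is, of $\mathcal V$-functors $\operatorname{mod}\mathcal A\to\mathcal V$ and $\mathcal V$-natural transformations. An object $Y$ of ${}_{\mathcal A}\mathcal C$ is finitely generated if, whenever $Y$ is the sum of a family of subobjects, it is the sum of finitely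 many of them; it is coherent if it is finitely presented and each of its finitely generated subobjects is finitely presented. For a left $\mathcal A$-module $N$ let $-\otimes_{\mathcal A}N\colon\operatorname{mod}\mathcal A\to\mathcal V$ be the $\mathcal V$-functor $M\mapsto\int^{a}M(a)\otimes N(a)$. **Theorem.** For $X\in{}_{\mathcal A}\mathcal C$ the following are equivalent: 1. $X$ is $\underline{\mathrm{coh}}$-injective: the functor $[-,X]$, $[Y,X]=\int_{M\in\operatorname{mod}\mathcal A}\underline{\mathcal V}(Y(M),X(M))$, exists on coherent objects and is exact, i.e. for every short exact sequence $0\to Y_1\to Y_2\to Y_3\to 0$ in ${}_{\mathcal A}\mathcal C$ with coherent terms, the sequence $0\to[Y_3,X]\to[Y_2,X]\to[Y_1,X]\to 0$ is exact in $\mathcal V$. 2. $X$ is right exact on finitely presented modules: for every sequence $K\to L\to M\to 0$ in $\operatorname{mod}\mathcal A$ that is exact as a sequence of right $\mathcal A$-modules, the sequence $X(K)\to X(L)\to X(M)\to 0$ is exact in $\mathcal V$. 3. $X$ is isomorphic to $-\otimes_{\mathcal A}N$ for some left $\mathcal A$-module $N$. -/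

import Mathlib

open CategoryTheory Limits MonoidalCategory Opposite
open scoped MonoidalClosed

universe w v u

set_option linter.unusedSectionVars false

namespace EnrichedModule

noncomputable section

section Basic

variable (V : Type u) [Category.{v} V] [MonoidalCategory V] [MonoidalClosed V]

variable {V} in
lemma uncurry_tensorHom_eComp {a b c X Y : V} (f : X ⟶ (ihom a).obj b) (g : Y ⟶ (ihom b).obj c) :
    MonoidalClosed.uncurry ((f ⊗ₘ g) ≫ (eComp V a b c : (ihom a).obj b ⊗ (ihom b).obj c ⟶ _)) =
      (α_ _ _ _).inv ≫ MonoidalClosed.uncurry f ▷ Y ≫ MonoidalClosed.uncurry g := by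
  rw [MonoidalClosed.uncurry_natural_left, MonoidalClosed.enrichedCategorySelf_comp,
    MonoidalClosed.comp_eq, MonoidalClosed.uncurry_curry, MonoidalClosed.compTranspose_eq,
    MonoidalClosed.uncurry_eq, MonoidalClosed.uncurry_eq, MonoidalCategory.tensorHom_def,
    MonoidalCategory.whiskerLeft_comp, Category.assoc, associator_inv_naturality_right_assoc,
    associator_inv_naturality_middle_assoc, comp_whiskerRight, Category.assoc,
    whisker_exchange_assoc]
  rfl

variable {V} in
lemma uncurry_eId (a : V) :
    MonoidalClosed.uncurry (eId V a : 𝟙_ V ⟶ (ihom a).obj a) = (ρ_ a).hom := by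
  rw [MonoidalClosed.enrichedCategorySelf_id, MonoidalClosed.id_eq, MonoidalClosed.uncurry_curry]

/-- A `V`-functor `C → V`. (A wrapper around Mathlib's `EnrichedFunctor`: the category structure
below has the `V`-natural transformations as morphisms, and not just the natural transformations
of the underlying functors.) -/
structure VFun (C : Type w) [EnrichedCategory V C] where
  /-- the enriched functor -/
  toEnriched : EnrichedFunctor V C V

namespace VFun

variable {V} {C : Type w} [EnrichedCategory V C]

/-- The value of a `V`-functor at an object. -/
abbrev obj (F : VFun V C) (c : C) : V := F.toEnriched.obj c

/-- The structure morphism `F(c) ⊗ C(c,d) ⟶ F(d)`, adjoint to `C(c,d) ⟶ [F(c), F(d)]`. -/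
def act (F : VFun V C) (c d : C) : F.obj c ⊗ (c ⟶[V] d) ⟶ F.obj d :=
  MonoidalClosed.uncurry (F.toEnriched.map c d)

lemma act_id (F : VFun V C) (c : C) :
    F.obj c ◁ eId V c ≫ F.act c c = (ρ_ (F.obj c)).hom := by
  rw [act, ← MonoidalClosed.uncurry_natural_left, F.toEnriched.map_id c]
  exact uncurry_eId _

lemma act_comp (F : VFun V C) (c d e : C) :
    F.obj c ◁ eComp V c d e ≫ F.act c e =
      (α_ _ _ _).inv ≫ F.act c d ▷ (d ⟶[V] e) ≫ F.act d e := by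
  rw [act, ← MonoidalClosed.uncurry_natural_left, F.toEnriched.map_comp c d e]
  exact uncurry_tensorHom_eComp _ _

/-- Construct a `V`-functor `C → V` from its structure morphisms. -/
def ofAct (obj : C → V) (act : ∀ c d, obj c ⊗ (c ⟶[V] d) ⟶ obj d)
    (act_id : ∀ c, obj c ◁ eId V c ≫ act c c = (ρ_ (obj c)).hom)
    (act_comp : ∀ c d e, obj c ◁ eComp V c d e ≫ act c e =
      (α_ _ _ _).inv ≫ act c d ▷ (d ⟶[V] e) ≫ act d e) : VFun V C where
  toEnriched :=
    { obj := obj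
      map := fun c d => MonoidalClosed.curry (act c d)
      map_id := fun c => by
        apply MonoidalClosed.uncurry_injective
        rw [MonoidalClosed.uncurry_natural_left, MonoidalClosed.uncurry_curry, act_id]
        exact (uncurry_eId _).symm
      map_comp := fun c d e => by
        apply MonoidalClosed.uncurry_injective
        rw [MonoidalClosed.uncurry_natural_left, MonoidalClosed.uncurry_curry, act_comp]
        refine Eq.trans ?_ (uncurry_tensorHom_eComp _ _).symm
        rw [MonoidalClosed.uncurry_curry, MonoidalClosed.uncurry_curry] }

@[simp]
lemma ofAct_act (obj : C → V) (act : ∀ c d, obj c ⊗ (c ⟶[V] d) ⟶ obj d) (h₁) (h₂) (c d : C) :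
    (ofAct obj act h₁ h₂).act c d = act c d :=
  MonoidalClosed.uncurry_curry _

/-- A `V`-natural transformation between `V`-functors `C → V`. -/
@[ext]
structure Hom (F G : VFun V C) where
  /-- the components -/
  app (c : C) : F.obj c ⟶ G.obj c
  naturality (c d : C) : F.act c d ≫ app d = app c ▷ (c ⟶[V] d) ≫ G.act c d


instance : Category (VFun V C) where
  Hom := Hom
  id F := { app := fun c => 𝟙 _, naturality := by simp }
  comp f g :=
    { app := fun c => f.app c ≫ g.app c
      naturality := fun c d => by
        rw [reassoc_of% f.naturality, g.naturality, comp_whiskerRight, Category.assoc] }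

@[ext]
lemma hom_ext {F G : VFun V C} {f g : F ⟶ G} (h : ∀ c, f.app c = g.app c) : f = g :=
  Hom.ext (funext h)

@[simp] lemma id_app (F : VFun V C) (c : C) : Hom.app (𝟙 F) c = 𝟙 (F.obj c) := rfl

@[simp] lemma comp_app {F G H : VFun V C} (f : F ⟶ G) (g : G ⟶ H) (c : C) :
    Hom.app (f ≫ g) c = f.app c ≫ g.app c := rfl

/-- An isomorphism of `V`-functors from a `V`-natural family of isomorphisms. -/
def isoMk {F G : VFun V C} (e : ∀ c, F.obj c ≅ G.obj c)
    (h : ∀ c d, F.act c d ≫ (e d).hom = (e c).hom ▷ (c ⟶[V] d) ≫ G.act c d) : F ≅ G where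
  hom := { app := fun c => (e c).hom, naturality := h }
  inv :=
    { app := fun c => (e c).inv
      naturality := fun c d => by
        rw [← cancel_mono (e d).hom, Category.assoc, Category.assoc, h, Iso.inv_hom_id,
          ← comp_whiskerRight_assoc]
        simp }
  hom_inv_id := by ext; simp
  inv_hom_id := by ext; simp

section Preadditive

variable [Preadditive V] [MonoidalPreadditive V]

instance : Preadditive (VFun V C) where
  homGroup F G :=
    letI : Zero (F ⟶ G) := ⟨{ app := fun _ => 0, naturality := by simp }⟩
    letI : Add (F ⟶ G) := ⟨fun f g =>
      { app := fun c => f.app c + g.app c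
        naturality := fun c d => by
          simp [f.naturality, g.naturality] }⟩
    letI : Neg (F ⟶ G) := ⟨fun f =>
      { app := fun c => - f.app c
        naturality := fun c d => by
          have : (- f.app c) ▷ (c ⟶[V] d) = - (f.app c ▷ (c ⟶[V] d)) :=
            (tensorRight (c ⟶[V] d)).map_neg (f := f.app c)
          rw [this]
          simp [f.naturality] }⟩
    { add_assoc := fun f g h => hom_ext fun c => add_assoc _ _ _
      zero_add := fun f => hom_ext fun c => zero_add _
      add_zero := fun f => hom_ext fun c => add_zero _
      nsmul := nsmulRec
      zsmul := zsmulRec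
      neg_add_cancel := fun f => hom_ext fun c => neg_add_cancel _
      add_comm := fun f g => hom_ext fun c => add_comm _ _ }
  add_comp F G H f g h := hom_ext fun c => Preadditive.add_comp _ _ _ _ _ _
  comp_add F G H f g h := hom_ext fun c => Preadditive.comp_add _ _ _ _ _ _

@[simp] lemma zero_app (F G : VFun V C) (c : C) : Hom.app (0 : F ⟶ G) c = 0 := rfl

@[simp] lemma add_app {F G : VFun V C} (f g : F ⟶ G) (c : C) :
    Hom.app (f + g) c = f.app c + g.app c := rfl

end Preadditive

end VFun
end Basic

section
variable (V : Type u) [Category.{v} V] [MonoidalCategory V] [SymmetricCategory V]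
  [MonoidalClosed V] [Abelian V]
instance : MonoidalPreadditive V := by
  have h1 (X : V) : (tensorLeft X).Additive := by
    have := preservesBinaryBiproducts_of_preservesBinaryCoproducts (tensorLeft X)
    exact Functor.additive_of_preservesBinaryBiproducts _
  have h2 (X : V) : (tensorRight X).Additive := Functor.additive_of_iso (BraidedCategory.tensorLeftIsoTensorRight X)
  exact
  { whiskerLeft_zero := fun {X Y Z} => (tensorLeft X).map_zero _ _
    zero_whiskerRight := fun {X Y Z} => (tensorRight X).map_zero _ _
    whiskerLeft_add := fun {X Y Z} f g => (tensorLeft X).map_add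
    add_whiskerRight := fun {X Y Z} f g => (tensorRight X).map_add }
end

section End
variable {V : Type u} [Category.{v} V] [MonoidalCategory V] [SymmetricCategory V]
  [MonoidalClosed V]

/-- The symmetry `(X ⊗ Y) ⊗ Z ⟶ (X ⊗ Z) ⊗ Y`. -/
def swapR (X Y Z : V) : (X ⊗ Y) ⊗ Z ⟶ (X ⊗ Z) ⊗ Y :=
  (α_ X Y Z).hom ≫ X ◁ (β_ Y Z).hom ≫ (α_ X Z Y).inv

lemma swapR_natural_right (X Y : V) {Z Z' : V} (f : Z ⟶ Z') :
    (X ⊗ Y) ◁ f ≫ swapR X Y Z' = swapR X Y Z ≫ (X ◁ f) ▷ Y := by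
  have h : X ◁ Y ◁ f ≫ X ◁ (β_ Y Z').hom = X ◁ (β_ Y Z).hom ≫ X ◁ f ▷ Y := by
    rw [← MonoidalCategory.whiskerLeft_comp, BraidedCategory.braiding_naturality_right,
      MonoidalCategory.whiskerLeft_comp]
  simp [swapR, reassoc_of% h]

lemma swapR_natural_left {X X' : V} (f : X ⟶ X') (Y Z : V) :
    (f ▷ Y) ▷ Z ≫ swapR X' Y Z = swapR X Y Z ≫ (f ▷ Z) ▷ Y := by
  rw [swapR, swapR, associator_naturality_left_assoc, ← whisker_exchange_assoc, Category.assoc,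
    Category.assoc, associator_inv_naturality_left]

lemma swapR_natural_middle (X : V) {Y Y' : V} (f : Y ⟶ Y') (Z : V) :
    (X ◁ f) ▷ Z ≫ swapR X Y' Z = swapR X Y Z ≫ (X ⊗ Z) ◁ f := by
  have h : X ◁ f ▷ Z ≫ X ◁ (β_ Y' Z).hom = X ◁ (β_ Y Z).hom ≫ X ◁ Z ◁ f := by
    rw [← MonoidalCategory.whiskerLeft_comp, BraidedCategory.braiding_naturality_left,
      MonoidalCategory.whiskerLeft_comp]
  simp [swapR, reassoc_of% h]

@[simp]
lemma swapR_swapR (X Y Z : V) : swapR X Y Z ≫ swapR X Z Y = 𝟙 _ := by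
  have h : X ◁ (β_ Y Z).hom ≫ X ◁ (β_ Z Y).hom = 𝟙 _ := by
    rw [← MonoidalCategory.whiskerLeft_comp, SymmetricCategory.symmetry,
      MonoidalCategory.whiskerLeft_id]
  simp [swapR, reassoc_of% h]

lemma swapR_unit (X Y : V) : swapR X Y (𝟙_ V) ≫ (ρ_ X).hom ▷ Y = (ρ_ (X ⊗ Y)).hom := by
  simp [swapR]

lemma swapR_tensor (X Y Z W : V) :
    swapR X Y (Z ⊗ W) ≫ (α_ X Z W).inv ▷ Y =
      (α_ (X ⊗ Y) Z W).inv ≫ swapR X Y Z ▷ W ≫ swapR (X ⊗ Z) Y W := by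
  simp [swapR]


namespace VFun

variable {C : Type w} [EnrichedCategory V C]

/-- The morphism `[F(c), G(c)] ⟶ [F(c) ⊗ C(c,d), G(d)]` given by the structure morphism of `G`. -/
def endFst (F G : VFun V C) (c d : C) :
    (ihom (F.obj c)).obj (G.obj c) ⟶ (ihom (F.obj c ⊗ (c ⟶[V] d))).obj (G.obj d) :=
  MonoidalClosed.curry (swapR (F.obj c) (c ⟶[V] d) ((ihom (F.obj c)).obj (G.obj c)) ≫
    (ihom.ev (F.obj c)).app (G.obj c) ▷ (c ⟶[V] d) ≫ G.act c d)

/-- The morphism `[F(d), G(d)] ⟶ [F(c) ⊗ C(c,d), G(d)]` given by the structure morphism of `F`. -/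
def endSnd (F G : VFun V C) (c d : C) :
    (ihom (F.obj d)).obj (G.obj d) ⟶ (ihom (F.obj c ⊗ (c ⟶[V] d))).obj (G.obj d) :=
  (MonoidalClosed.pre (F.act c d)).app (G.obj d)

/-- The diagram whose limit is the end `∫_c [F(c), G(c)]`. -/
def endIndex (F G : VFun V C) : MulticospanIndex (MulticospanShape.prod C) V where
  left c := (ihom (F.obj c)).obj (G.obj c)
  right p := (ihom (F.obj p.1 ⊗ (p.1 ⟶[V] p.2))).obj (G.obj p.2)
  fst p := endFst F G p.1 p.2
  snd p := endSnd F G p.1 p.2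

/-- A family `F(c) ⊗ A ⟶ G(c)` is natural if it is compatible with the structure morphisms. -/
def IsNat (F G : VFun V C) (A : V) (y : ∀ c, F.obj c ⊗ A ⟶ G.obj c) : Prop :=
  ∀ c d, F.act c d ▷ A ≫ y d = swapR (F.obj c) (c ⟶[V] d) A ≫ y c ▷ (c ⟶[V] d) ≫ G.act c d

lemma endIndex_condition_iff (F G : VFun V C) {A : V}
    (x : ∀ c, A ⟶ (ihom (F.obj c)).obj (G.obj c)) :
    (∀ p : C × C, x p.1 ≫ (endIndex F G).fst p = x p.2 ≫ (endIndex F G).snd p) ↔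
      IsNat F G A (fun c => MonoidalClosed.uncurry (x c)) := by
  have key (c d : C) : x c ≫ endFst F G c d = x d ≫ endSnd F G c d ↔
      F.act c d ▷ A ≫ MonoidalClosed.uncurry (x d) =
        swapR (F.obj c) (c ⟶[V] d) A ≫
          MonoidalClosed.uncurry (x c) ▷ (c ⟶[V] d) ≫ G.act c d := by
    rw [← MonoidalClosed.uncurry_injective.eq_iff, MonoidalClosed.uncurry_natural_left, endFst,
      MonoidalClosed.uncurry_curry, endSnd,
      MonoidalClosed.uncurry_pre_app, reassoc_of% (@swapR_natural_right), MonoidalClosed.uncurry_eq (x c),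
      comp_whiskerRight, Category.assoc, eq_comm]
  exact ⟨fun h c d => (key c d).1 (h (c, d)), fun h p => (key p.1 p.2).2 (h p.1 p.2)⟩

lemma isNat_comp {F G H : VFun V C} {A B : V} {y : ∀ c, F.obj c ⊗ A ⟶ G.obj c}
    (hy : IsNat F G A y) {z : ∀ c, G.obj c ⊗ B ⟶ H.obj c} (hz : IsNat G H B z) :
    IsNat F H (A ⊗ B) (fun c => (α_ _ _ _).inv ≫ y c ▷ B ≫ z c) := by
  intro c d
  simp only [comp_whiskerRight, Category.assoc]
  rw [associator_inv_naturality_left_assoc, reassoc_of% (@swapR_tensor), ← comp_whiskerRight_assoc, hy c d,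
    ← reassoc_of% (@swapR_natural_left)]
  simp only [comp_whiskerRight, Category.assoc]
  rw [hz c d]

lemma isNat_of_hom {F G : VFun V C} (f : F ⟶ G) :
    IsNat F G (𝟙_ V) (fun c => (ρ_ _).hom ≫ f.app c) := by
  intro c d
  simp only [comp_whiskerRight, Category.assoc]
  rw [reassoc_of% (@swapR_unit), rightUnitor_naturality_assoc, f.naturality]

lemma IsNat.precomp {F G : VFun V C} {A B : V} {y : ∀ c, F.obj c ⊗ A ⟶ G.obj c}
    (hy : IsNat F G A y) (f : B ⟶ A) : IsNat F G B (fun c => F.obj c ◁ f ≫ y c) := by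
  intro c d
  simp only [comp_whiskerRight, Category.assoc]
  rw [← whisker_exchange_assoc, hy, reassoc_of% (@swapR_natural_right)]

lemma isNat_precomp_hom {F G H : VFun V C} (f : F ⟶ G) {A : V} {y : ∀ c, G.obj c ⊗ A ⟶ H.obj c}
    (hy : IsNat G H A y) : IsNat F H A (fun c => f.app c ▷ A ≫ y c) := by
  intro c d
  simp only [comp_whiskerRight, Category.assoc]
  rw [← comp_whiskerRight_assoc, f.naturality, comp_whiskerRight, Category.assoc, hy c d,
    reassoc_of% (@swapR_natural_left)]

/-- The `V`-object of `V`-natural transformations, i.e. the end `∫_c [F(c), G(c)]`. -/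
def homObj (F G : VFun V C) [HasMultiequalizer (endIndex F G)] : V := multiequalizer (endIndex F G)

section HasEnd

variable {F G : VFun V C} [HasMultiequalizer (endIndex F G)]

variable (F G) in
/-- The projections of the end `∫_c [F(c), G(c)]`. -/
def homπ (c : C) : homObj F G ⟶ (ihom (F.obj c)).obj (G.obj c) :=
  Multiequalizer.ι (endIndex F G) c

variable (F G) in
/-- The evaluation `F(c) ⊗ ∫_c [F(c), G(c)] ⟶ G(c)`. -/
def homEv (c : C) : F.obj c ⊗ homObj F G ⟶ G.obj c :=
  MonoidalClosed.uncurry (homπ F G c)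

variable (F G) in
lemma isNat_homEv : IsNat F G (homObj F G) (homEv F G) :=
  (endIndex_condition_iff F G (homπ F G)).1 (Multiequalizer.condition (endIndex F G))

/-- The morphism to the end given by a natural family. -/
def homLift {A : V} (y : ∀ c, F.obj c ⊗ A ⟶ G.obj c) (hy : IsNat F G A y) :
    A ⟶ homObj F G :=
  Multiequalizer.lift (endIndex F G) _ (fun c => MonoidalClosed.curry (y c))
    ((endIndex_condition_iff F G (fun c => MonoidalClosed.curry (y c))).2
      (by simpa only [MonoidalClosed.uncurry_curry] using hy))

lemma homLift_π {A : V} (y : ∀ c, F.obj c ⊗ A ⟶ G.obj c) (hy : IsNat F G A y)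
    (c : C) : homLift y hy ≫ homπ F G c = MonoidalClosed.curry (y c) :=
  Multiequalizer.lift_ι _ _ _ _ _

@[simp]
lemma homLift_ev {A : V} (y : ∀ c, F.obj c ⊗ A ⟶ G.obj c) (hy : IsNat F G A y)
    (c : C) : F.obj c ◁ homLift y hy ≫ homEv F G c = y c := by
  rw [homEv, ← MonoidalClosed.uncurry_natural_left, homLift_π, MonoidalClosed.uncurry_curry]

lemma homObj_hom_ext {A : V} {f g : A ⟶ homObj F G}
    (h : ∀ c, f ≫ homπ F G c = g ≫ homπ F G c) : f = g :=
  Multiequalizer.hom_ext _ _ _ h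

/-- The morphism `𝟙 ⟶ ∫_c [F(c), G(c)]` given by a `V`-natural transformation. -/
def homEquivFun (f : F ⟶ G) : 𝟙_ V ⟶ homObj F G :=
  homLift _ (isNat_of_hom f)

end HasEnd

section Pre

variable {F G : VFun V C} (X : VFun V C) [HasMultiequalizer (endIndex F X)]
  [HasMultiequalizer (endIndex G X)]

/-- The morphism `∫_c [G(c), X(c)] ⟶ ∫_c [F(c), X(c)]` given by a `V`-natural transformation
`F ⟶ G`. -/
def homPre (f : F ⟶ G) : homObj G X ⟶ homObj F X :=
  homLift (fun c => f.app c ▷ _ ≫ homEv G X c) (isNat_precomp_hom f (isNat_homEv G X))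

@[simp]
lemma homPre_ev (f : F ⟶ G) (c : C) :
    F.obj c ◁ homPre X f ≫ homEv F X c = f.app c ▷ _ ≫ homEv G X c :=
  homLift_ev _ _ c

end Pre

lemma homObj_hom_ext' {F G : VFun V C} [HasMultiequalizer (endIndex F G)] {A : V}
    {f g : A ⟶ homObj F G}
    (h : ∀ c, F.obj c ◁ f ≫ homEv F G c = F.obj c ◁ g ≫ homEv F G c) : f = g :=
  homObj_hom_ext fun c => MonoidalClosed.uncurry_injective (by
    rw [MonoidalClosed.uncurry_natural_left, MonoidalClosed.uncurry_natural_left]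
    exact h c)

variable (V C) in
/-- All ends `∫_c [F(c), G(c)]` exist. -/
class HasEnds : Prop where
  hasMultiequalizer (F G : VFun V C) : HasMultiequalizer (endIndex F G)

section HasEnds

variable [HasEnds V C]

instance (F G : VFun V C) : HasMultiequalizer (endIndex F G) := HasEnds.hasMultiequalizer F G

/-- The composition of the `V`-category of `V`-functors. -/
def homComp (F G H : VFun V C) : homObj F G ⊗ homObj G H ⟶ homObj F H :=
  homLift _ (isNat_comp (isNat_homEv F G) (isNat_homEv G H))

lemma homEquivFun_π {F G : VFun V C} (f : F ⟶ G) (c : C) :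
    homEquivFun f ≫ homπ F G c = eHomEquiv V (f.app c) := by
  rw [homEquivFun, homLift_π]
  rfl

lemma homComp_π (F G H : VFun V C) (c : C) :
    homComp F G H ≫ homπ F H c =
      (homπ F G c ⊗ₘ homπ G H c) ≫ eComp V (F.obj c) (G.obj c) (H.obj c) := by
  rw [homComp, homLift_π, MonoidalClosed.curry_eq_iff]
  exact (uncurry_tensorHom_eComp _ _).symm

/-- `V`-functors `C → V` form a `V`-category whose underlying category is the category of
`V`-natural transformations. The composition and the identities are the componentwise ones. -/
instance : EnrichedOrdinaryCategory V (VFun V C) where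
  Hom F G := homObj F G
  id F := homEquivFun (𝟙 F)
  comp F G H := homComp F G H
  id_comp F G := by
    refine homObj_hom_ext fun c => ?_
    simp only [Category.assoc, Category.id_comp, homComp_π]
    rw [MonoidalCategory.tensorHom_def, Category.assoc, ← comp_whiskerRight_assoc, homEquivFun_π,
      ← whisker_exchange_assoc, ← leftUnitor_inv_naturality_assoc, id_app, eHomEquiv_id]
    exact (congrArg (homπ F G c ≫ ·) (e_id_comp V (F.obj c) (G.obj c))).trans (Category.comp_id _)
  comp_id F G := by
    refine homObj_hom_ext fun c => ?_
    simp only [Category.assoc, Category.id_comp, homComp_π]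
    rw [MonoidalCategory.tensorHom_def', Category.assoc,
      ← MonoidalCategory.whiskerLeft_comp_assoc, homEquivFun_π,
      whisker_exchange_assoc, ← rightUnitor_inv_naturality_assoc, id_app, eHomEquiv_id]
    exact (congrArg (homπ F G c ≫ ·) (e_comp_id V (F.obj c) (G.obj c))).trans (Category.comp_id _)
  assoc F G H K := by
    refine homObj_hom_ext fun c => ?_
    simp only [Category.assoc, homComp_π]
    have h₁ : homComp F G H ▷ homObj H K ≫ (homπ F H c ⊗ₘ homπ H K c) =
        ((homπ F G c ⊗ₘ homπ G H c) ⊗ₘ homπ H K c) ≫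
          eComp V (F.obj c) (G.obj c) (H.obj c) ▷ _ := by
      rw [← tensorHom_id, ← tensorHom_id, tensorHom_comp_tensorHom, tensorHom_comp_tensorHom,
        homComp_π, Category.id_comp, Category.comp_id]
    have h₂ : homObj F G ◁ homComp G H K ≫ (homπ F G c ⊗ₘ homπ G K c) =
        (homπ F G c ⊗ₘ (homπ G H c ⊗ₘ homπ H K c)) ≫
          _ ◁ eComp V (G.obj c) (H.obj c) (K.obj c) := by
      rw [← id_tensorHom, ← id_tensorHom, tensorHom_comp_tensorHom, tensorHom_comp_tensorHom,
        homComp_π, Category.id_comp, Category.comp_id]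
    rw [reassoc_of% h₁, reassoc_of% h₂, ← associator_inv_naturality_assoc]
    exact congrArg (_ ≫ ·) (e_assoc V (F.obj c) (G.obj c) (H.obj c) (K.obj c))
  homEquiv {F G} :=
    { toFun := fun f => homEquivFun f
      invFun := fun (x : 𝟙_ V ⟶ homObj F G) =>
        { app := fun c => (ρ_ _).inv ≫ F.obj c ◁ x ≫ homEv F G c
          naturality := fun c d => by
            have h := ((isNat_homEv F G).precomp x) c d
            rw [← cancel_epi (ρ_ (F.obj c ⊗ (c ⟶[V] d))).hom, ← rightUnitor_naturality_assoc,
              Iso.hom_inv_id_assoc, h, ← swapR_unit, Category.assoc,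
              ← comp_whiskerRight_assoc, Iso.hom_inv_id_assoc] }
      left_inv := by
        intro f
        ext c
        change (ρ_ _).inv ≫ F.obj c ◁ homEquivFun f ≫ homEv F G c = f.app c
        simp [homEquivFun]
      right_inv := by
        intro x
        refine homObj_hom_ext fun c => ?_
        rw [homEquivFun_π]
        apply MonoidalClosed.uncurry_injective
        refine (MonoidalClosed.uncurry_curry _).trans ?_
        rw [Iso.hom_inv_id_assoc, MonoidalClosed.uncurry_natural_left]
        rfl }
  homEquiv_id F := rfl
  homEquiv_comp f g := by
    refine homObj_hom_ext fun c => ?_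
    change homEquivFun (f ≫ g) ≫ _ = ((λ_ _).inv ≫ (homEquivFun f ⊗ₘ homEquivFun g) ≫
      homComp _ _ _) ≫ _
    rw [homEquivFun_π, comp_app, eHomEquiv_comp, Category.assoc, Category.assoc, homComp_π,
      tensorHom_comp_tensorHom_assoc, homEquivFun_π, homEquivFun_π]

end HasEnds
end VFun

end End

section Skeletal
variable (V : Type u) [Category.{v} V] [MonoidalCategory V] 

/-- A `V`-category is skeletally small if there is a (`v`-)small family of objects such that every
object is isomorphic, in the underlying category, to a member of the family. -/
class IsSkeletallySmall (C : Type w) [EnrichedCategory V C] : Prop where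
  exists_skeleton (C) : ∃ (S : Type v) (σ : S → C), ∀ c : C, ∃ s : S,
    Nonempty (ForgetEnrichment.of V c ≅ ForgetEnrichment.of V (σ s))

variable {V} {C : Type w} [EnrichedCategory V C]

/-- Mutually inverse generalized elements of hom objects. -/
structure ElemIso (c d : C) where
  hom : 𝟙_ V ⟶ (c ⟶[V] d)
  inv : 𝟙_ V ⟶ (d ⟶[V] c)
  hom_inv_id : (λ_ (𝟙_ V)).inv ≫ (hom ⊗ₘ inv) ≫ eComp V c d c = eId V c
  inv_hom_id : (λ_ (𝟙_ V)).inv ≫ (inv ⊗ₘ hom) ≫ eComp V d c d = eId V d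

/-- Extract generalized elements from an isomorphism in the underlying category. -/
def ElemIso.ofIso {c d : C} (e : ForgetEnrichment.of V c ≅ ForgetEnrichment.of V d) :
    ElemIso (V := V) c d where
  hom := ForgetEnrichment.homTo V e.hom
  inv := ForgetEnrichment.homTo V e.inv
  hom_inv_id := by
    have := congrArg (ForgetEnrichment.homTo V) e.hom_inv_id
    rw [ForgetEnrichment.homTo_comp, ForgetEnrichment.homTo_id, Category.assoc] at this
    exact this
  inv_hom_id := by
    have := congrArg (ForgetEnrichment.homTo V) e.inv_hom_id
    rw [ForgetEnrichment.homTo_comp, ForgetEnrichment.homTo_id, Category.assoc] at this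
    exact this

variable (V) in
lemma exists_elemIso (C : Type w) [EnrichedCategory V C] [IsSkeletallySmall V C] :
    ∃ (S : Type v) (σ : S → C) (r : C → S), ∀ c, Nonempty (ElemIso (V := V) c (σ (r c))) := by
  obtain ⟨S, σ, h⟩ := IsSkeletallySmall.exists_skeleton (V := V) C
  choose r hr using h
  exact ⟨S, σ, r, fun c => (hr c).map ElemIso.ofIso⟩

/-- The `V`-category structure on `S` pulled back along a map `S → C`. -/
@[reducible]
def pullbackEnriched {S : Type*} (σ : S → C) : EnrichedCategory V S where
  Hom s t := (σ s) ⟶[V] (σ t)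
  id s := eId V (σ s)
  comp s t r := eComp V (σ s) (σ t) (σ r)
  id_comp s t := e_id_comp V (σ s) (σ t)
  comp_id s t := e_comp_id V (σ s) (σ t)
  assoc s t r q := e_assoc V (σ s) (σ t) (σ r) (σ q)

variable [MonoidalClosed V]

/-- The restriction of a `V`-functor along a map `S → C`. -/
def VFun.restr {S : Type*} (σ : S → C) (F : VFun V C) :
    letI := pullbackEnriched (V := V) σ
    VFun V S :=
  letI := pullbackEnriched (V := V) σ
  { toEnriched :=
      { obj := fun s => F.obj (σ s)
        map := fun s t => F.toEnriched.map (σ s) (σ t)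
        map_id := fun s => F.toEnriched.map_id (σ s)
        map_comp := fun s t r => F.toEnriched.map_comp (σ s) (σ t) (σ r) } }

namespace VFun

/-- The action of a `V`-functor `C → V` on a morphism of the underlying category. -/
def mapElem (F : VFun V C) {c d : C} (f : 𝟙_ V ⟶ (c ⟶[V] d)) : F.obj c ⟶ F.obj d :=
  (ρ_ _).inv ≫ F.obj c ◁ f ≫ F.act c d

@[simp]
lemma mapElem_id (F : VFun V C) (c : C) : F.mapElem (eId V c) = 𝟙 (F.obj c) := by
  rw [mapElem, act_id, Iso.inv_hom_id]

lemma act_mapElem (F : VFun V C) {c d d' : C} (g : 𝟙_ V ⟶ (d ⟶[V] d')) :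
    F.act c d ≫ F.mapElem g =
      F.obj c ◁ ((ρ_ _).inv ≫ (c ⟶[V] d) ◁ g ≫ eComp V c d d') ≫ F.act c d' := by
  simp only [mapElem, MonoidalCategory.whiskerLeft_comp, Category.assoc, act_comp]
  rw [associator_inv_naturality_right_assoc, whisker_exchange_assoc,
    rightUnitor_inv_naturality_assoc]
  simp

lemma mapElem_act (F : VFun V C) {c c' d : C} (f : 𝟙_ V ⟶ (c ⟶[V] c')) :
    F.mapElem f ▷ (c' ⟶[V] d) ≫ F.act c' d =
      F.obj c ◁ ((λ_ _).inv ≫ f ▷ (c' ⟶[V] d) ≫ eComp V c c' d) ≫ F.act c d := by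
  simp only [mapElem, MonoidalCategory.whiskerLeft_comp, Category.assoc, act_comp,
    comp_whiskerRight]
  simp

lemma mapElem_comp (F : VFun V C) {c d e : C} (f : 𝟙_ V ⟶ (c ⟶[V] d)) (g : 𝟙_ V ⟶ (d ⟶[V] e)) :
    F.mapElem ((λ_ (𝟙_ V)).inv ≫ (f ⊗ₘ g) ≫ eComp V c d e) = F.mapElem f ≫ F.mapElem g := by
  conv_rhs => rw [mapElem, Category.assoc, Category.assoc, act_mapElem]
  rw [mapElem, MonoidalCategory.tensorHom_def]
  simp only [← MonoidalCategory.whiskerLeft_comp_assoc]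
  rw [rightUnitor_inv_naturality_assoc, unitors_inv_equal, Category.assoc]

@[simp]
lemma mapElem_hom_inv (F : VFun V C) {c d : C} (e : ElemIso (V := V) c d) :
    F.mapElem e.hom ≫ F.mapElem e.inv = 𝟙 _ := by
  rw [← mapElem_comp, e.hom_inv_id, mapElem_id]

@[simp]
lemma mapElem_inv_hom (F : VFun V C) {c d : C} (e : ElemIso (V := V) c d) :
    F.mapElem e.inv ≫ F.mapElem e.hom = 𝟙 _ := by
  rw [← mapElem_comp, e.inv_hom_id, mapElem_id]

lemma Hom.mapElem_naturality {F G : VFun V C} (α : F ⟶ G) {c d : C} (f : 𝟙_ V ⟶ (c ⟶[V] d)) :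
    F.mapElem f ≫ α.app d = α.app c ≫ G.mapElem f := by
  simp [mapElem, α.naturality, whisker_exchange_assoc]

/-- Conjugation of hom objects by isomorphisms. -/
def conj {c c' d d' : C} (e : ElemIso (V := V) c c') (i : ElemIso (V := V) d d') :
    (c ⟶[V] d) ⟶ (c' ⟶[V] d') :=
  ((ρ_ _).inv ≫ (c ⟶[V] d) ◁ i.hom ≫ eComp V c d d') ≫
    ((λ_ _).inv ≫ e.inv ▷ (c ⟶[V] d') ≫ eComp V c' c d')

lemma conj_act (F : VFun V C) {c c' d d' : C} (e : ElemIso (V := V) c c')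
    (i : ElemIso (V := V) d d') :
    F.obj c' ◁ conj e i ≫ F.act c' d' = F.mapElem e.inv ▷ _ ≫ F.act c d ≫ F.mapElem i.hom := by
  rw [conj, MonoidalCategory.whiskerLeft_comp, Category.assoc, ← mapElem_act, act_mapElem,
    whisker_exchange_assoc]

lemma act_conj (F : VFun V C) {c c' d d' : C} (e : ElemIso (V := V) c c')
    (i : ElemIso (V := V) d d') :
    F.act c d ≫ F.mapElem i.hom = F.mapElem e.hom ▷ _ ≫ F.obj c' ◁ conj e i ≫ F.act c' d' := by
  rw [conj_act, ← comp_whiskerRight_assoc, mapElem_hom_inv, id_whiskerRight, Category.id_comp]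

end VFun
end Skeletal

section EndExists
variable {V : Type u} [Category.{v} V] [MonoidalCategory V] [SymmetricCategory V]
  [MonoidalClosed V] {C : Type w} [EnrichedCategory V C]

namespace VFun

lemma natural_extend {F G : VFun V C} {A : V} {c c' d d' : C}
    {x : F.obj c' ⊗ A ⟶ G.obj c'} {y : F.obj d' ⊗ A ⟶ G.obj d'}
    (h : F.act c' d' ▷ A ≫ y =
      swapR (F.obj c') (c' ⟶[V] d') A ≫ x ▷ (c' ⟶[V] d') ≫ G.act c' d')
    (e : ElemIso (V := V) c c') (i : ElemIso (V := V) d d') :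
    F.act c d ▷ A ≫ F.mapElem i.hom ▷ A ≫ y ≫ G.mapElem i.inv =
      swapR (F.obj c) (c ⟶[V] d) A ≫
        (F.mapElem e.hom ▷ A ≫ x ≫ G.mapElem e.inv) ▷ (c ⟶[V] d) ≫ G.act c d := by
  rw [← comp_whiskerRight_assoc, act_conj F e i]
  simp only [comp_whiskerRight, Category.assoc]
  rw [reassoc_of% h, reassoc_of% (@swapR_natural_middle), reassoc_of% (@swapR_natural_left),
    whisker_exchange_assoc, reassoc_of% (conj_act G e i), mapElem_hom_inv, Category.comp_id]

lemma IsNat.mapElem {F G : VFun V C} {A : V} {y : ∀ c, F.obj c ⊗ A ⟶ G.obj c}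
    (hy : IsNat F G A y) {c d : C} (f : 𝟙_ V ⟶ (c ⟶[V] d)) :
    F.mapElem f ▷ A ≫ y d = y c ≫ G.mapElem f := by
  simp only [VFun.mapElem, comp_whiskerRight, Category.assoc, hy c d]
  rw [reassoc_of% (@swapR_natural_middle), whisker_exchange_assoc]
  simp [swapR]

lemma hasMultiequalizer_of_universal {F G : VFun V C} {E : V} (ev : ∀ c, F.obj c ⊗ E ⟶ G.obj c)
    (hev : IsNat F G E ev)
    (huniv : ∀ {A : V} (y : ∀ c, F.obj c ⊗ A ⟶ G.obj c), IsNat F G A y →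
      ∃ f : A ⟶ E, (∀ c, F.obj c ◁ f ≫ ev c = y c) ∧
        ∀ g : A ⟶ E, (∀ c, F.obj c ◁ g ≫ ev c = y c) → g = f) :
    HasMultiequalizer (endIndex F G) := by
  have hev' := (endIndex_condition_iff F G (fun c => MonoidalClosed.curry (ev c))).2
    (by simpa only [MonoidalClosed.uncurry_curry] using hev)
  have hK (K : Multifork (endIndex F G)) :
      IsNat F G K.pt (fun c => MonoidalClosed.uncurry (K.ι c)) :=
    (endIndex_condition_iff F G K.ι).1 K.condition
  choose l hl₁ hl₂ using fun K : Multifork (endIndex F G) => huniv _ (hK K)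
  have key (A : V) (f : A ⟶ E) (c : C) (k : A ⟶ (ihom (F.obj c)).obj (G.obj c)) :
      f ≫ MonoidalClosed.curry (ev c) = k ↔
        F.obj c ◁ f ≫ ev c = MonoidalClosed.uncurry k := by
    rw [← MonoidalClosed.curry_natural_left, MonoidalClosed.curry_eq_iff]
  exact ⟨⟨⟨Multifork.ofι (endIndex F G) E (fun c => MonoidalClosed.curry (ev c)) hev',
    Multifork.IsLimit.mk _ l (fun K c => (key _ _ c _).2 (hl₁ K c))
      (fun K m hm => hl₂ K m (fun c => (key _ m c _).1 (hm c)))⟩⟩⟩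

lemma hasEnds_of_type [HasLimitsOfSize.{v, v} V] {S : Type v} [EnrichedCategory V S] :
    HasEnds V S where
  hasMultiequalizer _ _ := inferInstance

instance hasEnds_of_skeletallySmall [HasLimitsOfSize.{v, v} V] [IsSkeletallySmall V C] :
    HasEnds V C where
  hasMultiequalizer F G := by
    obtain ⟨S, σ, r, he⟩ := exists_elemIso V C
    have e := fun c => (he c).some
    let _ := pullbackEnriched (V := V) σ
    have : HasEnds V S := hasEnds_of_type
    let E : V := homObj (restr σ F) (restr σ G)
    let ε (s : S) : F.obj (σ s) ⊗ E ⟶ G.obj (σ s) := homEv (restr σ F) (restr σ G) s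
    have hε : IsNat (restr σ F) (restr σ G) E ε := isNat_homEv (restr σ F) (restr σ G)
    refine hasMultiequalizer_of_universal (E := E)
      (fun c => F.mapElem (e c).hom ▷ _ ≫ ε (r c) ≫ G.mapElem (e c).inv)
      (fun c d => natural_extend (F := F) (G := G) (c' := σ (r c)) (d' := σ (r d))
        (hε (r c) (r d)) (e c) (e d)) ?_
    intro A y hy
    have hy' : IsNat (restr σ F) (restr σ G) A (fun s => y (σ s)) :=
      fun s t => hy (σ s) (σ t)
    have hl (s : S) : F.obj (σ s) ◁ (homLift _ hy' : A ⟶ E) ≫ ε s = y (σ s) :=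
      homLift_ev _ hy' s
    refine ⟨homLift _ hy', fun c => ?_, fun g hg => ?_⟩
    · rw [whisker_exchange_assoc, reassoc_of% (hl (r c)), reassoc_of% (hy.mapElem (e c).hom),
        mapElem_hom_inv, Category.comp_id]
    · have h₃ (s : S) : F.mapElem (e (σ s)).hom ▷ _ ≫ ε (r (σ s)) =
          ε s ≫ G.mapElem (e (σ s)).hom :=
        hε.mapElem (c := s) (d := r (σ s)) (e (σ s)).hom
      refine homObj_hom_ext' (F := restr σ F) (G := restr σ G) fun s => ?_
      refine Eq.trans ?_ (hl s).symm
      rw [← hg (σ s), reassoc_of% (h₃ s), mapElem_hom_inv, Category.comp_id]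
      rfl

end VFun
end EndExists

section Tensor
variable {V : Type u} [Category.{v} V] [MonoidalCategory V] [SymmetricCategory V]

instance isSkeletallySmall_op {A : Type w} [EnrichedCategory V A] [IsSkeletallySmall V A] :
    IsSkeletallySmall V Aᵒᵖ where
  exists_skeleton := by
    obtain ⟨S, σ, h⟩ := IsSkeletallySmall.exists_skeleton (V := V) A
    refine ⟨S, fun s => op (σ s), fun c => ?_⟩
    obtain ⟨s, ⟨e⟩⟩ := h c.unop
    exact ⟨s, ⟨(forgetEnrichmentOppositeEquivalence.inverse V A).mapIso e.symm.op⟩⟩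

variable {A : Type w} [EnrichedCategory V A]

lemma comp_elem_op {c d e : A} (f : 𝟙_ V ⟶ (d ⟶[V] e)) (g : 𝟙_ V ⟶ (c ⟶[V] d)) :
    (λ_ (𝟙_ V)).inv ≫ (f ⊗ₘ g) ≫ eComp V (op e) (op d) (op c) =
      (λ_ (𝟙_ V)).inv ≫ (g ⊗ₘ f) ≫ eComp V c d e := by
  refine (congrArg ((λ_ (𝟙_ V)).inv ≫ ·) (tensorHom_eComp_op_eq V (x := op c) (y := op d)
    (z := op e) f g)).trans ?_
  dsimp only
  rw [leftUnitor_inv_braiding_assoc, unitors_inv_equal]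

/-- The isomorphism in the opposite `V`-category. -/
def ElemIso.op {c d : A} (e : ElemIso (V := V) c d) :
    ElemIso (V := V) (Opposite.op c) (Opposite.op d) where
  hom := e.inv
  inv := e.hom
  hom_inv_id := (comp_elem_op e.inv e.hom).trans e.hom_inv_id
  inv_hom_id := (comp_elem_op e.hom e.inv).trans e.inv_hom_id

lemma conj_op [MonoidalClosed V] {a b a' b' : A} (e : ElemIso (V := V) a a')
    (i : ElemIso (V := V) b b') :
    VFun.conj (C := Aᵒᵖ) i.op e.op = (VFun.conj e i : (a ⟶[V] b) ⟶ (a' ⟶[V] b')) := by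
  have h1 : (VFun.conj (C := Aᵒᵖ) i.op e.op : (a ⟶[V] b) ⟶ (a' ⟶[V] b')) =
    ((ρ_ _).inv ≫ (a ⟶[V] b) ◁ e.inv ≫ (β_ _ _).hom ≫ eComp V a' a b) ≫
      ((λ_ _).inv ≫ i.hom ▷ (a' ⟶[V] b) ≫ (β_ _ _).hom ≫ eComp V a' b b') := rfl
  rw [h1, VFun.conj, BraidedCategory.braiding_naturality_right_assoc,
    BraidedCategory.braiding_naturality_left_assoc]
  simp only [Category.assoc, leftUnitor_inv_braiding_assoc, rightUnitor_inv_braiding_assoc]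
  rw [rightUnitor_inv_naturality_assoc, leftUnitor_inv_naturality_assoc,
    leftUnitor_inv_naturality_assoc]
  rw [← whisker_exchange_assoc (eComp V a' a b) i.hom,
    whisker_exchange_assoc e.inv (eComp V a b b'), ← e_assoc,
    whisker_exchange_assoc e.inv ((a ⟶[V] b) ◁ i.hom)]
  simp only [← Category.assoc]
  congr 2
  monoidal

end Tensor

section TensorProduct
variable {V : Type u} [Category.{v} V] [MonoidalCategory V] [SymmetricCategory V]
  [MonoidalClosed V] {A : Type w} [EnrichedCategory V A]

namespace VFun

/-- The right action `M(b) ⊗ A(a,b) ⟶ M(a)`. -/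
def actR (M : VFun V Aᵒᵖ) (a b : A) : M.obj (op b) ⊗ (a ⟶[V] b) ⟶ M.obj (op a) :=
  M.act (op b) (op a)

/-- The left action `A(a,b) ⊗ N(a) ⟶ N(b)`. -/
def actL (N : VFun V A) (a b : A) : (a ⟶[V] b) ⊗ N.obj a ⟶ N.obj b :=
  (β_ _ _).hom ≫ N.act a b

/-- The diagram whose colimit is the coend `∫^a M(a) ⊗ N(a)`. -/
def tensorIndex (M : VFun V Aᵒᵖ) (N : VFun V A) : MultispanIndex (MultispanShape.prod A) V where
  left p := (M.obj (op p.2) ⊗ (p.1 ⟶[V] p.2)) ⊗ N.obj p.1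
  right a := M.obj (op a) ⊗ N.obj a
  fst p := M.actR p.1 p.2 ▷ N.obj p.1
  snd p := (α_ _ _ _).hom ≫ M.obj (op p.2) ◁ N.actL p.1 p.2

/-- A family `M(a) ⊗ N(a) ⟶ W` is balanced if it is compatible with the actions. -/
def IsBal (M : VFun V Aᵒᵖ) (N : VFun V A) (W : V)
    (z : ∀ a, M.obj (op a) ⊗ N.obj a ⟶ W) : Prop :=
  ∀ a b, M.actR a b ▷ N.obj a ≫ z a = (α_ _ _ _).hom ≫ M.obj (op b) ◁ N.actL a b ≫ z b

lemma actR_mapElem (M : VFun V Aᵒᵖ) {a a' b b' : A} (e : ElemIso (V := V) a a')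
    (i : ElemIso (V := V) b b') :
    M.actR a b ≫ M.mapElem (c := op a) (d := op a') e.inv =
      M.mapElem (c := op b) (d := op b') i.inv ▷ _ ≫
        M.obj (op b') ◁ (conj e i : (a ⟶[V] b) ⟶ (a' ⟶[V] b')) ≫ M.actR a' b' := by
  rw [← conj_op]
  exact act_conj M i.op e.op

lemma bal_extend {M : VFun V Aᵒᵖ} {N : VFun V A} {W : V} {a a' b b' : A}
    {x : M.obj (op a') ⊗ N.obj a' ⟶ W} {y : M.obj (op b') ⊗ N.obj b' ⟶ W}
    (h : M.actR a' b' ▷ N.obj a' ≫ x = (α_ _ _ _).hom ≫ M.obj (op b') ◁ N.actL a' b' ≫ y)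
    (e : ElemIso (V := V) a a') (i : ElemIso (V := V) b b') :
    M.actR a b ▷ N.obj a ≫
        (M.mapElem (c := op a) (d := op a') e.inv ⊗ₘ N.mapElem e.hom) ≫ x =
      (α_ _ _ _).hom ≫ M.obj (op b) ◁ N.actL a b ≫
        (M.mapElem (c := op b) (d := op b') i.inv ⊗ₘ N.mapElem i.hom) ≫ y := by
  have h2 : N.actL a b ≫ N.mapElem i.hom =
      (conj e i ⊗ₘ N.mapElem e.hom) ≫ N.actL a' b' := by
    rw [actL, actL, Category.assoc, act_conj N e i, BraidedCategory.braiding_naturality_assoc,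
      MonoidalCategory.tensorHom_def, Category.assoc]
  have h1 : M.actR a b ▷ N.obj a ≫
      (M.mapElem (c := op a) (d := op a') e.inv ⊗ₘ N.mapElem e.hom) =
      ((M.mapElem (c := op b) (d := op b') i.inv ⊗ₘ conj e i) ⊗ₘ N.mapElem e.hom) ≫
        M.actR a' b' ▷ N.obj a' := by
    rw [← tensorHom_id, ← tensorHom_id, tensorHom_comp_tensorHom, tensorHom_comp_tensorHom,
      actR_mapElem M e i, Category.id_comp, Category.comp_id,
      MonoidalCategory.tensorHom_def (M.mapElem _), Category.assoc]
  have h3 : M.obj (op b) ◁ N.actL a b ≫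
      (M.mapElem (c := op b) (d := op b') i.inv ⊗ₘ N.mapElem i.hom) =
      (M.mapElem (c := op b) (d := op b') i.inv ⊗ₘ (conj e i ⊗ₘ N.mapElem e.hom)) ≫
        M.obj (op b') ◁ N.actL a' b' := by
    rw [← id_tensorHom, ← id_tensorHom, tensorHom_comp_tensorHom, tensorHom_comp_tensorHom,
      h2, Category.id_comp, Category.comp_id]
  rw [reassoc_of% h1, reassoc_of% h3, h, associator_naturality_assoc]

lemma bal_mapElem {M : VFun V Aᵒᵖ} {N : VFun V A} {W : V} {a b : A}
    {x : M.obj (op a) ⊗ N.obj a ⟶ W} {y : M.obj (op b) ⊗ N.obj b ⟶ W}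
    (hz : M.actR a b ▷ N.obj a ≫ x = (α_ _ _ _).hom ≫ M.obj (op b) ◁ N.actL a b ≫ y)
    (f : 𝟙_ V ⟶ (a ⟶[V] b)) :
    M.mapElem (c := op b) (d := op a) f ▷ N.obj a ≫ x = M.obj (op b) ◁ N.mapElem f ≫ y := by
  have h : M.mapElem (c := op b) (d := op a) f = (ρ_ _).inv ≫ M.obj (op b) ◁ f ≫ M.actR a b := rfl
  rw [h, comp_whiskerRight, comp_whiskerRight, Category.assoc, Category.assoc, hz,
    associator_naturality_middle_assoc]
  have hN : (λ_ _).inv ≫ f ▷ N.obj a ≫ N.actL a b = N.mapElem f := by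
    rw [actL, BraidedCategory.braiding_naturality_left_assoc, leftUnitor_inv_braiding_assoc,
      VFun.mapElem]
  rw [← hN]
  simp

lemma bal_elemIso {M : VFun V Aᵒᵖ} {N : VFun V A} {W : V} {a b : A}
    {x : M.obj (op a) ⊗ N.obj a ⟶ W} {y : M.obj (op b) ⊗ N.obj b ⟶ W}
    (hz : M.actR a b ▷ N.obj a ≫ x = (α_ _ _ _).hom ≫ M.obj (op b) ◁ N.actL a b ≫ y)
    (e : ElemIso (V := V) a b) :
    (M.mapElem (c := op a) (d := op b) e.inv ⊗ₘ N.mapElem e.hom) ≫ y = x := by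
  rw [MonoidalCategory.tensorHom_def, Category.assoc, ← bal_mapElem hz e.hom,
    ← comp_whiskerRight_assoc]
  have : M.mapElem (c := op a) (d := op b) e.inv ≫ M.mapElem (c := op b) (d := op a) e.hom =
      𝟙 _ := M.mapElem_hom_inv e.op
  rw [this, id_whiskerRight, Category.id_comp]

lemma hasMulticoequalizer_of_universal {M : VFun V Aᵒᵖ} {N : VFun V A} {T : V}
    (z : ∀ a, M.obj (op a) ⊗ N.obj a ⟶ T) (hz : IsBal M N T z)
    (huniv : ∀ {W : V} (y : ∀ a, M.obj (op a) ⊗ N.obj a ⟶ W), IsBal M N W y →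
      ∃ f : T ⟶ W, (∀ a, z a ≫ f = y a) ∧ ∀ g : T ⟶ W, (∀ a, z a ≫ g = y a) → g = f) :
    HasMulticoequalizer (tensorIndex M N) := by
  have hK (K : Multicofork (tensorIndex M N)) : IsBal M N K.pt K.π := fun a b =>
    (K.condition (a, b)).trans (Category.assoc _ _ _)
  choose l hl₁ hl₂ using fun K : Multicofork (tensorIndex M N) => huniv _ (hK K)
  exact ⟨⟨⟨Multicofork.ofπ (tensorIndex M N) T z
      (fun p => (hz p.1 p.2).trans (Category.assoc _ _ _).symm),
    Multicofork.IsColimit.mk _ l (fun K a => hl₁ K a) (fun K m hm => hl₂ K m hm)⟩⟩⟩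

instance hasMulticoequalizer_tensorIndex [HasColimitsOfSize.{v, v} V] [IsSkeletallySmall V A]
    (M : VFun V Aᵒᵖ) (N : VFun V A) : HasMulticoequalizer (tensorIndex M N) := by
  obtain ⟨S, σ, r, he⟩ := exists_elemIso V A
  have e := fun c => (he c).some
  let I : MultispanIndex (MultispanShape.prod S) V :=
    { left := fun p => (M.obj (op (σ p.2)) ⊗ (σ p.1 ⟶[V] σ p.2)) ⊗ N.obj (σ p.1)
      right := fun s => M.obj (op (σ s)) ⊗ N.obj (σ s)
      fst := fun p => M.actR (σ p.1) (σ p.2) ▷ N.obj (σ p.1)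
      snd := fun p => (α_ _ _ _).hom ≫ M.obj (op (σ p.2)) ◁ N.actL (σ p.1) (σ p.2) }
  let ζ (s : S) : M.obj (op (σ s)) ⊗ N.obj (σ s) ⟶ multicoequalizer I := Multicoequalizer.π I s
  have hζ (s t : S) : M.actR (σ s) (σ t) ▷ N.obj (σ s) ≫ ζ s =
      (α_ _ _ _).hom ≫ M.obj (op (σ t)) ◁ N.actL (σ s) (σ t) ≫ ζ t :=
    (Multicoequalizer.condition I (s, t)).trans (Category.assoc _ _ _)
  have hz : IsBal M N (multicoequalizer I) (fun a =>
      (M.mapElem (c := op a) (d := op (σ (r a))) (e a).inv ⊗ₘ N.mapElem (e a).hom) ≫ ζ (r a)) :=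
    fun a b => bal_extend (hζ (r a) (r b)) (e a) (e b)
  refine hasMulticoequalizer_of_universal _ hz ?_
  intro W y hy
  have hy' (a : A) : (M.mapElem (c := op a) (d := op (σ (r a))) (e a).inv ⊗ₘ
      N.mapElem (e a).hom) ≫ y (σ (r a)) = y a :=
    bal_elemIso (hy a (σ (r a))) (e a)
  refine ⟨Multicoequalizer.desc I W (fun s => y (σ s))
    (fun p => (hy (σ p.1) (σ p.2)).trans (Category.assoc _ _ _).symm), fun a => ?_,
    fun g hg => ?_⟩
  · have := Multicoequalizer.π_desc I W (fun s => y (σ s))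
      (fun p => (hy (σ p.1) (σ p.2)).trans (Category.assoc _ _ _).symm) (r a)
    rw [Category.assoc]
    exact (congrArg (_ ≫ ·) this).trans (hy' a)
  · refine Multicoequalizer.hom_ext I _ _ fun (s : S) => ?_
    have h1 : ζ s ≫ g = y (σ s) := by
      rw [← hg (σ s), bal_elemIso (hζ s (r (σ s))) (e (σ s))]
    exact h1.trans (Multicoequalizer.π_desc I W (fun s => y (σ s))
      (fun p => (hy (σ p.1) (σ p.2)).trans (Category.assoc _ _ _).symm) s).symm

end VFun
end TensorProduct

section TensorFunctor
variable {V : Type u} [Category.{v} V] [MonoidalCategory V] [SymmetricCategory V]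
  [MonoidalClosed V] {A : Type w} [EnrichedCategory V A]

namespace VFun

section
variable [HasColimitsOfSize.{v, v} V] [IsSkeletallySmall V A]

/-- The tensor product `M ⊗_A N`, i.e. the coend `∫^a M(a) ⊗ N(a)`. -/
def tensorObj (M : VFun V Aᵒᵖ) (N : VFun V A) : V := multicoequalizer (tensorIndex M N)

/-- The morphism `M(a) ⊗ N(a) ⟶ M ⊗_A N` to the coend. -/
def tensorι (M : VFun V Aᵒᵖ) (N : VFun V A) (a : A) :
    M.obj (op a) ⊗ N.obj a ⟶ tensorObj M N :=
  Multicoequalizer.π (tensorIndex M N) a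

lemma isBal_tensorι (M : VFun V Aᵒᵖ) (N : VFun V A) : IsBal M N _ (tensorι M N) := fun a b =>
  (Multicoequalizer.condition (tensorIndex M N) (a, b)).trans (Category.assoc _ _ _)

variable {M : VFun V Aᵒᵖ} {N : VFun V A}

/-- The morphism from the coend given by a balanced family. -/
def tensorDesc {W : V} (z : ∀ a, M.obj (op a) ⊗ N.obj a ⟶ W) (hz : IsBal M N W z) :
    tensorObj M N ⟶ W :=
  Multicoequalizer.desc (tensorIndex M N) W z
    (fun p => (hz p.1 p.2).trans (Category.assoc _ _ _).symm)

lemma tensorι_desc {W : V} (z : ∀ a, M.obj (op a) ⊗ N.obj a ⟶ W) (hz : IsBal M N W z) (a : A) :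
    tensorι M N a ≫ tensorDesc z hz = z a :=
  Multicoequalizer.π_desc (tensorIndex M N) W z _ a

lemma tensorObj_hom_ext {W : V} {f g : tensorObj M N ⟶ W}
    (h : ∀ a, tensorι M N a ≫ f = tensorι M N a ≫ g) : f = g :=
  Multicoequalizer.hom_ext (tensorIndex M N) _ _ h

lemma tensorObj_whisker_hom_ext {K W : V} {f g : tensorObj M N ⊗ K ⟶ W}
    (h : ∀ a, tensorι M N a ▷ K ≫ f = tensorι M N a ▷ K ≫ g) : f = g := by
  rw [← cancel_epi (β_ K (tensorObj M N)).hom]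
  apply MonoidalClosed.curry_injective
  refine tensorObj_hom_ext fun a => ?_
  rw [← MonoidalClosed.curry_natural_left, ← MonoidalClosed.curry_natural_left,
    BraidedCategory.braiding_naturality_right_assoc,
    BraidedCategory.braiding_naturality_right_assoc, h]

variable {M' : VFun V Aᵒᵖ} {K : V}

lemma isBal_of_isNat {y : ∀ a : Aᵒᵖ, M.obj a ⊗ K ⟶ M'.obj a} (hy : IsNat M M' K y) (a b : A) :
    (M.actR a b ▷ N.obj a) ▷ K ≫ swapR _ _ _ ≫ y (op a) ▷ N.obj a ≫ tensorι M' N a =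
      (α_ _ _ _).hom ▷ K ≫ (M.obj (op b) ◁ N.actL a b) ▷ K ≫
        swapR _ _ _ ≫ y (op b) ▷ N.obj b ≫ tensorι M' N b := by
  have h : M.actR a b ▷ K ≫ y (op a) = swapR _ _ _ ≫ y (op b) ▷ (a ⟶[V] b) ≫ M'.actR a b :=
    hy (op b) (op a)
  have h' := isBal_tensorι M' N a b
  rw [reassoc_of% (@swapR_natural_left), ← comp_whiskerRight_assoc, h,
    reassoc_of% (@swapR_natural_middle), whisker_exchange_assoc]
  simp only [comp_whiskerRight, Category.assoc]
  rw [h', associator_naturality_left_assoc]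
  simp only [← Category.assoc]
  congr 3
  simp only [swapR, Category.assoc, comp_whiskerRight, BraidedCategory.braiding_tensor_left_hom]
  simp

lemma isBal_curry {y : ∀ a : Aᵒᵖ, M.obj a ⊗ K ⟶ M'.obj a} (hy : IsNat M M' K y) :
    IsBal M N _ (fun a => MonoidalClosed.curry
      ((β_ _ _).hom ≫ swapR _ _ _ ≫ y (op a) ▷ N.obj a ≫ tensorι M' N a)) := by
  intro a b
  rw [← MonoidalClosed.curry_natural_left, ← MonoidalClosed.curry_natural_left,
    ← MonoidalClosed.curry_natural_left]
  congr 1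
  simp only [BraidedCategory.braiding_naturality_right_assoc]
  rw [isBal_of_isNat hy]

/-- The morphism `(M ⊗_A N) ⊗ K ⟶ M' ⊗_A N` induced by a natural family `M(a) ⊗ K ⟶ M'(a)`. -/
def tensorMapParam (N : VFun V A) (y : ∀ a : Aᵒᵖ, M.obj a ⊗ K ⟶ M'.obj a) (hy : IsNat M M' K y) :
    tensorObj M N ⊗ K ⟶ tensorObj M' N :=
  (β_ _ _).hom ≫ MonoidalClosed.uncurry (tensorDesc _ (isBal_curry (N := N) hy))

lemma tensorι_mapParam (y : ∀ a : Aᵒᵖ, M.obj a ⊗ K ⟶ M'.obj a) (hy : IsNat M M' K y) (a : A) :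
    tensorι M N a ▷ K ≫ tensorMapParam N y hy = 
      swapR _ _ _ ≫ y (op a) ▷ N.obj a ≫ tensorι M' N a := by
  rw [tensorMapParam, BraidedCategory.braiding_naturality_left_assoc,
    ← MonoidalClosed.uncurry_natural_left, tensorι_desc, MonoidalClosed.uncurry_curry,
    SymmetricCategory.symmetry_assoc]

lemma whiskerLeft_mapParam {y : ∀ a : Aᵒᵖ, M.obj a ⊗ K ⟶ M'.obj a} (hy : IsNat M M' K y)
    {L : V} (f : L ⟶ K) {y' : ∀ a : Aᵒᵖ, M.obj a ⊗ L ⟶ M'.obj a} (hy' : IsNat M M' L y')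
    (h : ∀ a, M.obj a ◁ f ≫ y a = y' a) :
    tensorObj M N ◁ f ≫ tensorMapParam N y hy = tensorMapParam N y' hy' :=
  tensorObj_whisker_hom_ext fun a => by
    rw [← whisker_exchange_assoc, tensorι_mapParam, tensorι_mapParam,
      reassoc_of% (@swapR_natural_right), ← comp_whiskerRight_assoc, h]

lemma mapParam_unit {y : ∀ a : Aᵒᵖ, M.obj a ⊗ 𝟙_ V ⟶ M.obj a} (hy : IsNat M M (𝟙_ V) y)
    (h : ∀ a, y a = (ρ_ _).hom) : tensorMapParam N y hy = (ρ_ _).hom :=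
  tensorObj_whisker_hom_ext fun a => by
    rw [tensorι_mapParam, h, reassoc_of% (@swapR_unit), rightUnitor_naturality]

lemma mapParam_comp {M'' : VFun V Aᵒᵖ} {L : V} {y : ∀ a : Aᵒᵖ, M.obj a ⊗ K ⟶ M'.obj a}
    (hy : IsNat M M' K y) {z : ∀ a : Aᵒᵖ, M'.obj a ⊗ L ⟶ M''.obj a} (hz : IsNat M' M'' L z) :
    tensorMapParam N _ (isNat_comp hy hz) =
      (α_ _ _ _).inv ≫ tensorMapParam N y hy ▷ L ≫ tensorMapParam N z hz :=
  tensorObj_whisker_hom_ext fun a => by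
    rw [tensorι_mapParam, associator_inv_naturality_left_assoc, ← comp_whiskerRight_assoc,
      tensorι_mapParam]
    simp only [comp_whiskerRight, Category.assoc]
    rw [tensorι_mapParam, reassoc_of% (@swapR_tensor), reassoc_of% (@swapR_natural_left)]

end

variable (V A) in
/-- The `V`-category of finitely presented right `A`-modules, a full `V`-subcategory of the
`V`-category of right `A`-modules. -/
abbrev _root_.EnrichedModule.FPMod : Type _ :=
  (ObjectProperty.isFinitelyPresentable.{v} (VFun V Aᵒᵖ)).FullSubcategory

variable [HasLimitsOfSize.{v, v} V] [HasColimitsOfSize.{v, v} V] [IsSkeletallySmall V A]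

/-- The `V`-functor `- ⊗_A N` on finitely presented right `A`-modules. Its structure morphisms
`(M ⊗_A N) ⊗ [M, M'] ⟶ M' ⊗_A N` are induced by the evaluations `M(a) ⊗ [M, M'] ⟶ M'(a)`. -/
def tensorFunctor (N : VFun V A) : VFun V (FPMod V A) :=
  ofAct (fun M => tensorObj M.obj N)
    (fun M M' => tensorMapParam N (homEv M.obj M'.obj) (isNat_homEv M.obj M'.obj))
    (fun M => (whiskerLeft_mapParam (isNat_homEv M.obj M.obj) (eId V M)
        (isNat_of_hom (𝟙 M.obj)) (homLift_ev _ (isNat_of_hom (𝟙 M.obj)))).trans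
      (mapParam_unit _ (fun _ => Category.comp_id _)))
    (fun M M' M'' => (whiskerLeft_mapParam (isNat_homEv M.obj M''.obj) (eComp V M M' M'')
        (isNat_comp (isNat_homEv M.obj M'.obj) (isNat_homEv M'.obj M''.obj))
        (fun a => homLift_ev _ (isNat_comp (isNat_homEv M.obj M'.obj)
          (isNat_homEv M'.obj M''.obj)) a)).trans (mapParam_comp _ _))

end VFun
end TensorFunctor

section Conditions

/-- The base category has a finitely presented unit and a small generating family of dualizable
objects. -/
class HasDualizableGenerators (V : Type u) [Category.{v} V] [MonoidalCategory V] : Prop where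
  isFinitelyPresentable_unit : IsFinitelyPresentable.{v} (𝟙_ V)
  exists_generators : ∃ (ι : Type v) (g : ι → V),
    (∀ i, ∃ d : V, Nonempty (ExactPairing (g i) d)) ∧ (ObjectProperty.ofObj g).IsSeparating

/-- An object is finitely generated if, whenever it is the sum (i.e. the supremum) of a family of
subobjects, it is already the sum of finitely many of them. -/
def IsFinitelyGenerated {D : Type u} [Category.{v} D] (Y : D) : Prop :=
  ∀ s : Set (Subobject Y), IsLUB s ⊤ →
    ∃ t : Set (Subobject Y), t ⊆ s ∧ t.Finite ∧ IsLUB t ⊤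

/-- An object is coherent if it is finitely presented and every finitely generated subobject of it
is finitely presented. The size `w` is the size of the filtered colimits considered. -/
def IsCoherent {D : Type u} [Category.{v} D] (Y : D) : Prop :=
  IsFinitelyPresentable.{w} Y ∧
    ∀ (Z : D) (i : Z ⟶ Y), Mono i → IsFinitelyGenerated Z → IsFinitelyPresentable.{w} Z

variable (V : Type u) [Category.{v} V] [Abelian V] [IsGrothendieckAbelian.{v} V]
  [MonoidalCategory V] [SymmetricCategory V] [MonoidalClosed V]
  (A : Type w) [EnrichedCategory V A] [IsSkeletallySmall V A]

/-- The category of generalised `A`-modules: the `V`-functors from finitely presented right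
`A`-modules to `V`. -/
abbrev GenMod : Type _ := VFun V (FPMod V A)

variable {V A}

/-- The action of a generalised module on a morphism of finitely presented right modules. -/
def GenMod.map (X : GenMod V A) {K L : FPMod V A} (f : K ⟶ L) : X.obj K ⟶ X.obj L :=
  X.mapElem (eHomEquiv V f)

/-- A generalised module is right exact if it sends every sequence `K ⟶ L ⟶ M ⟶ 0` of finitely
presented right modules which is exact (in the category of all right modules) to an exact sequence
in `V`. -/
def GenMod.IsRightExact (X : GenMod V A) : Prop :=
  ∀ (K L M : FPMod V A) (f : K ⟶ L) (g : L ⟶ M) (h : f.hom ≫ g.hom = 0),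
    (ShortComplex.mk f.hom g.hom h).Exact → Epi g.hom →
      ∃ h' : X.map f ≫ X.map g = 0, (ShortComplex.mk (X.map f) (X.map g) h').Exact ∧ Epi (X.map g)

/-- A generalised module `X` is coh-injective if the functor `[-, X]`, where
`[Y, X] = ∫_M [Y(M), X(M)]` is the `V`-object of `V`-natural transformations, exists and is exact
on coherent generalised modules, i.e. it sends every short exact sequence
`0 ⟶ Y₁ ⟶ Y₂ ⟶ Y₃ ⟶ 0` of coherent generalised modules to a short exact sequence
`0 ⟶ [Y₃, X] ⟶ [Y₂, X] ⟶ [Y₁, X] ⟶ 0` in `V`. -/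
def GenMod.IsCohInjective (X : GenMod V A) : Prop :=
  ∀ S : ShortComplex (GenMod V A), S.ShortExact →
    IsCoherent.{v} S.X₁ → IsCoherent.{v} S.X₂ → IsCoherent.{v} S.X₃ →
      ∃ (_ : HasMultiequalizer (VFun.endIndex S.X₁ X)) (_ : HasMultiequalizer (VFun.endIndex S.X₂ X))
        (_ : HasMultiequalizer (VFun.endIndex S.X₃ X))
        (h : VFun.homPre X S.g ≫ VFun.homPre X S.f = 0),
        (ShortComplex.mk (VFun.homPre X S.g) (VFun.homPre X S.f) h).ShortExact

end Conditions

end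

end EnrichedModule

open CategoryTheory Limits MonoidalCategory Opposite
open scoped MonoidalClosed

set_option linter.unusedSectionVars false

namespace EnrichedModule

/-! Everything is read through the enriched Yoneda lemma `homCorepIso`: for M in mod A the
corepresentable generalised module `corep V M` satisfies [corep M, X] ≅ X(M). A right exact sequence
K → L → M → 0 in mod A gives an exact sequence 0 → corep M → corep L → corep K, and [-, X] sends it
back to X(K) → X(L) → X(M) → 0. So right exactness of X says how [-, X] acts on corepresentables,
and coh-injectivity says the same on all coherent objects.

The unit of V need not be projective, so corepresentables are not projective either. Dualizable
generators compensate for this. A V-functor F satisfies F(M ⊗ d) ≅ F(M) ⊗ d for dualizable d, hence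
an element of F(M) defined over a generator is an ordinary element of F at another finitely
presented module (`TensorData.elem`). Therefore corepresentables separate morphisms
(`eq_zero_of_corep`) and, since the unit is finitely presented, a morphism from one of them lifts
along an epimorphism after passing to a single corepresentable cover (`exists_lift`).

1 ⇔ 2. Finitely presented generalised modules are coherent: mod A has pushouts, corep turns them
into pullbacks, and so kernels of maps out of corepresentables are again covered by corepresentables
(`exists_corep_kernel`). Thus coh-injectivity applies to the sequence above and gives 2. Conversely
[-, X] is always left exact, being a right adjoint (`isRightAdjoint_homFunctor`). Only extension
along a monomorphism is at stake; it is proved for suitable subobjects of a corepresentable from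
right exactness (`epi_homPre_of_mono_corep`) and carried to general coherent sequences by a cover of
the middle term.

2 ⇔ 3. The functor − ⊗_A N preserves colimits, and cokernels in mod A are computed among all
modules. Conversely let N be the restriction of X to representables. The canonical map − ⊗_A N → X
is invertible on representables by the co-Yoneda lemma, on their tensors with dualizable objects
because V-functors preserve these, and then on all of mod A, since both sides preserve finite
colimits and these modules generate mod A under finite colimits (`isFinitelyPresentable_induction`).
-/

noncomputable section

/-! ### Pointwise limits and colimits of V-functors; the abelian structure. -/

section Pointwise

universe v' u'

variable {V : Type u} [Category.{v} V] [MonoidalCategory V] [SymmetricCategory V]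
  [MonoidalClosed V]

/-- The comparison of colimits: a colimit cocone tensored with an object on the right. -/
def whiskerRightIsColimit {J : Type u'} [Category.{v'} J] {K : J ⥤ V} {c : Cocone K}
    (hc : IsColimit c) (X : V) : IsColimit ((tensorRight X).mapCocone c) :=
  isColimitOfPreserves (tensorRight X) hc

/-- As V is closed, tensoring preserves colimits. This is what allows actions on pointwise colimits
to be defined and compared on the inclusions. -/
lemma whiskerRight_hom_ext {J : Type u'} [Category.{v'} J] {K : J ⥤ V} {c : Cocone K}
    (hc : IsColimit c) {X Y : V} {f g : c.pt ⊗ X ⟶ Y}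
    (h : ∀ j, c.ι.app j ▷ X ≫ f = c.ι.app j ▷ X ≫ g) : f = g :=
  (whiskerRightIsColimit hc X).hom_ext h

namespace VFun

variable {C : Type w} [EnrichedCategory V C]

variable (V) in
/-- Evaluation of `V`-functors at an object. -/
@[simps]
def ev (c : C) : VFun V C ⥤ V where
  obj F := F.obj c
  map f := Hom.app f c

section OfAct

variable {obj : C → V} {act : ∀ c d, obj c ⊗ (c ⟶[V] d) ⟶ obj d}
  {h₁ : ∀ c, obj c ◁ eId V c ≫ act c c = (ρ_ (obj c)).hom}
  {h₂ : ∀ c d e, obj c ◁ eComp V c d e ≫ act c e =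
      (α_ _ _ _).inv ≫ act c d ▷ (d ⟶[V] e) ≫ act d e} {F : VFun V C}

/-- A `V`-natural transformation to a `V`-functor given by its structure morphisms. -/
def homOfAct (app : ∀ c, F.obj c ⟶ obj c)
    (h : ∀ c d, F.act c d ≫ app d = app c ▷ (c ⟶[V] d) ≫ act c d) : F ⟶ ofAct obj act h₁ h₂ where
  app := app
  naturality c d := by
    rw [ofAct_act]
    exact h c d

/-- A `V`-natural transformation from a `V`-functor given by its structure morphisms. -/
def ofActHom (app : ∀ c, obj c ⟶ F.obj c)
    (h : ∀ c d, act c d ≫ app d = app c ▷ (c ⟶[V] d) ≫ F.act c d) : ofAct obj act h₁ h₂ ⟶ F where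
  app := app
  naturality c d := by
    rw [ofAct_act]
    exact h c d

end OfAct

variable {J : Type u'} [Category.{v'} J] (K : J ⥤ VFun V C)

lemma map_act (i j : J) (f : i ⟶ j) (x y : C) :
    (K.obj i).act x y ≫ (K.map f).app y = (K.map f).app x ▷ _ ≫ (K.obj j).act x y :=
  (K.map f).naturality x y

section Limits

variable (c : ∀ x : C, LimitCone (K ⋙ ev V x))

/-- The projections of a pointwise limit, at an object. -/
def limitProj (x : C) (j : J) : (c x).cone.pt ⟶ (K.obj j).obj x :=
  (c x).cone.π.app j

lemma limitProj_map (x : C) {i j : J} (f : i ⟶ j) :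
    limitProj K c x i ≫ (K.map f).app x = limitProj K c x j :=
  (c x).cone.w f

lemma limitProj_hom_ext (x : C) {W : V} {f g : W ⟶ (c x).cone.pt}
    (h : ∀ j, f ≫ limitProj K c x j = g ≫ limitProj K c x j) : f = g :=
  (c x).isLimit.hom_ext h

/-- The action on a pointwise limit. -/
def limitAct (x y : C) : (c x).cone.pt ⊗ (x ⟶[V] y) ⟶ (c y).cone.pt :=
  (c y).isLimit.lift
    { pt := _
      π :=
        { app := fun j => limitProj K c x j ▷ _ ≫ (K.obj j).act x y
          naturality := fun i j f => by
            have h : limitProj K c x j ▷ _ ≫ (K.obj j).act x y =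
                (limitProj K c x i ▷ _ ≫ (K.obj i).act x y) ≫ (K.map f).app y := by
              rw [← limitProj_map K c x f, comp_whiskerRight, Category.assoc, Category.assoc,
                map_act]
            exact (Category.id_comp _).trans h } }

lemma limitAct_proj (x y : C) (j : J) :
    limitAct K c x y ≫ limitProj K c y j = limitProj K c x j ▷ _ ≫ (K.obj j).act x y :=
  (c y).isLimit.fac _ j

/-- The pointwise limit of a diagram of `V`-functors. -/
abbrev limitObj : VFun V C :=
  ofAct (fun x => (c x).cone.pt) (limitAct K c)
    (fun x => limitProj_hom_ext K c x fun j => by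
      rw [Category.assoc, limitAct_proj, whisker_exchange_assoc, act_id, rightUnitor_naturality])
    (fun x y z => limitProj_hom_ext K c z fun j => by
      simp only [Category.assoc, limitAct_proj]
      rw [← comp_whiskerRight_assoc, limitAct_proj, whisker_exchange_assoc, act_comp]
      simp)

/-- The projections of the pointwise limit. -/
def limitObjProj (j : J) : limitObj K c ⟶ K.obj j :=
  ofActHom (fun x => limitProj K c x j) fun x y => limitAct_proj K c x y j

/-- The pointwise limit cone of a diagram of `V`-functors. -/
def limitCone : Cone K where
  pt := limitObj K c
  π :=
    { app := limitObjProj K c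
      naturality := fun i j f => by
        have h : limitObjProj K c i ≫ K.map f = limitObjProj K c j :=
          hom_ext fun x => limitProj_map K c x f
        exact (Category.id_comp _).trans h.symm }

/-- The components of the universal morphism to a pointwise limit. -/
def limitLift (s : Cone K) (x : C) : s.pt.obj x ⟶ (c x).cone.pt :=
  (c x).isLimit.lift ((ev V x).mapCone s)

lemma limitLift_proj (s : Cone K) (x : C) (j : J) :
    limitLift K c s x ≫ limitProj K c x j = Hom.app (s.π.app j) x :=
  (c x).isLimit.fac _ j

/-- The universal morphism to a pointwise limit. -/
def limitObjLift (s : Cone K) : s.pt ⟶ limitObj K c :=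
  homOfAct (fun x => limitLift K c s x)
    (fun x y => limitProj_hom_ext K c y fun j => by
      rw [Category.assoc, Category.assoc, limitAct_proj, limitLift_proj,
        ← comp_whiskerRight_assoc, limitLift_proj]
      exact (s.π.app j).naturality x y)

/-- The pointwise limit cone is a limit cone. -/
def isLimitLimitCone : IsLimit (limitCone K c) where
  lift s := limitObjLift K c s
  fac s j := hom_ext fun x => limitLift_proj K c s x j
  uniq s _ hm := hom_ext fun x => limitProj_hom_ext K c x fun j =>
    (congrArg (fun f => Hom.app f x) (hm j)).trans (limitLift_proj K c s x j).symm

/-- The value of the pointwise limit cone is a limit cone. -/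
def isLimitMapLimitCone (x : C) : IsLimit ((ev V x).mapCone (limitCone K c)) :=
  IsLimit.ofIsoLimit (c x).isLimit (Cone.ext (Iso.refl _) fun _ => (Category.id_comp _).symm)

end Limits

section Colimits

variable (c : ∀ x : C, ColimitCocone (K ⋙ ev V x))

/-- The inclusions of a pointwise colimit, at an object. -/
def colimitIncl (x : C) (j : J) : (K.obj j).obj x ⟶ (c x).cocone.pt :=
  (c x).cocone.ι.app j

lemma map_colimitIncl (x : C) {i j : J} (f : i ⟶ j) :
    (K.map f).app x ≫ colimitIncl K c x j = colimitIncl K c x i :=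
  (c x).cocone.w f

lemma colimitIncl_hom_ext (x : C) {X W : V} {f g : (c x).cocone.pt ⊗ X ⟶ W}
    (h : ∀ j, colimitIncl K c x j ▷ X ≫ f = colimitIncl K c x j ▷ X ≫ g) : f = g :=
  whiskerRight_hom_ext (c x).isColimit h

/-- The action on a pointwise colimit. -/
def colimitAct (x y : C) : (c x).cocone.pt ⊗ (x ⟶[V] y) ⟶ (c y).cocone.pt :=
  (whiskerRightIsColimit (c x).isColimit (x ⟶[V] y)).desc
    { pt := _
      ι :=
        { app := fun j => (K.obj j).act x y ≫ colimitIncl K c y j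
          naturality := fun i j f => by
            have h : (K.map f).app x ▷ _ ≫ (K.obj j).act x y ≫ colimitIncl K c y j =
                (K.obj i).act x y ≫ colimitIncl K c y i := by
              rw [← map_colimitIncl K c y f, reassoc_of% map_act]
            exact h.trans (Category.comp_id _).symm } }

lemma incl_colimitAct (x y : C) (j : J) :
    colimitIncl K c x j ▷ _ ≫ colimitAct K c x y = (K.obj j).act x y ≫ colimitIncl K c y j :=
  (whiskerRightIsColimit (c x).isColimit (x ⟶[V] y)).fac _ j

/-- The pointwise colimit of a diagram of `V`-functors. -/
abbrev colimitObj : VFun V C :=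
  ofAct (fun x => (c x).cocone.pt) (colimitAct K c)
    (fun x => colimitIncl_hom_ext K c x fun j => by
      rw [← whisker_exchange_assoc, incl_colimitAct, rightUnitor_naturality,
        reassoc_of% (act_id (K.obj j) x)])
    (fun x y z => colimitIncl_hom_ext K c x fun j => by
      rw [← whisker_exchange_assoc, incl_colimitAct, associator_inv_naturality_left_assoc,
        ← comp_whiskerRight_assoc, incl_colimitAct, comp_whiskerRight_assoc, incl_colimitAct,
        reassoc_of% (act_comp (K.obj j) x y z)])

/-- The inclusions of the pointwise colimit. -/
def colimitObjIncl (j : J) : K.obj j ⟶ colimitObj K c :=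
  homOfAct (fun x => colimitIncl K c x j) fun x y => (incl_colimitAct K c x y j).symm

/-- The pointwise colimit cocone of a diagram of `V`-functors. -/
def colimitCocone : Cocone K where
  pt := colimitObj K c
  ι :=
    { app := colimitObjIncl K c
      naturality := fun i j f => by
        have h : K.map f ≫ colimitObjIncl K c j = colimitObjIncl K c i :=
          hom_ext fun x => map_colimitIncl K c x f
        exact h.trans (Category.comp_id _).symm }

/-- The components of the universal morphism from a pointwise colimit. -/
def colimitDesc (s : Cocone K) (x : C) : (c x).cocone.pt ⟶ s.pt.obj x :=
  (c x).isColimit.desc ((ev V x).mapCocone s)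

lemma incl_colimitDesc (s : Cocone K) (x : C) (j : J) :
    colimitIncl K c x j ≫ colimitDesc K c s x = Hom.app (s.ι.app j) x :=
  (c x).isColimit.fac _ j

/-- The universal morphism from a pointwise colimit. -/
def colimitObjDesc (s : Cocone K) : colimitObj K c ⟶ s.pt :=
  ofActHom (fun x => colimitDesc K c s x)
    (fun x y => colimitIncl_hom_ext K c x fun j => by
      rw [reassoc_of% incl_colimitAct, incl_colimitDesc, ← comp_whiskerRight_assoc,
        incl_colimitDesc]
      exact (s.ι.app j).naturality x y)

/-- The pointwise colimit cocone is a colimit cocone. -/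
def isColimitColimitCocone : IsColimit (colimitCocone K c) where
  desc s := colimitObjDesc K c s
  fac s j := hom_ext fun x => incl_colimitDesc K c s x j
  uniq s _ hm := hom_ext fun x => (c x).isColimit.hom_ext fun j =>
    (congrArg (fun f => Hom.app f x) (hm j)).trans (incl_colimitDesc K c s x j).symm

/-- The value of the pointwise colimit cocone is a colimit cocone. -/
def isColimitMapColimitCocone (x : C) : IsColimit ((ev V x).mapCocone (colimitCocone K c)) :=
  IsColimit.ofIsoColimit (c x).isColimit
    (Cocone.ext (Iso.refl _) fun _ => Category.comp_id _)

end Colimits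

variable (J)

instance hasLimitsOfShape [HasLimitsOfShape J V] : HasLimitsOfShape J (VFun V C) where
  has_limit K := ⟨⟨_, isLimitLimitCone K fun x => getLimitCone (K ⋙ ev V x)⟩⟩

instance hasColimitsOfShape [HasColimitsOfShape J V] : HasColimitsOfShape J (VFun V C) where
  has_colimit K := ⟨⟨_, isColimitColimitCocone K fun x => getColimitCocone (K ⋙ ev V x)⟩⟩

instance preservesLimitsOfShape_ev [HasLimitsOfShape J V] (c : C) :
    PreservesLimitsOfShape J (ev V c) where
  preservesLimit {K} := preservesLimit_of_preserves_limit_cone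
    (isLimitLimitCone K fun x => getLimitCone (K ⋙ ev V x)) (isLimitMapLimitCone K _ c)

instance preservesColimitsOfShape_ev [HasColimitsOfShape J V] (c : C) :
    PreservesColimitsOfShape J (ev V c) where
  preservesColimit {K} := preservesColimit_of_preserves_colimit_cocone
    (isColimitColimitCocone K fun x => getColimitCocone (K ⋙ ev V x))
    (isColimitMapColimitCocone K _ c)

instance hasColimitsOfSize [HasColimitsOfSize.{v', u'} V] :
    HasColimitsOfSize.{v', u'} (VFun V C) where

instance [HasFiniteLimits V] : HasFiniteLimits (VFun V C) where
  out _ _ _ := inferInstance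

instance [HasFiniteColimits V] : HasFiniteColimits (VFun V C) where
  out _ _ _ := inferInstance

instance [HasFiniteLimits V] (c : C) : PreservesFiniteLimits (ev V c) where
  preservesFiniteLimits _ _ _ := inferInstance

instance [HasFiniteColimits V] (c : C) : PreservesFiniteColimits (ev V c) where
  preservesFiniteColimits _ _ _ := inferInstance

variable {J}

lemma isIso_of_isIso_app {F G : VFun V C} (f : F ⟶ G) (h : ∀ c, IsIso (f.app c)) : IsIso f :=
  (isoMk (fun c => @asIso _ _ _ _ (f.app c) (h c)) (fun c d => f.naturality c d)).isIso_hom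

instance isIso_app {F G : VFun V C} (f : F ⟶ G) [IsIso f] (c : C) : IsIso (f.app c) :=
  inferInstanceAs (IsIso ((ev V c).map f))

instance epi_app [HasFiniteColimits V] {F G : VFun V C} (f : F ⟶ G) [Epi f] (c : C) :
    Epi (f.app c) :=
  inferInstanceAs (Epi ((ev V c).map f))

section Abelian

variable [Abelian V]

instance additive_ev (c : C) : (ev V c).Additive where
  map_add := rfl

instance : HasFiniteProducts (VFun V C) := inferInstance

/-- Evaluations are additive, preserve finite limits and colimits, and jointly reflect isomorphisms;
each value of the coimage-image comparison is the comparison of the abelian category V. -/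
instance : Abelian (VFun V C) := by
  have (F G : VFun V C) (f : F ⟶ G) : IsIso (Abelian.coimageImageComparison f) := by
    refine isIso_of_isIso_app _ fun c => ?_
    change IsIso ((ev V c).map (Abelian.coimageImageComparison f))
    have e := Abelian.PreservesCoimageImageComparison.iso (ev V c) f
    exact ((MorphismProperty.isomorphisms V).arrow_mk_iso_iff e).2
      (MorphismProperty.isomorphisms.infer_property _)
  exact Abelian.ofCoimageImageComparisonIsIso

end Abelian

end VFun

end Pointwise

/-! ### Corepresentable V-functors, the enriched Yoneda lemma, cotensors. -/

section Representable

variable {V : Type u} [Category.{v} V] [MonoidalCategory V]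

namespace VFun

section

variable [MonoidalClosed V] {C : Type w} [EnrichedCategory V C]

/-- Construct a `V`-functor from its structure morphisms; this agrees with `ofAct`, and its values
are reducible. -/
abbrev mkAct (obj : C → V) (act : ∀ c d, obj c ⊗ (c ⟶[V] d) ⟶ obj d)
    (act_id : ∀ c, obj c ◁ eId V c ≫ act c c = (ρ_ (obj c)).hom)
    (act_comp : ∀ c d e, obj c ◁ eComp V c d e ≫ act c e =
      (α_ _ _ _).inv ≫ act c d ▷ (d ⟶[V] e) ≫ act d e) : VFun V C where
  toEnriched :=
    { obj := obj
      map := fun c d => MonoidalClosed.curry (act c d)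
      map_id := (ofAct obj act act_id act_comp).toEnriched.map_id
      map_comp := (ofAct obj act act_id act_comp).toEnriched.map_comp }

@[simp]
lemma mkAct_act (obj : C → V) (act : ∀ c d, obj c ⊗ (c ⟶[V] d) ⟶ obj d) (h₁) (h₂) (c d : C) :
    (mkAct obj act h₁ h₂).act c d = act c d :=
  MonoidalClosed.uncurry_curry _

variable (V) in
/-- The `V`-functor corepresented by an object. -/
abbrev corep (c : C) : VFun V C :=
  mkAct (fun d => (c ⟶[V] d)) (fun d e => eComp V c d e)
    (fun d => by
      rw [← cancel_epi (ρ_ _).inv, Iso.inv_hom_id]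
      exact e_comp_id V c d)
    (fun d e f => (e_assoc V c d e f).symm)

lemma corep_act (c d e : C) : (corep V c).act d e = eComp V c d e := mkAct_act _ _ _ _ _ _

/-- The morphism from a corepresentable `V`-functor given by an element. -/
def corepHom {F : VFun V C} {c : C} (x : 𝟙_ V ⟶ F.obj c) : corep V c ⟶ F where
  app d := (λ_ _).inv ≫ x ▷ (c ⟶[V] d) ≫ F.act c d
  naturality d e := by
    simp only [corep_act, comp_whiskerRight, Category.assoc]
    rw [leftUnitor_inv_naturality_assoc, whisker_exchange_assoc, act_comp]
    simp

lemma corepHom_app {F : VFun V C} {c : C} (x : 𝟙_ V ⟶ F.obj c) (d : C) :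
    (corepHom x).app d = (λ_ _).inv ≫ x ▷ (c ⟶[V] d) ≫ F.act c d := rfl

lemma eId_corepHom {F : VFun V C} {c : C} (x : 𝟙_ V ⟶ F.obj c) :
    eId V c ≫ (corepHom x).app c = x := by
  rw [corepHom_app, leftUnitor_inv_naturality_assoc, whisker_exchange_assoc, act_id]
  simp [unitors_inv_equal]

lemma corepHom_eId {F : VFun V C} {c : C} (f : corep V c ⟶ F) :
    corepHom (eId V c ≫ f.app c) = f := by
  ext d
  rw [corepHom_app, comp_whiskerRight_assoc, ← f.naturality, corep_act]
  exact (e_id_comp_assoc V c d (f.app d))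

lemma corep_hom_ext {F : VFun V C} {c : C} {f g : corep V c ⟶ F}
    (h : eId V c ≫ f.app c = eId V c ≫ g.app c) : f = g := by
  rw [← corepHom_eId f, ← corepHom_eId g, h]

lemma corepHom_comp {F G : VFun V C} {c : C} (x : 𝟙_ V ⟶ F.obj c) (f : F ⟶ G) :
    corepHom x ≫ f = corepHom (x ≫ f.app c) :=
  corep_hom_ext (by rw [comp_app, reassoc_of% eId_corepHom, eId_corepHom])

/-- The Yoneda lemma for morphisms from a corepresentable `V`-functor. -/
def corepEquiv (F : VFun V C) (c : C) : (corep V c ⟶ F) ≃ (𝟙_ V ⟶ F.obj c) where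
  toFun f := eId V c ≫ f.app c
  invFun x := corepHom x
  left_inv f := corepHom_eId f
  right_inv x := eId_corepHom x

end

variable [SymmetricCategory V] [MonoidalClosed V] {C : Type w} [EnrichedCategory V C]

lemma isNat_corep_of_obj (F : VFun V C) (c : C) :
    IsNat (corep V c) F (F.obj c) (fun d => (β_ (c ⟶[V] d) (F.obj c)).hom ≫ F.act c d) := by
  intro d e
  rw [corep_act, BraidedCategory.braiding_naturality_left_assoc, act_comp]
  simp only [comp_whiskerRight, ← Category.assoc]
  congr 2
  simp [swapR]

/-- The uniqueness half of enriched Yoneda: inserting the identity of c into the naturality square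
from c to d shows that the whole family is determined by its value at that identity. -/
lemma IsNat.corep_eq {F : VFun V C} {c : C} {W : V} {y : ∀ d, (c ⟶[V] d) ⊗ W ⟶ F.obj d}
    (hy : IsNat (corep V c) F W y) (d : C) :
    y d = (c ⟶[V] d) ◁ ((λ_ W).inv ≫ eId V c ▷ W ≫ y c) ≫ (β_ _ _).hom ≫ F.act c d := by
  have h := hy c d
  rw [corep_act] at h
  have h2 : (λ_ (c ⟶[V] d)).inv ▷ W ≫ (eId V c ▷ (c ⟶[V] d)) ▷ W ≫ eComp V c c d ▷ W = 𝟙 _ := by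
    rw [← comp_whiskerRight, ← comp_whiskerRight, e_id_comp, id_whiskerRight]
  have h3 : y d = (λ_ (c ⟶[V] d)).inv ▷ W ≫ (eId V c ▷ (c ⟶[V] d)) ▷ W ≫ swapR _ _ _ ≫
      y c ▷ (c ⟶[V] d) ≫ F.act c d := by
    rw [← h, reassoc_of% h2]
  rw [h3, reassoc_of% (@swapR_natural_left)]
  rw [BraidedCategory.braiding_naturality_right_assoc, comp_whiskerRight_assoc,
    comp_whiskerRight_assoc]
  simp only [← Category.assoc]
  congr 3
  simp [swapR]

section HasEnds

variable [HasEnds V C]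

/-- The morphism `F(c) ⟶ ∫_d [C(c,d), F(d)]` of the enriched Yoneda lemma. -/
def toHomCorep (F : VFun V C) (c : C) : F.obj c ⟶ homObj (corep V c) F :=
  homLift _ (isNat_corep_of_obj F c)

lemma toHomCorep_ev (F : VFun V C) (c d : C) :
    (c ⟶[V] d) ◁ toHomCorep F c ≫ homEv (corep V c) F d =
      (β_ (c ⟶[V] d) (F.obj c)).hom ≫ F.act c d :=
  homLift_ev _ (isNat_corep_of_obj F c) d

/-- The enriched Yoneda lemma `F(c) ≅ ∫_d [C(c,d), F(d)]`. -/
def homCorepIso (F : VFun V C) (c : C) : homObj (corep V c) F ≅ F.obj c where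
  hom := (λ_ _).inv ≫ eId V c ▷ _ ≫ homEv (corep V c) F c
  inv := toHomCorep F c
  hom_inv_id := homObj_hom_ext' fun d => by
    rw [MonoidalCategory.whiskerLeft_comp, Category.assoc, toHomCorep_ev,
      ← (isNat_homEv (corep V c) F).corep_eq d, MonoidalCategory.whiskerLeft_id, Category.id_comp]
  inv_hom_id := by
    rw [leftUnitor_inv_naturality_assoc, whisker_exchange_assoc, toHomCorep_ev,
      BraidedCategory.braiding_naturality_left_assoc, act_id]
    simp

/-- Under Yoneda, evaluation becomes composition of V-natural transformations. This is later the
source of the V-naturality of − ⊗_A N → X. -/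
lemma homEv_toHomCorep (F G : VFun V C) (c : C) :
    homEv F G c ≫ toHomCorep G c = toHomCorep F c ▷ _ ≫ homComp (corep V c) F G :=
  homObj_hom_ext' fun d => by
    rw [MonoidalCategory.whiskerLeft_comp, MonoidalCategory.whiskerLeft_comp, Category.assoc,
      Category.assoc, toHomCorep_ev, homComp, homLift_ev, associator_inv_naturality_middle_assoc,
      ← comp_whiskerRight_assoc, toHomCorep_ev, comp_whiskerRight_assoc, isNat_homEv F G c d,
      BraidedCategory.braiding_naturality_right_assoc]
    simp only [← Category.assoc]
    congr 2
    simp [swapR]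

end HasEnds

/-- The evaluation `W ⊗ [W, Z] ⟶ Z`. -/
def ihomEv (W Z : V) : W ⊗ (ihom W).obj Z ⟶ Z := (ihom.ev W).app Z

lemma whiskerLeft_ihomEv {W Z T : V} (f : T ⟶ (ihom W).obj Z) :
    W ◁ f ≫ ihomEv W Z = MonoidalClosed.uncurry f :=
  (MonoidalClosed.uncurry_eq f).symm

/-- The `V`-functor `c ↦ [W, X(c)]`. -/
abbrev cotensor (W : V) (X : VFun V C) : VFun V C :=
  mkAct (fun c => (ihom W).obj (X.obj c))
    (fun c d => MonoidalClosed.curry ((α_ _ _ _).inv ≫ ihomEv W (X.obj c) ▷ _ ≫ X.act c d))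
    (fun c => by
      apply MonoidalClosed.uncurry_injective
      rw [MonoidalClosed.uncurry_natural_left, MonoidalClosed.uncurry_curry,
        associator_inv_naturality_right_assoc, whisker_exchange_assoc, act_id,
        rightUnitor_naturality, ← whiskerLeft_ihomEv]
      simp)
    (fun c d e => by
      apply MonoidalClosed.uncurry_injective
      rw [MonoidalClosed.uncurry_natural_left, MonoidalClosed.uncurry_natural_left,
        MonoidalClosed.uncurry_natural_left, MonoidalClosed.uncurry_curry,
        MonoidalClosed.uncurry_curry, associator_inv_naturality_right_assoc,
        whisker_exchange_assoc, act_comp, associator_inv_naturality_middle_assoc,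
        ← comp_whiskerRight_assoc, whiskerLeft_ihomEv, MonoidalClosed.uncurry_curry]
      simp)

lemma cotensor_act (W : V) (X : VFun V C) (c d : C) :
    (cotensor W X).act c d =
      MonoidalClosed.curry ((α_ _ _ _).inv ≫ ihomEv W (X.obj c) ▷ _ ≫ X.act c d) :=
  mkAct_act _ _ _ _ _ _

/-- Morphisms to a cotensor correspond to natural families. -/
lemma isNat_iff_cotensor {W : V} {X Y : VFun V C} (y : ∀ c, Y.obj c ⊗ W ⟶ X.obj c) :
    IsNat Y X W y ↔ ∀ c d, Y.act c d ≫ MonoidalClosed.curry ((β_ _ _).hom ≫ y d) =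
      MonoidalClosed.curry ((β_ _ _).hom ≫ y c) ▷ _ ≫ (cotensor W X).act c d := by
  refine forall_congr' fun c => forall_congr' fun d => ?_
  rw [← MonoidalClosed.uncurry_injective.eq_iff, MonoidalClosed.uncurry_natural_left,
    MonoidalClosed.uncurry_natural_left, cotensor_act, MonoidalClosed.uncurry_curry,
    MonoidalClosed.uncurry_curry, associator_inv_naturality_middle_assoc,
    ← comp_whiskerRight_assoc, whiskerLeft_ihomEv, MonoidalClosed.uncurry_curry,
    BraidedCategory.braiding_naturality_right_assoc,
    ← cancel_epi (β_ W (Y.obj c ⊗ (c ⟶[V] d))).hom]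
  have h : (β_ W (Y.obj c ⊗ (c ⟶[V] d))).hom ≫ swapR (Y.obj c) (c ⟶[V] d) W =
      (α_ _ _ _).inv ≫ (β_ W (Y.obj c)).hom ▷ _ := by
    have h0 : (β_ W (Y.obj c ⊗ (c ⟶[V] d))).hom =
        (α_ _ _ _).inv ≫ (β_ W (Y.obj c)).hom ▷ _ ≫ swapR _ _ _ := by
      simp [swapR]
    rw [h0, Category.assoc, Category.assoc, swapR_swapR, Category.comp_id]
  rw [comp_whiskerRight_assoc, reassoc_of% h]

lemma isNat_of_cotensor {W : V} {X Y : VFun V C} (f : Y ⟶ cotensor W X) :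
    IsNat Y X W (fun c => (β_ _ _).hom ≫ MonoidalClosed.uncurry (f.app c)) :=
  (isNat_iff_cotensor _).2 fun c d => by
    simpa using f.naturality c d

section HasEnds

variable [HasEnds V C]

/-- The universal property of cotensors. -/
def cotensorEquiv (W : V) (X Y : VFun V C) : (Y ⟶ cotensor W X) ≃ (W ⟶ homObj Y X) where
  toFun f := homLift _ (isNat_of_cotensor f)
  invFun g :=
    { app := fun c => MonoidalClosed.curry ((β_ _ _).hom ≫ Y.obj c ◁ g ≫ homEv Y X c)
      naturality := (isNat_iff_cotensor _).1 ((isNat_homEv Y X).precomp g) }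
  left_inv f := by
    ext c
    dsimp only
    rw [homLift_ev, SymmetricCategory.symmetry_assoc, MonoidalClosed.curry_uncurry]
  right_inv g := homObj_hom_ext' fun c => by
    rw [homLift_ev, MonoidalClosed.uncurry_curry, SymmetricCategory.symmetry_assoc]

/-- The contravariant functor `[-, X]`. -/
@[simps]
def homFunctor (X : VFun V C) : (VFun V C)ᵒᵖ ⥤ V where
  obj Y := homObj Y.unop X
  map f := homPre X f.unop
  map_id Y := homObj_hom_ext' fun c => by simp
  map_comp f g := homObj_hom_ext' fun c => by
    rw [MonoidalCategory.whiskerLeft_comp, Category.assoc, homPre_ev, homPre_ev, unop_comp,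
      comp_app, whisker_exchange_assoc, homPre_ev, comp_whiskerRight, Category.assoc]

lemma cotensorEquiv_ev {W : V} {X Y : VFun V C} (f : Y ⟶ cotensor W X) (c : C) :
    Y.obj c ◁ cotensorEquiv W X Y f ≫ homEv Y X c =
      (β_ _ _).hom ≫ MonoidalClosed.uncurry (f.app c) :=
  homLift_ev _ (isNat_of_cotensor f) c

lemma cotensorEquiv_comp {W : V} {X Y Y' : VFun V C} (f : Y ⟶ cotensor W X) (g : Y' ⟶ Y) :
    cotensorEquiv W X Y' (g ≫ f) = cotensorEquiv W X Y f ≫ homPre X g :=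
  homObj_hom_ext' fun c => by
    rw [MonoidalCategory.whiskerLeft_comp, Category.assoc, homPre_ev, whisker_exchange_assoc,
      cotensorEquiv_ev, cotensorEquiv_ev, comp_app, MonoidalClosed.uncurry_natural_left,
      BraidedCategory.braiding_naturality_left_assoc]

/-- The left adjoint sends W to the cotensor of X by W. Hence [-, X] turns colimits into limits,
which is the automatic left exactness used for coh-injectivity. -/
instance isRightAdjoint_homFunctor (X : VFun V C) : (homFunctor X).IsRightAdjoint :=
  (Adjunction.adjunctionOfEquivLeft (G := homFunctor X) (F_obj := fun W => op (cotensor W X))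
    (fun W Y => (opEquiv _ _).trans (cotensorEquiv W X Y.unop))
    (fun _ _ _ g h => cotensorEquiv_comp h.unop g.unop)).isRightAdjoint

end HasEnds

end VFun
end Representable

/-! ### Tensoring with dualizable objects, and preservation of finite presentation. -/

section Tensors

variable {V : Type u} [Category.{v} V] [MonoidalCategory V] [SymmetricCategory V]

lemma swapR_tensor_middle (X Y Z W : V) :
    (α_ X Y Z).inv ▷ W ≫ swapR (X ⊗ Y) Z W ≫ swapR X Y W ▷ Z =
      swapR X (Y ⊗ Z) W ≫ (α_ (X ⊗ W) Y Z).inv := by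
  simp [swapR]

lemma swapR_unit_middle (X W : V) :
    (ρ_ X).inv ▷ W ≫ swapR X (𝟙_ V) W = (ρ_ (X ⊗ W)).inv := by
  simp [swapR]

variable [MonoidalClosed V]

namespace VFun

variable {C : Type w} [EnrichedCategory V C]

/-- The tensor product of a `V`-functor with an object of `V`. -/
abbrev tensObj (W : V) (F : VFun V C) : VFun V C :=
  mkAct (fun c => F.obj c ⊗ W) (fun c d => swapR (F.obj c) W (c ⟶[V] d) ≫ F.act c d ▷ W)
    (fun c => by
      rw [reassoc_of% (@swapR_natural_right), ← comp_whiskerRight, act_id, swapR_unit])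
    (fun c d e => by
      rw [reassoc_of% (@swapR_natural_right), ← comp_whiskerRight, act_comp]
      simp only [comp_whiskerRight, Category.assoc]
      rw [reassoc_of% (@swapR_tensor), reassoc_of% (@swapR_natural_left)])

lemma tensObj_act (W : V) (F : VFun V C) (c d : C) :
    (tensObj W F).act c d = swapR (F.obj c) W (c ⟶[V] d) ≫ F.act c d ▷ W :=
  mkAct_act _ _ _ _ _ _

variable (C) in
/-- Tensoring `V`-functors with an object of `V`. -/
@[simps]
def tensR (W : V) : VFun V C ⥤ VFun V C where
  obj F := tensObj W F
  map f :=
    { app := fun c => f.app c ▷ W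
      naturality := fun c d => by
        rw [tensObj_act, tensObj_act, Category.assoc, ← comp_whiskerRight, f.naturality,
          comp_whiskerRight, reassoc_of% (@swapR_natural_left)] }
  map_id F := hom_ext fun c => by simp
  map_comp f g := hom_ext fun c => by simp

lemma isNat_iff_tensObj {W : V} {X Y : VFun V C} (y : ∀ c, Y.obj c ⊗ W ⟶ X.obj c) :
    IsNat Y X W y ↔ ∀ c d, (tensObj W Y).act c d ≫ y d = y c ▷ _ ≫ X.act c d := by
  refine forall_congr' fun c => forall_congr' fun d => ?_
  rw [tensObj_act, Category.assoc]
  constructor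
  · intro h
    rw [h, ← Category.assoc, swapR_swapR, Category.id_comp]
  · intro h
    rw [← h, ← Category.assoc, swapR_swapR, Category.id_comp]

section ExactPairing

variable (d e : V) [ExactPairing d e]

/-- The unit `X ⟶ (X ⊗ d) ⊗ e`. -/
def pairUnit (X : V) : X ⟶ (X ⊗ d) ⊗ e :=
  (ρ_ _).inv ≫ X ◁ η_ d e ≫ (α_ _ _ _).inv

/-- The counit `(X ⊗ e) ⊗ d ⟶ X`. -/
def pairCounit (X : V) : (X ⊗ e) ⊗ d ⟶ X :=
  (α_ _ _ _).hom ≫ X ◁ ε_ d e ≫ (ρ_ _).hom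

lemma pairUnit_naturality {X Y : V} (f : X ⟶ Y) :
    f ≫ pairUnit d e Y = pairUnit d e X ≫ (f ▷ d) ▷ e := by
  rw [pairUnit, pairUnit, rightUnitor_inv_naturality_assoc, ← whisker_exchange_assoc]
  simp

lemma pairCounit_naturality {X Y : V} (f : X ⟶ Y) :
    (f ▷ e) ▷ d ≫ pairCounit d e Y = pairCounit d e X ≫ f := by
  rw [pairCounit, pairCounit, associator_naturality_left_assoc, ← whisker_exchange_assoc,
    Category.assoc, Category.assoc, rightUnitor_naturality]

lemma pair_left_triangle (X : V) :
    pairUnit d e X ▷ d ≫ pairCounit d e (X ⊗ d) = 𝟙 _ := by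
  have h : X ◁ η_ d e ▷ d ≫ X ◁ (α_ d e d).hom ≫ X ◁ d ◁ ε_ d e =
      X ◁ (λ_ d).hom ≫ X ◁ (ρ_ d).inv := by
    simp only [← MonoidalCategory.whiskerLeft_comp, ExactPairing.evaluation_coevaluation]
  have h2 : pairUnit d e X ▷ d ≫ pairCounit d e (X ⊗ d) = (ρ_ X).inv ▷ d ≫ (α_ _ _ _).hom ≫
      (X ◁ η_ d e ▷ d ≫ X ◁ (α_ d e d).hom ≫ X ◁ d ◁ ε_ d e) ≫ (α_ _ _ _).inv ≫
        (ρ_ _).hom := by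
    simp only [pairUnit, pairCounit]
    monoidal
  rw [h2, h]
  monoidal

lemma pair_right_triangle (X : V) :
    pairUnit d e (X ⊗ e) ≫ pairCounit d e X ▷ e = 𝟙 _ := by
  have h : X ◁ e ◁ η_ d e ≫ X ◁ (α_ e d e).inv ≫ X ◁ ε_ d e ▷ e =
      X ◁ (ρ_ e).hom ≫ X ◁ (λ_ e).inv := by
    simp only [← MonoidalCategory.whiskerLeft_comp, ExactPairing.coevaluation_evaluation]
  have h2 : pairUnit d e (X ⊗ e) ≫ pairCounit d e X ▷ e = (ρ_ _).inv ≫ (α_ _ _ _).hom ≫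
      (X ◁ e ◁ η_ d e ≫ X ◁ (α_ e d e).inv ≫ X ◁ ε_ d e ▷ e) ≫ (α_ _ _ _).inv ≫
        (ρ_ _).hom ▷ e := by
    simp only [pairUnit, pairCounit]
    monoidal
  rw [h2, h]
  monoidal

/-- The unit of the adjunction between tensoring with an object and with its dual. -/
def tensUnit (F : VFun V C) : F ⟶ tensObj e (tensObj d F) where
  app c := pairUnit d e (F.obj c)
  naturality x y := by
    rw [pairUnit, pairUnit, tensObj_act, tensObj_act, comp_whiskerRight, comp_whiskerRight,
      comp_whiskerRight]
    simp only [Category.assoc]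
    rw [reassoc_of% (@swapR_tensor_middle), reassoc_of% (@swapR_natural_middle),
      reassoc_of% (@swapR_unit_middle), rightUnitor_inv_naturality_assoc,
      ← whisker_exchange_assoc, associator_inv_naturality_left]

/-- The counit of the adjunction between tensoring with an object and with its dual. -/
def tensCounit (F : VFun V C) : tensObj d (tensObj e F) ⟶ F where
  app c := pairCounit d e (F.obj c)
  naturality x y := by
    rw [pairCounit, pairCounit, tensObj_act, tensObj_act, comp_whiskerRight, comp_whiskerRight,
      comp_whiskerRight]
    have h := swapR_tensor_middle (F.obj x) e d (x ⟶[V] y)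
    have h2 : (ρ_ _).hom ▷ _ = swapR (F.obj x) (𝟙_ V) (x ⟶[V] y) ≫ (ρ_ _).hom := by
      simp [swapR]
    rw [← cancel_epi ((α_ (F.obj x) e d).inv ▷ (x ⟶[V] y))]
    simp only [Category.assoc]
    rw [reassoc_of% h, associator_naturality_left_assoc, Iso.inv_hom_id_assoc,
      ← whisker_exchange_assoc, ← comp_whiskerRight_assoc _ _ (x ⟶[V] y),
      Iso.inv_hom_id, id_whiskerRight, Category.id_comp, h2]
    simp only [Category.assoc]
    rw [reassoc_of% (@swapR_natural_middle), rightUnitor_naturality]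

variable (C) in
/-- Tensoring with a dualizable object is left adjoint to tensoring with its dual. -/
def tensAdjunction : tensR C d ⊣ tensR C e :=
  Adjunction.mkOfUnitCounit
    { unit :=
        { app := tensUnit d e
          naturality := fun _ _ f => hom_ext fun c => pairUnit_naturality d e (f.app c) }
      counit :=
        { app := tensCounit d e
          naturality := fun _ _ f => hom_ext fun c => pairCounit_naturality d e (f.app c) }
      left_triangle := by
        ext F c
        refine Eq.trans ?_ (pair_left_triangle d e (F.obj c))
        exact congrArg (_ ≫ ·) (Category.id_comp _)
      right_triangle := by
        ext F c
        refine Eq.trans ?_ (pair_right_triangle d e (F.obj c))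
        exact congrArg (_ ≫ ·) (Category.id_comp _) }

variable {d e}

/-- The data exhibiting `c'` as the tensor of `c` with `d`, where `d` has the dual `e`. -/
structure TensorData (d e : V) [ExactPairing e d] (c c' : C) where
  /-- the unit -/
  unit : d ⟶ (c ⟶[V] c')
  /-- the counit -/
  counit : e ⟶ (c' ⟶[V] c)
  unit_counit : (unit ⊗ₘ counit) ≫ eComp V c c' c = ε_ e d ≫ eId V c
  counit_unit : η_ e d ≫ (counit ⊗ₘ unit) ≫ eComp V c' c c' = eId V c'

end ExactPairing

namespace TensorData

variable {d e : V} [ExactPairing e d] {c c' : C} (D : TensorData d e c c')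

/-- The inclusion `F(c') ⟶ F(c) ⊗ d`. -/
def incl (F : VFun V C) : F.obj c' ⟶ F.obj c ⊗ d :=
  pairUnit e d _ ≫ (F.obj c' ◁ D.counit ≫ F.act c' c) ▷ d

/-- The retraction `F(c) ⊗ d ⟶ F(c')`. -/
def retr (F : VFun V C) : F.obj c ⊗ d ⟶ F.obj c' :=
  F.obj c ◁ D.unit ≫ F.act c c'

/-- The identity `counit_unit`, transported by the action of F, makes F(c') a retract of F(c) ⊗ d,
naturally in F. Such tensors are preserved by every V-functor, since they are given by equations in
C. -/
lemma incl_retr (F : VFun V C) : D.incl F ≫ D.retr F = 𝟙 _ := by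
  have h : (F.obj c' ◁ D.counit ≫ F.act c' c) ▷ d ≫ F.obj c ◁ D.unit ≫ F.act c c' =
      (α_ _ _ _).hom ≫ F.obj c' ◁ (D.counit ⊗ₘ D.unit) ≫ F.obj c' ◁ eComp V c' c c' ≫
        F.act c' c' := by
    rw [act_comp, comp_whiskerRight_assoc, ← whisker_exchange_assoc,
      MonoidalCategory.tensorHom_def]
    simp
  rw [incl, retr, Category.assoc, h, pairUnit]
  simp only [Category.assoc, Iso.inv_hom_id_assoc]
  simp only [← MonoidalCategory.whiskerLeft_comp_assoc]
  rw [D.counit_unit, act_id, Iso.inv_hom_id]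

lemma incl_naturality {F G : VFun V C} (f : F ⟶ G) :
    D.incl F ≫ f.app c ▷ d = f.app c' ≫ D.incl G := by
  rw [incl, incl, Category.assoc, ← comp_whiskerRight, Category.assoc, f.naturality,
    whisker_exchange_assoc, comp_whiskerRight, ← Category.assoc, ← Category.assoc,
    pairUnit_naturality]

lemma retr_naturality {F G : VFun V C} (f : F ⟶ G) :
    D.retr F ≫ f.app c' = f.app c ▷ d ≫ D.retr G := by
  rw [retr, retr, Category.assoc, f.naturality, whisker_exchange_assoc]

-- A retract of an isomorphism is an isomorphism: the component at c' is a retract of the component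
-- at c tensored with d.
include D in
lemma isIso_app {F G : VFun V C} (f : F ⟶ G) [IsIso (f.app c)] : IsIso (f.app c') := by
  refine ⟨D.incl G ≫ (inv (f.app c)) ▷ d ≫ D.retr F, ?_, ?_⟩
  · rw [← reassoc_of% (D.incl_naturality f), ← comp_whiskerRight_assoc, IsIso.hom_inv_id,
      id_whiskerRight, Category.id_comp, incl_retr]
  · rw [Category.assoc, Category.assoc, retr_naturality, ← comp_whiskerRight_assoc,
      IsIso.inv_hom_id, id_whiskerRight, Category.id_comp, incl_retr]

/-- The element of `F(c')` corresponding to a generalized element of `F(c)`. -/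
def elem {F : VFun V C} (x : e ⟶ F.obj c) : 𝟙_ V ⟶ F.obj c' :=
  η_ e d ≫ x ▷ d ≫ D.retr F

/-- Here the other identity, `unit_counit`, is used. Passing from elements of F(c) over e to
elements of F(c') over the unit loses nothing, so equalities may be tested with ordinary elements.
-/
lemma elem_recover {F : VFun V C} (x : e ⟶ F.obj c) :
    (λ_ _).inv ≫ D.elem x ▷ e ≫ F.obj c' ◁ D.counit ≫ F.act c' c = x := by
  have h : D.retr F ▷ e ≫ F.obj c' ◁ D.counit ≫ F.act c' c =
      (α_ _ _ _).hom ≫ F.obj c ◁ ((D.unit ⊗ₘ D.counit) ≫ eComp V c c' c) ≫ F.act c c := by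
    rw [MonoidalCategory.whiskerLeft_comp, Category.assoc, act_comp, retr,
      comp_whiskerRight_assoc, ← whisker_exchange_assoc, MonoidalCategory.tensorHom_def]
    simp
  rw [elem]
  simp only [comp_whiskerRight, Category.assoc]
  rw [h, D.unit_counit, MonoidalCategory.whiskerLeft_comp, Category.assoc, act_id,
    associator_naturality_left_assoc, ← whisker_exchange_assoc, rightUnitor_naturality,
    ExactPairing.evaluation_coevaluation_assoc]
  simp

end TensorData

section HasEnds

variable [HasEnds V C]

lemma homEv_homComp (F G H : VFun V C) (c : C) :
    F.obj c ◁ homComp F G H ≫ homEv F H c =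
      (α_ _ _ _).inv ≫ homEv F G c ▷ _ ≫ homEv G H c :=
  homLift_ev _ (isNat_comp (isNat_homEv F G) (isNat_homEv G H)) c

lemma isNat_tensObj_id (d : V) (F : VFun V C) :
    IsNat F (tensObj d F) d (fun c => 𝟙 (F.obj c ⊗ d)) :=
  (isNat_iff_tensObj _).2 fun c d => by simp

lemma isNat_pairCounit (d e : V) [ExactPairing e d] (F : VFun V C) :
    IsNat (tensObj d F) F e (fun c => pairCounit e d (F.obj c)) :=
  (isNat_iff_tensObj _).2 (tensCounit e d F).naturality

lemma homEv_eId (F : VFun V C) (c : C) : F.obj c ◁ eId V F ≫ homEv F F c = (ρ_ _).hom :=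
  (homLift_ev _ (isNat_of_hom (𝟙 F)) c).trans (Category.comp_id _)

lemma homLift_homComp {F G H : VFun V C} {P Q : V} {y : ∀ c, F.obj c ⊗ P ⟶ G.obj c}
    (hy : IsNat F G P y) {z : ∀ c, G.obj c ⊗ Q ⟶ H.obj c} (hz : IsNat G H Q z) (c : C) :
    F.obj c ◁ ((homLift y hy ⊗ₘ homLift z hz) ≫ homComp F G H) ≫ homEv F H c =
      (α_ _ _ _).inv ≫ y c ▷ Q ≫ z c := by
  rw [MonoidalCategory.whiskerLeft_comp, Category.assoc, homEv_homComp,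
    MonoidalCategory.tensorHom_def, MonoidalCategory.whiskerLeft_comp, Category.assoc,
    associator_inv_naturality_right_assoc, whisker_exchange_assoc, homLift_ev,
    associator_inv_naturality_middle_assoc, ← comp_whiskerRight_assoc, homLift_ev]

/-- The tensor data exhibiting `F ⊗ d` as the tensor of `F` with `d`. -/
def tensorData (d e : V) [ExactPairing e d] (F : VFun V C) : TensorData d e F (tensObj d F) where
  unit := homLift _ (isNat_tensObj_id d F)
  counit := homLift _ (isNat_pairCounit d e F)
  unit_counit := homObj_hom_ext' fun c => by
    refine (homLift_homComp (isNat_tensObj_id d F) (isNat_pairCounit d e F) c).trans ?_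
    rw [MonoidalCategory.whiskerLeft_comp, Category.assoc, homEv_eId]
    simp [pairCounit]
  counit_unit := homObj_hom_ext' fun c => by
    rw [MonoidalCategory.whiskerLeft_comp, Category.assoc, homEv_eId]
    refine (congrArg (_ ≫ ·)
      (homLift_homComp (isNat_pairCounit d e F) (isNat_tensObj_id d F) c)).trans ?_
    have h := pair_right_triangle e d (F.obj c)
    rw [pairUnit, Category.assoc, Category.assoc, Iso.inv_comp_eq, Category.comp_id] at h
    rw [Category.comp_id]
    exact h

end HasEnds

section Presentable

open Cardinal

attribute [local instance] fact_isRegular_aleph0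

variable [HasColimitsOfSize.{v, v} V]

/-- By Yoneda, morphisms to F are elements 𝟙 → F(c); evaluation at c preserves colimits, and the
unit is finitely presented. -/
lemma isFinitelyPresentable_corep [IsFinitelyPresentable.{v} (𝟙_ V)] (c : C) :
    IsFinitelyPresentable.{v} (corep V c) := by
  rw [isFinitelyPresentable_iff_preservesFilteredColimitsOfSize]
  refine ⟨fun J _ _ => ?_⟩
  have e : coyoneda.obj (op (corep V c)) ≅
      ev V c ⋙ coyoneda.obj (op (𝟙_ V)) ⋙ uliftFunctor.{w} :=
    NatIso.ofComponents (fun F => ((corepEquiv F c).trans Equiv.ulift.symm).toIso) (by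
      intro F G f
      ext x
      exact congrArg ULift.up (Category.assoc (eId V c) (Hom.app x c) (f.app c)).symm)
  have : PreservesColimitsOfShape J (coyoneda.obj (op (𝟙_ V))) :=
    PreservesFilteredColimitsOfSize.preserves_filtered_colimits J
  exact preservesColimitsOfShape_of_natIso e.symm

/-- A left adjoint whose right adjoint preserves filtered colimits preserves finitely presented
objects. The right adjoint here tensors with the dual e, and by symmetry it is itself a left
adjoint. -/
lemma isFinitelyPresentable_tensObj (d e : V) [ExactPairing d e] (F : VFun V C)
    [IsFinitelyPresentable.{v} F] : IsFinitelyPresentable.{v} (tensObj d F) := by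
  have : PreservesColimitsOfSize.{v, v} (tensR C e) :=
    letI : ExactPairing e d := BraidedCategory.exactPairing_swap d e
    (tensAdjunction C e d).leftAdjoint_preservesColimits
  exact (tensAdjunction C d e).isCardinalPresentable_leftAdjoint_obj ℵ₀ F

end Presentable

end VFun

end Tensors

/-! ### Finitely presented generators, and smallness of the category of finitely presented modules.
-/

section Generators

open Cardinal

attribute [local instance] fact_isRegular_aleph0

/-- In a balanced category, separating families are strong generators. -/
lemma isStrongGenerator_of_isSeparating {D : Type*} [Category* D] [Balanced D]
    {P : ObjectProperty D} (hP : P.IsSeparating) : P.IsStrongGenerator := by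
  refine ObjectProperty.isStrongGenerator_iff.2 ⟨hP, fun X Y i _ hi => ?_⟩
  have : Epi i := ⟨fun f g h => hP _ _ fun G hG k => by
    obtain ⟨k', rfl⟩ := hi G hG k
    simp only [Category.assoc, h]⟩
  exact isIso_of_mono_of_epi i

namespace VFun

section Separating

variable {V : Type u} [Category.{v} V] [MonoidalCategory V] [SymmetricCategory V]
  [MonoidalClosed V] {C : Type w} [EnrichedCategory V C]

lemma hom_ext_of_elemIso {F G : VFun V C} {f g : F ⟶ G} {S : Type*} {σ : S → C} {r : C → S}
    (e : ∀ c, ElemIso (V := V) c (σ (r c))) (h : ∀ s, f.app (σ s) = g.app (σ s)) : f = g := by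
  ext c
  have key (f : F ⟶ G) : f.app c = F.mapElem (e c).hom ≫ f.app _ ≫ G.mapElem (e c).inv := by
    rw [← f.mapElem_naturality, ← Category.assoc, mapElem_hom_inv, Category.id_comp]
  rw [key f, key g, h]

instance locallySmall_of_isSkeletallySmall [IsSkeletallySmall V C] :
    LocallySmall.{v} (VFun V C) where
  hom_small F G := by
    obtain ⟨S, σ, r, he⟩ := exists_elemIso V C
    have e := fun c => (he c).some
    exact small_of_injective (β := ∀ s : S, F.obj (σ s) ⟶ G.obj (σ s))
      (f := fun f s => f.app (σ s)) fun f g h => hom_ext_of_elemIso e fun s => congrFun h s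

/-- The morphism `C(c,-) ⊗ W ⟶ F` given by a generalized element of `F(c)`. -/
def corepTensHom {F : VFun V C} {c : C} {W : V} (x : W ⟶ F.obj c) :
    tensObj W (corep V c) ⟶ F where
  app d := (c ⟶[V] d) ◁ x ≫ (β_ _ _).hom ≫ F.act c d
  naturality := (isNat_iff_tensObj _).1 ((isNat_corep_of_obj F c).precomp x)

lemma eId_corepTensHom {F : VFun V C} {c : C} {W : V} (x : W ⟶ F.obj c) :
    (λ_ W).inv ≫ eId V c ▷ W ≫ (corepTensHom x).app c = x := by
  have h : (corepTensHom x).app c = (c ⟶[V] c) ◁ x ≫ (β_ _ _).hom ≫ F.act c c := rfl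
  rw [h, ← whisker_exchange_assoc,
    ← leftUnitor_inv_naturality_assoc,
    BraidedCategory.braiding_naturality_left_assoc, act_id]
  simp

/-- The family of tensor products of corepresentable `V`-functors with objects of `V`. -/
def corepTens {S ι : Type*} (σ : S → C) (g : ι → V) (p : S × ι) : VFun V C :=
  tensObj (g p.2) (corep V (σ p.1))

/-- A morphism is determined on the skeleton by its effect on elements over the generators of V, and
`eId_corepTensHom` recovers each such element from a morphism out of a tensored corepresentable. -/
lemma isSeparating_corepTens {S : Type*} {σ : S → C} {r : C → S}
    (e : ∀ c, ElemIso (V := V) c (σ (r c))) {ι : Type*} {g : ι → V}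
    (hg : (ObjectProperty.ofObj g).IsSeparating) :
    (ObjectProperty.ofObj (corepTens σ g)).IsSeparating := by
  intro F G f f' h
  refine hom_ext_of_elemIso e fun s => hg _ _ ?_
  rintro _ ⟨i⟩ x
  have := h _ ⟨(s, i)⟩ (corepTensHom x)
  rw [← eId_corepTensHom x]
  simp only [Category.assoc]
  exact congrArg (fun k => (λ_ _).inv ≫ eId V _ ▷ _ ≫ Hom.app k (σ s)) this

end Separating

section FP

variable (V : Type u) [Category.{v} V] [Abelian V] [IsGrothendieckAbelian.{v} V]
  [MonoidalCategory V] [SymmetricCategory V] [MonoidalClosed V] [HasDualizableGenerators V]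
  (C : Type w) [EnrichedCategory V C] [IsSkeletallySmall V C]

lemma exists_generators : ∃ (S ι : Type v) (σ : S → C) (g : ι → V),
    (∀ i, ∃ d : V, Nonempty (ExactPairing d (g i))) ∧
      (∀ p, IsFinitelyPresentable.{v} (corepTens σ g p)) ∧
      (ObjectProperty.ofObj (corepTens σ g)).IsStrongGenerator := by
  obtain ⟨S, σ, r, he⟩ := exists_elemIso V C
  obtain ⟨ι, g, hd, hg⟩ := HasDualizableGenerators.exists_generators (V := V)
  have := HasDualizableGenerators.isFinitelyPresentable_unit (V := V)
  refine ⟨S, ι, σ, g, fun i => ?_, fun p => ?_,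
    isStrongGenerator_of_isSeparating (isSeparating_corepTens (fun c => (he c).some) hg)⟩
  · obtain ⟨d, ⟨h⟩⟩ := hd i
    exact ⟨d, ⟨BraidedCategory.exactPairing_swap _ _⟩⟩
  · obtain ⟨d, ⟨h⟩⟩ := hd p.2
    have := isFinitelyPresentable_corep (V := V) (σ p.1)
    exact isFinitelyPresentable_tensObj (g p.2) d (corep V (σ p.1))

/-- The finitely presented objects are the closure of a small family under finite colimits. -/
instance essentiallySmall_isFinitelyPresentable :
    ObjectProperty.EssentiallySmall.{v} (ObjectProperty.isFinitelyPresentable.{v} (VFun V C)) := by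
  obtain ⟨S, ι, σ, g, -, h, h'⟩ := exists_generators V C
  rw [ObjectProperty.isFinitelyPresentable_eq_isCardinalPresentable,
    IsStrongGenerator.colimitsCardinalClosure_eq_isCardinalPresentable h']
  · infer_instance
  · rintro _ ⟨p⟩
    exact h p

variable {V C} in
/-- Induction principle for finitely presented `V`-functors. -/
lemma isFinitelyPresentable_induction (Q : ObjectProperty (VFun V C))
    [Q.IsClosedUnderIsomorphisms]
    (hQ : ∀ (J : Type v) [SmallCategory J] [FinCategory J], Q.IsClosedUnderColimitsOfShape J)
    (h : ∀ (c : C) (d e : V) [ExactPairing e d], Q (tensObj d (corep V c))) (F : VFun V C)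
    (hF : IsFinitelyPresentable.{v} F) : Q F := by
  obtain ⟨S, ι, σ, g, hd, h₁, h₂⟩ := exists_generators V C
  have : ObjectProperty.isFinitelyPresentable.{v} (VFun V C) ≤ Q := by
    -- For a strong generator of finitely presented objects, the finitely presented objects are
    -- precisely its closure under finite colimits; this reduces the claim to the closure properties
    -- of Q.
    rw [ObjectProperty.isFinitelyPresentable_eq_isCardinalPresentable,
      IsStrongGenerator.colimitsCardinalClosure_eq_isCardinalPresentable h₂]
    · refine ObjectProperty.colimitsCardinalClosure_le _ _ (fun J _ hJ => ?_) ?_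
      · rw [hasCardinalLT_aleph0_iff] at hJ
        have : Finite J := Finite.of_injective (fun j => Arrow.mk (𝟙 j)) fun i j h =>
          congrArg (fun f => f.left) h
        have (i j : J) : Finite (i ⟶ j) :=
          Finite.of_injective (fun f => Arrow.mk f) fun f g h => (Arrow.mk_inj _ _).1 h
        let _ : FinCategory J :=
          { fintypeObj := Fintype.ofFinite _
            fintypeHom := fun _ _ => Fintype.ofFinite _ }
        exact hQ J
      · rintro _ ⟨p⟩
        obtain ⟨e, ⟨he⟩⟩ := hd p.2
        exact h (σ p.1) (g p.2) e
    · rintro _ ⟨p⟩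
      exact h₁ p
  exact this F hF

instance isClosedUnderColimitsOfShape_isFinitelyPresentable (J : Type*)
    [SmallCategory J] [FinCategory J] :
    (ObjectProperty.isFinitelyPresentable.{v} (VFun V C)).IsClosedUnderColimitsOfShape J := by
  rw [ObjectProperty.isFinitelyPresentable_eq_isCardinalPresentable]
  exact isClosedUnderColimitsOfShape_isCardinalPresentable _
    ((hasCardinalLT_aleph0_iff _).2 inferInstance)

end FP

end VFun

section FPMod

variable (V : Type u) [Category.{v} V] [Abelian V] [IsGrothendieckAbelian.{v} V]
  [MonoidalCategory V] [SymmetricCategory V] [MonoidalClosed V] [HasDualizableGenerators V]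
  (A : Type w) [EnrichedCategory V A] [IsSkeletallySmall V A]

/-- This makes all the ends over mod A exist, so that [Y, X] is defined for any two generalised
modules. -/
instance isSkeletallySmall_fpMod : IsSkeletallySmall V (FPMod V A) where
  exists_skeleton := by
    obtain ⟨Q, _, hQ₁, hQ₂⟩ := ObjectProperty.EssentiallySmall.exists_small_le.{v}
      (ObjectProperty.isFinitelyPresentable.{v} (VFun V Aᵒᵖ))
    refine ⟨Shrink.{v} (Subtype Q), fun s => ⟨((equivShrink _).symm s).1,
      hQ₁ _ ((equivShrink _).symm s).2⟩, fun M => ?_⟩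
    obtain ⟨N, hN, ⟨e⟩⟩ := hQ₂ _ M.property
    refine ⟨equivShrink _ ⟨N, hN⟩, ⟨(ForgetEnrichment.equivInverse V (FPMod V A)).mapIso
      ((ObjectProperty.isFinitelyPresentable.{v} (VFun V Aᵒᵖ)).isoMk ?_)⟩⟩
    exact e ≪≫ eqToIso (by simp)

instance : HasFiniteColimits (FPMod V A) where
  out _ _ _ := inferInstance

instance : PreservesFiniteColimits (ObjectProperty.isFinitelyPresentable.{v} (VFun V Aᵒᵖ)).ι where
  preservesFiniteColimits _ _ _ := inferInstance

instance : HasZeroObject (FPMod V A) := inferInstance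

instance : HasFiniteBiproducts (FPMod V A) := HasFiniteBiproducts.of_hasFiniteCoproducts

end FPMod

end Generators

/-! ### Compatibility of the Yoneda morphisms with actions and composition. -/

section YonedaModule

variable {V : Type u} [Category.{v} V] [MonoidalCategory V] [SymmetricCategory V]
  [MonoidalClosed V]

namespace VFun

section

variable {C : Type w} [EnrichedCategory V C] [HasEnds V C]

lemma elem_toHomCorep {F : VFun V C} {c : C} (x : 𝟙_ V ⟶ F.obj c) :
    x ≫ toHomCorep F c = homEquivFun (corepHom x) :=
  homObj_hom_ext' fun d => by
    rw [MonoidalCategory.whiskerLeft_comp, Category.assoc, toHomCorep_ev, homEquivFun, homLift_ev,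
      BraidedCategory.braiding_naturality_right_assoc, corepHom_app]
    simp

lemma eId_toHomCorep (c : C) : eId V c ≫ toHomCorep (corep V c) c = eId V (corep V c) := by
  refine (elem_toHomCorep (F := corep V c) (eId V c)).trans ?_
  have h : corepHom (F := corep V c) (eId V c) = 𝟙 _ :=
    corep_hom_ext ((eId_corepHom _).trans (Category.comp_id _).symm)
  rw [h]
  rfl

lemma act_toHomCorep (F : VFun V C) (c d : C) :
    F.act c d ≫ toHomCorep F d =
      (β_ _ _).hom ≫ (toHomCorep (corep V c) d ⊗ₘ toHomCorep F c) ≫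
        homComp (corep V d) (corep V c) F := by
  rw [MonoidalCategory.tensorHom_def', Category.assoc, ← homEv_toHomCorep,
    reassoc_of% (toHomCorep_ev F c d), SymmetricCategory.symmetry_assoc]

end

section

variable {A : Type w} [EnrichedCategory V A] [HasEnds V Aᵒᵖ]

/-- The enriched Yoneda embedding is a V-functor. The braiding in the action formula cancels against
the one defining composition in the opposite V-category. -/
lemma eComp_toHomCorep (a b c : A) :
    eComp V a b c ≫ toHomCorep (corep V (op c)) (op a) =
      (toHomCorep (corep V (op b)) (op a) ⊗ₘ toHomCorep (corep V (op c)) (op b)) ≫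
        homComp (corep V (op a)) (corep V (op b)) (corep V (op c)) := by
  have h := act_toHomCorep (corep V (op c)) (op b) (op a)
  rw [corep_act, eComp_op_eq, Category.assoc] at h
  exact (cancel_epi (β_ _ _).hom).1 h

end

end VFun

end YonedaModule

/-! ### Right exactness as preservation of finite colimits. -/

namespace GenMod

variable {V : Type u} [Category.{v} V] [Abelian V] [IsGrothendieckAbelian.{v} V]
  [MonoidalCategory V] [SymmetricCategory V] [MonoidalClosed V]
  {A : Type w} [EnrichedCategory V A] [IsSkeletallySmall V A]

open VFun

/-- The functor underlying a generalised module. -/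
@[simps]
def toFunctor (X : GenMod V A) : FPMod V A ⥤ V where
  obj M := X.obj M
  map f := X.map f
  map_id M := by
    rw [GenMod.map, eHomEquiv_id, mapElem_id]
  map_comp f g := by
    rw [GenMod.map, GenMod.map, GenMod.map, eHomEquiv_comp, mapElem_comp]

/-- The natural transformation underlying a morphism of generalised modules. -/
@[simps]
def toNatTrans {X Y : GenMod V A} (α : X ⟶ Y) : toFunctor X ⟶ toFunctor Y where
  app M := α.app M
  naturality _ _ f := α.mapElem_naturality (eHomEquiv V f)

/-- The natural isomorphism underlying an isomorphism of generalised modules. -/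
def toNatIso {X Y : GenMod V A} (α : X ≅ Y) : toFunctor X ≅ toFunctor Y :=
  have (M : FPMod V A) : IsIso ((toNatTrans α.hom).app M) :=
    inferInstanceAs (IsIso (α.hom.app M))
  have := NatIso.isIso_of_isIso_app (toNatTrans α.hom)
  asIso (toNatTrans α.hom)

lemma eHomEquiv_add {K L : FPMod V A} (f g : K ⟶ L) :
    eHomEquiv V (f + g) = eHomEquiv V f + eHomEquiv V g := by
  refine homObj_hom_ext' (F := K.obj) (G := L.obj) fun c => ?_
  have h (f : K ⟶ L) : K.obj.obj c ◁ eHomEquiv V f ≫ homEv K.obj L.obj c =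
      (ρ_ _).hom ≫ f.hom.app c :=
    homLift_ev _ (isNat_of_hom f.hom) c
  rw [h, MonoidalPreadditive.whiskerLeft_add, Preadditive.add_comp]
  refine Eq.trans ?_ (congrArg₂ (· + ·) (h f) (h g)).symm
  exact Preadditive.comp_add _ _ _ _ _ _

/-- Additivity is automatic for V-functors because the tensor product is additive. It is what turns
right exactness into preservation of all finite colimits. -/
instance additive_toFunctor (X : GenMod V A) : (toFunctor X).Additive where
  map_add {K L f g} := by
    change X.mapElem (eHomEquiv V (f + g)) = X.mapElem (eHomEquiv V f) + X.mapElem (eHomEquiv V g)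
    rw [eHomEquiv_add]
    simp [VFun.mapElem]

variable [HasDualizableGenerators V]

/-- Finitely presented modules are closed under finite colimits, so their cokernels agree with those
in all modules and right exactness applies. -/
lemma IsRightExact.exact_cokernel {X : GenMod V A} (hX : X.IsRightExact) {K L : FPMod V A}
    (f : K ⟶ L) : ∃ h : X.map f ≫ X.map (cokernel.π f) = 0,
      (ShortComplex.mk (X.map f) (X.map (cokernel.π f)) h).Exact ∧ Epi (X.map (cokernel.π f)) := by
  have hι := isColimitOfHasCokernelOfPreservesColimit
    (ObjectProperty.isFinitelyPresentable.{v} (VFun V Aᵒᵖ)).ι f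
  have h₀ : f.hom ≫ (cokernel.π f).hom = 0 := congrArg (·.hom) (cokernel.condition f)
  have hexact : (ShortComplex.mk f.hom (cokernel.π f).hom h₀).Exact :=
    ShortComplex.exact_of_g_is_cokernel _ hι
  exact hX K L (cokernel f) f (cokernel.π f) h₀ hexact (epi_of_isColimit_cofork hι)

lemma IsRightExact.preservesFiniteColimits {X : GenMod V A} (hX : X.IsRightExact) :
    PreservesFiniteColimits (toFunctor X) := by
  have : HasBinaryBiproducts (FPMod V A) := hasBinaryBiproducts_of_finite_biproducts _
  have {K L : FPMod V A} (f : K ⟶ L) : PreservesColimit (parallelPair f 0) (toFunctor X) := by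
    obtain ⟨h', h₁, h₂⟩ := hX.exact_cokernel f
    refine preservesColimit_of_preserves_colimit_cocone (cokernelIsCokernel f) ?_
    exact (CokernelCofork.isColimitMapCoconeEquiv _ _).symm h₁.gIsCokernel
  exact Functor.preservesFiniteColimits_of_preservesCokernels _

/-- A right exact sequence of right modules with finitely presented terms is a cokernel sequence of
finitely presented modules. -/
def isCokernelOfExact {K L M : FPMod V A} {f : K ⟶ L} {g : L ⟶ M} (h₀ : f ≫ g = 0)
    {h : f.hom ≫ g.hom = 0} (hexact : (ShortComplex.mk f.hom g.hom h).Exact) (hg : Epi g.hom) :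
    IsColimit (CokernelCofork.ofπ g h₀) :=
  isColimitOfReflects (ObjectProperty.isFinitelyPresentable.{v} (VFun V Aᵒᵖ)).ι
    ((CokernelCofork.isColimitMapCoconeEquiv _ _).symm hexact.gIsCokernel)

lemma isRightExact_of_preservesFiniteColimits {X : GenMod V A}
    [PreservesFiniteColimits (toFunctor X)] : X.IsRightExact := by
  intro K L M f g h hexact hepi
  have h₀ : f ≫ g = 0 := by
    ext1
    exact h
  have hc' := CokernelCofork.mapIsColimit _ (isCokernelOfExact h₀ hexact hepi) (toFunctor X)
  have h' : X.map f ≫ X.map g = 0 := by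
    have := (toFunctor X).map_comp f g
    rw [h₀, Functor.map_zero] at this
    exact this.symm
  exact ⟨h', ShortComplex.exact_of_g_is_cokernel _ hc', epi_of_isColimit_cofork hc'⟩

end GenMod

/-! ### The functor − ⊗_A N preserves colimits. -/

section TensorModule

namespace VFun

section

variable {V : Type u} [Category.{v} V] [MonoidalCategory V] [SymmetricCategory V]
  [MonoidalClosed V] {A : Type w} [EnrichedCategory V A] [HasColimitsOfSize.{v, v} V]
  [IsSkeletallySmall V A]

lemma isBal_whiskerRight {M M' : VFun V Aᵒᵖ} (N : VFun V A) (f : M ⟶ M') {W : V}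
    {z : ∀ a, M'.obj (op a) ⊗ N.obj a ⟶ W} (hz : IsBal M' N W z) :
    IsBal M N W (fun a => f.app (op a) ▷ N.obj a ≫ z a) := by
  intro a b
  have h : M.actR a b ≫ f.app (op a) = f.app (op b) ▷ _ ≫ M'.actR a b :=
    f.naturality (op b) (op a)
  rw [← comp_whiskerRight_assoc, h, comp_whiskerRight_assoc, hz a b,
    associator_naturality_left_assoc, whisker_exchange_assoc]

/-- The morphism `M ⊗_A N ⟶ M' ⊗_A N` induced by a `V`-natural transformation. -/
def tensorMap {M M' : VFun V Aᵒᵖ} (N : VFun V A) (f : M ⟶ M') :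
    tensorObj M N ⟶ tensorObj M' N :=
  tensorDesc _ (isBal_whiskerRight N f (isBal_tensorι M' N))

lemma tensorι_map {M M' : VFun V Aᵒᵖ} (N : VFun V A) (f : M ⟶ M') (a : A) :
    tensorι M N a ≫ tensorMap N f = f.app (op a) ▷ N.obj a ≫ tensorι M' N a :=
  tensorι_desc _ _ a

lemma tensorι_map_assoc {M M' : VFun V Aᵒᵖ} (N : VFun V A) (f : M ⟶ M') (a : A) {W : V}
    (h : tensorObj M' N ⟶ W) :
    tensorι M N a ≫ tensorMap N f ≫ h = f.app (op a) ▷ N.obj a ≫ tensorι M' N a ≫ h := by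
  rw [← Category.assoc, tensorι_map, Category.assoc]

/-- The functor `- ⊗_A N` on right `A`-modules. -/
@[simps]
def tensorWith (N : VFun V A) : VFun V Aᵒᵖ ⥤ V where
  obj M := tensorObj M N
  map f := tensorMap N f
  map_id M := tensorObj_hom_ext fun a => by
    rw [tensorι_map, id_app, id_whiskerRight, Category.id_comp, Category.comp_id]
  map_comp f g := tensorObj_hom_ext fun a => by
    rw [tensorι_map, tensorι_map_assoc, tensorι_map, comp_app, comp_whiskerRight, Category.assoc]

section

variable {J : Type*} [Category* J] {K : J ⥤ VFun V Aᵒᵖ} {c : Cocone K} {N : VFun V A}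
  (hc : ∀ a : A, IsColimit ((ev V (op a)).mapCocone c)) (s : Cocone (K ⋙ tensorWith N))

variable (c) in
/-- The components of a cocone of `V`-functors. -/
def coconeApp (j : J) (a : Aᵒᵖ) : (K.obj j).obj a ⟶ c.pt.obj a := Hom.app (c.ι.app j) a

/-- The components of a cocone under `K ⊗_A N`. -/
def tensorWithι (j : J) : tensorObj (K.obj j) N ⟶ s.pt := s.ι.app j

/-- The family of morphisms out of `c(a) ⊗ N(a)` induced by a cocone under `K ⊗_A N`. -/
def tensorWithDescAux (a : A) : c.pt.obj (op a) ⊗ N.obj a ⟶ s.pt :=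
  (whiskerRightIsColimit (hc a) (N.obj a)).desc
    { pt := s.pt
      ι :=
        { app := fun j => tensorι (K.obj j) N a ≫ tensorWithι s j
          naturality := fun i j f => by
            refine Eq.trans ?_ (Category.comp_id _).symm
            refine (tensorι_map_assoc N (K.map f) a (tensorWithι s j)).symm.trans ?_
            exact congrArg (_ ≫ ·) (s.w f) } }

lemma tensorWithDescAux_fac (a : A) (j : J) :
    coconeApp c j (op a) ▷ N.obj a ≫ tensorWithDescAux hc s a =
      tensorι (K.obj j) N a ≫ tensorWithι s j :=
  (whiskerRightIsColimit (hc a) (N.obj a)).fac _ j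

lemma coconeApp_whiskerRight_hom_ext
    (hc : ∀ a : A, IsColimit ((ev V (op a)).mapCocone c)) (a : A) {X Y : V}
    {f g : c.pt.obj (op a) ⊗ X ⟶ Y}
    (h : ∀ j, coconeApp c j (op a) ▷ X ≫ f = coconeApp c j (op a) ▷ X ≫ g) : f = g :=
  whiskerRight_hom_ext (hc a) h

/-- Tensoring preserves the pointwise colimit, so balancedness may be checked on each inclusion,
where it is that of K(j) ⊗_A N. -/
lemma isBal_tensorWithDescAux : IsBal c.pt N s.pt (tensorWithDescAux hc s) := by
  intro a b
  rw [← cancel_epi (α_ _ _ _).inv]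
  refine coconeApp_whiskerRight_hom_ext hc b fun j => ?_
  have h : (K.obj j).actR a b ≫ coconeApp c j (op a) =
      coconeApp c j (op b) ▷ _ ≫ c.pt.actR a b :=
    (c.ι.app j).naturality (op b) (op a)
  have h' := isBal_tensorι (K.obj j) N a b
  rw [associator_inv_naturality_left_assoc, ← comp_whiskerRight_assoc, ← h,
    comp_whiskerRight_assoc, tensorWithDescAux_fac, reassoc_of% h', Iso.inv_hom_id_assoc,
    Iso.inv_hom_id_assoc, ← whisker_exchange_assoc, tensorWithDescAux_fac]

/-- The functor `- ⊗_A N` maps pointwise colimits to colimits. -/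
def isColimitTensorWith : IsColimit ((tensorWith N).mapCocone c) where
  desc s := tensorDesc _ (isBal_tensorWithDescAux hc s)
  fac s j := tensorObj_hom_ext fun a => by
    refine (tensorι_map_assoc N (c.ι.app j) a _).trans ?_
    refine (congrArg (_ ≫ ·) (tensorι_desc _ (isBal_tensorWithDescAux hc s) a)).trans ?_
    exact tensorWithDescAux_fac hc s a j
  uniq s m hm := tensorObj_hom_ext fun a => coconeApp_whiskerRight_hom_ext hc a fun j => by
    refine Eq.trans ?_ (congrArg (_ ≫ ·) (tensorι_desc _ (isBal_tensorWithDescAux hc s) a)).symm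
    refine Eq.trans ?_ (tensorWithDescAux_fac hc s a j).symm
    refine (tensorι_map_assoc N (c.ι.app j) a m).symm.trans ?_
    exact congrArg (_ ≫ ·) (hm j)

end

instance preservesColimitsOfShape_tensorWith (N : VFun V A) (J : Type*) [Category* J]
    [HasColimitsOfShape J V] : PreservesColimitsOfShape J (tensorWith N) where
  preservesColimit := ⟨fun hc => ⟨isColimitTensorWith fun _ => isColimitOfPreserves _ hc⟩⟩

end

end VFun

end TensorModule

/-! ### Tensor functors are right exact. -/

namespace GenMod

variable {V : Type u} [Category.{v} V] [Abelian V] [IsGrothendieckAbelian.{v} V]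
  [MonoidalCategory V] [SymmetricCategory V] [MonoidalClosed V]
  {A : Type w} [EnrichedCategory V A] [IsSkeletallySmall V A]

open VFun

lemma tensorFunctor_act (N : VFun V A) (K L : FPMod V A) :
    (tensorFunctor N).act K L = tensorMapParam N (homEv K.obj L.obj) (isNat_homEv K.obj L.obj) :=
  ofAct_act _ _ _ _ _ _

/-- The functor underlying `- ⊗_A N`. -/
def toFunctorTensorFunctor (N : VFun V A) : toFunctor (tensorFunctor N) ≅
    (ObjectProperty.isFinitelyPresentable.{v} (VFun V Aᵒᵖ)).ι ⋙ tensorWith N :=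
  NatIso.ofComponents (fun _ => Iso.refl _) fun {K L} f => by
    refine (Category.comp_id _).trans (Eq.trans ?_ (Category.id_comp _).symm)
    refine (congrArg (fun t => (ρ_ _).inv ≫ _ ◁ eHomEquiv V f ≫ t)
      (tensorFunctor_act N K L)).trans ?_
    refine (congrArg ((ρ_ _).inv ≫ ·) (whiskerLeft_mapParam (isNat_homEv K.obj L.obj)
      (eHomEquiv V f) (isNat_of_hom f.hom) (homLift_ev _ (isNat_of_hom f.hom)))).trans ?_
    change _ = tensorMap N f.hom
    rw [Iso.inv_comp_eq]
    refine tensorObj_whisker_hom_ext fun a => ?_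
    rw [tensorι_mapParam, comp_whiskerRight, Category.assoc, reassoc_of% (@swapR_unit),
      rightUnitor_naturality_assoc]
    rw [tensorι_map]

variable [HasDualizableGenerators V]

instance preservesFiniteColimits_tensorFunctor (N : VFun V A) :
    PreservesFiniteColimits (toFunctor (tensorFunctor N)) := by
  have : PreservesFiniteColimits (tensorWith N) := ⟨fun _ => inferInstance⟩
  exact preservesFiniteColimits_of_natIso (toFunctorTensorFunctor N).symm

lemma isRightExact_of_iso_tensorFunctor {X : GenMod V A} {N : VFun V A}
    (α : X ≅ tensorFunctor N) : X.IsRightExact := by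
  have := preservesFiniteColimits_of_natIso (toNatIso α).symm
  exact isRightExact_of_preservesFiniteColimits

end GenMod

/-! ### Reconstruction of a right exact generalised module from its restriction to representables.
-/

namespace GenMod

variable {V : Type u} [Category.{v} V] [Abelian V] [IsGrothendieckAbelian.{v} V]
  [MonoidalCategory V] [SymmetricCategory V] [MonoidalClosed V] [HasDualizableGenerators V]
  {A : Type w} [EnrichedCategory V A] [IsSkeletallySmall V A]

open VFun

instance isFinitelyPresentable_unit : IsFinitelyPresentable.{v} (𝟙_ V) :=
  HasDualizableGenerators.isFinitelyPresentable_unit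

variable (V) in
/-- The representable right `A`-module of an object, as a finitely presented module. -/
abbrev rep (a : A) : FPMod V A :=
  ⟨corep V (op a), isFinitelyPresentable_corep (op a)⟩

/-- The tensor product of a finitely presented module with a dualizable object. -/
abbrev fpTens (d e : V) [ExactPairing e d] (K : FPMod V A) : FPMod V A :=
  ⟨tensObj d K.obj,
    letI : ExactPairing d e := BraidedCategory.exactPairing_swap e d
    have : IsFinitelyPresentable.{v} K.obj := K.property
    isFinitelyPresentable_tensObj d e K.obj⟩

/-- The tensor data exhibiting `fpTens d e K` as the tensor of `K` with `d`. -/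
def fpTensorData (d e : V) [ExactPairing e d] (K : FPMod V A) :
    TensorData d e K (fpTens d e K) where
  unit := (tensorData d e K.obj).unit
  counit := (tensorData d e K.obj).counit
  unit_counit := (tensorData d e K.obj).unit_counit
  counit_unit := (tensorData d e K.obj).counit_unit

variable (V) in
/-- The enriched Yoneda embedding on morphisms. -/
def repMap (a b : A) : (a ⟶[V] b) ⟶ (rep V a ⟶[V] rep V b) :=
  toHomCorep (corep V (op b)) (op a)

/-- The morphism `M(a) ⟶ [A(-, a), M]` of the enriched Yoneda lemma. -/
def repElem (M : FPMod V A) (a : A) : M.obj.obj (op a) ⟶ (rep V a ⟶[V] M) :=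
  toHomCorep M.obj (op a)

lemma eId_repMap (a : A) : eId V a ≫ repMap V a a = eId V (rep V a) :=
  eId_toHomCorep (op a)

lemma eComp_repMap (a b c : A) : eComp V a b c ≫ repMap V a c =
    (repMap V a b ⊗ₘ repMap V b c) ≫ eComp V (rep V a) (rep V b) (rep V c) :=
  eComp_toHomCorep a b c

lemma actR_repElem (M : FPMod V A) (a b : A) : M.obj.actR a b ≫ repElem M a =
    (β_ _ _).hom ≫ (repMap V a b ⊗ₘ repElem M b) ≫ eComp V (rep V a) (rep V b) M :=
  act_toHomCorep M.obj (op b) (op a)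

/-- The evaluation of the hom object of two finitely presented modules. -/
def fpEv (K L : FPMod V A) (a : A) : K.obj.obj (op a) ⊗ (K ⟶[V] L) ⟶ L.obj.obj (op a) :=
  homEv K.obj L.obj (op a)

lemma fpEv_repElem (K L : FPMod V A) (a : A) :
    fpEv K L a ≫ repElem L a = repElem K a ▷ _ ≫ eComp V (rep V a) K L :=
  homEv_toHomCorep K.obj L.obj (op a)

variable (X : GenMod V A)

/-- The left `A`-module obtained by restricting a generalised module to the representable
modules. -/
abbrev restrict : VFun V A :=
  mkAct (fun a => X.obj (rep V a))
    (fun a b => X.obj (rep V a) ◁ repMap V a b ≫ X.act (rep V a) (rep V b))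
    (fun a => by
      rw [← MonoidalCategory.whiskerLeft_comp_assoc, eId_repMap, act_id])
    (fun a b c => by
      rw [← MonoidalCategory.whiskerLeft_comp_assoc, eComp_repMap,
        MonoidalCategory.whiskerLeft_comp_assoc, act_comp, MonoidalCategory.tensorHom_def]
      simp only [MonoidalCategory.whiskerLeft_comp, Category.assoc, comp_whiskerRight]
      rw [associator_inv_naturality_right_assoc, associator_inv_naturality_middle_assoc,
        whisker_exchange_assoc])

lemma restrict_act (a b : A) : X.restrict.act a b =
    X.obj (rep V a) ◁ repMap V a b ≫ X.act (rep V a) (rep V b) :=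
  mkAct_act _ _ _ _ _ _

/-- The morphism `M(a) ⊗ X(A(-, a)) ⟶ X(M)`. -/
def restrictEv (M : FPMod V A) (a : A) : M.obj.obj (op a) ⊗ X.obj (rep V a) ⟶ X.obj M :=
  (β_ _ _).hom ≫ X.obj (rep V a) ◁ repElem M a ≫ X.act (rep V a) M

lemma actR_restrictEv (M : FPMod V A) (a b : A) :
    M.obj.actR a b ▷ X.obj (rep V a) ≫ X.restrictEv M a =
      (α_ _ _ _).hom ≫ M.obj.obj (op b) ◁ ((β_ _ _).hom ≫ X.obj (rep V a) ◁ repMap V a b ≫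
        X.act (rep V a) (rep V b)) ≫ X.restrictEv M b := by
  rw [restrictEv, restrictEv, BraidedCategory.braiding_naturality_left_assoc,
    ← MonoidalCategory.whiskerLeft_comp_assoc, actR_repElem,
    BraidedCategory.braiding_naturality_right_assoc]
  simp only [MonoidalCategory.whiskerLeft_comp, Category.assoc, comp_whiskerRight,
    MonoidalCategory.tensorHom_def]
  rw [act_comp, associator_inv_naturality_right_assoc, whisker_exchange_assoc,
    associator_inv_naturality_middle_assoc]
  simp only [← Category.assoc]
  congr 4
  simp only [BraidedCategory.braiding_tensor_left_hom, BraidedCategory.braiding_tensor_right_hom,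
    Category.assoc]
  -- What remains compares two ways of reversing the order of three factors.
  have h := BraidedCategory.yang_baxter (M.obj.obj (op b)) (a ⟶[V] b) (X.obj (rep V a))
  rw [Iso.inv_comp_eq] at h
  rw [← cancel_mono (α_ _ _ _).hom]
  simpa using h.symm

lemma isBal_restrictEv (M : FPMod V A) : IsBal M.obj X.restrict _ (X.restrictEv M) := fun a b =>
  (X.actR_restrictEv M a b).trans (by rw [actL, restrict_act])

/-- V-naturality of the comparison, before passing to the coend: `fpEv_repElem` turns the evaluation
into a composition in mod A, which X respects. -/
lemma fpEv_restrictEv (K L : FPMod V A) (a : A) :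
    swapR _ _ _ ≫ fpEv K L a ▷ X.obj (rep V a) ≫ X.restrictEv L a =
      X.restrictEv K a ▷ (K ⟶[V] L) ≫ X.act K L := by
  rw [restrictEv, restrictEv, BraidedCategory.braiding_naturality_left_assoc,
    ← MonoidalCategory.whiskerLeft_comp_assoc, fpEv_repElem,
    MonoidalCategory.whiskerLeft_comp_assoc, act_comp, associator_inv_naturality_middle_assoc]
  simp only [comp_whiskerRight, Category.assoc]
  simp only [← Category.assoc]
  congr 3
  simp [swapR, ← MonoidalCategory.whiskerLeft_comp_assoc]

/-- The morphism `M ⊗_A X|_A ⟶ X(M)`. -/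
def tensorRestrictApp (M : FPMod V A) : tensorObj M.obj X.restrict ⟶ X.obj M :=
  tensorDesc _ (X.isBal_restrictEv M)

lemma tensorι_restrictApp (M : FPMod V A) (a : A) :
    tensorι M.obj X.restrict a ≫ X.tensorRestrictApp M = X.restrictEv M a :=
  tensorι_desc _ _ a

lemma tensorι_restrictApp_comp (M : FPMod V A) (a : A) {W : V} (h : X.obj M ⟶ W) :
    tensorι M.obj X.restrict a ≫ X.tensorRestrictApp M ≫ h = X.restrictEv M a ≫ h := by
  rw [← Category.assoc, tensorι_restrictApp]

lemma tensorRestrictApp_naturality (K L : FPMod V A) :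
    tensorMapParam X.restrict (homEv K.obj L.obj) (isNat_homEv K.obj L.obj) ≫
      X.tensorRestrictApp L = X.tensorRestrictApp K ▷ homObj K.obj L.obj ≫ X.act K L := by
  refine tensorObj_whisker_hom_ext fun a => ?_
  refine Eq.trans ?_ ((X.fpEv_restrictEv K L a).trans ?_)
  · rw [← Category.assoc, tensorι_mapParam, Category.assoc, Category.assoc, tensorι_restrictApp]
    rfl
  · rw [← tensorι_restrictApp]
    exact (congrArg (· ≫ _) (comp_whiskerRight _ _ _)).trans (Category.assoc _ _ _)

/-- The canonical morphism `- ⊗_A X|_A ⟶ X`. -/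
def tensorRestrict : tensorFunctor X.restrict ⟶ X where
  app M := X.tensorRestrictApp M
  naturality K L := (congrArg (· ≫ _) (tensorFunctor_act X.restrict K L)).trans
    (X.tensorRestrictApp_naturality K L)

lemma restrictEv_rep (a b : A) : X.restrictEv (rep V b) a = X.restrict.actL a b := by
  rw [actL, restrict_act]
  rfl

lemma leftUnitor_inv_whiskerRight_comp {W H H' N T : V} (u : 𝟙_ V ⟶ W) (f : W ⊗ H ⟶ H')
    (t : H' ⊗ N ⟶ T) : (λ_ _).inv ≫ u ▷ _ ≫ (α_ _ _ _).inv ≫ f ▷ N ≫ t =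
      ((λ_ _).inv ≫ u ▷ H ≫ f) ▷ N ≫ t := by
  simp

/-- The co-Yoneda lemma: the coend of A(a, b) ⊗ N(a) over a is N(b). The inverse sends n to the
class of id_b ⊗ n. -/
lemma isIso_tensorRestrict_rep (b : A) : IsIso (X.tensorRestrict.app (rep V b)) := by
  change IsIso (X.tensorRestrictApp (rep V b))
  refine ⟨(λ_ _).inv ≫ eId V b ▷ _ ≫ tensorι (corep V (op b)) X.restrict b, ?_, ?_⟩
  · refine tensorObj_hom_ext fun a => ?_
    refine (X.tensorι_restrictApp_comp (rep V b) a _).trans ?_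
    rw [Category.comp_id, restrictEv_rep, leftUnitor_inv_naturality_assoc,
      whisker_exchange_assoc]
    -- Balancing identifies id_b ⊗ h·n with id_b·h ⊗ n = h ⊗ n, for h in A(a, b) and n in N(a).
    have h := isBal_tensorι (corep V (op b)) X.restrict a b
    have h' : (λ_ _).inv ≫ eId V b ▷ _ ≫ (corep V (op b)).actR a b = 𝟙 _ := by
      rw [actR, corep_act]
      exact e_id_comp V (op b) (op a)
    rw [← Iso.inv_comp_eq] at h
    refine (congrArg (fun t => (λ_ ((a ⟶[V] b) ⊗ X.obj (rep V a))).inv ≫ eId V b ▷ _ ≫ t)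
      h.symm).trans ?_
    refine Eq.trans ?_ ((congrArg (fun t => t ▷ X.restrict.obj a ≫
      tensorι (corep V (op b)) X.restrict a) h').trans ?_)
    · exact leftUnitor_inv_whiskerRight_comp _ _ _
    · rw [id_whiskerRight, Category.id_comp]
  · rw [Category.assoc, Category.assoc]
    refine (congrArg (fun t => (λ_ _).inv ≫ eId V b ▷ _ ≫ t)
      ((X.tensorι_restrictApp (rep V b) b).trans (X.restrictEv_rep b b))).trans ?_
    rw [actL, BraidedCategory.braiding_naturality_left_assoc, act_id]
    simp

section

variable {X} {Y Z : GenMod V A} (α : Y ⟶ Z)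

/-- The property of a right module that a morphism of generalised modules is invertible on it. -/
def IsIsoOn : ObjectProperty (VFun V Aᵒᵖ) := fun M =>
  ∃ h : IsFinitelyPresentable.{v} M, IsIso (α.app ⟨M, h⟩)

instance : (IsIsoOn α).IsClosedUnderIsomorphisms where
  of_iso {M M'} e := fun ⟨h, h'⟩ => by
    have hM : IsFinitelyPresentable.{v} M' := (ObjectProperty.prop_iff_of_iso
      (ObjectProperty.isFinitelyPresentable.{v} (VFun V Aᵒᵖ)) e).1 h
    refine ⟨hM, ?_⟩
    let i : (⟨M, h⟩ : FPMod V A) ≅ ⟨M', hM⟩ := ObjectProperty.isoMk _ e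
    exact (NatTrans.isIso_app_iff_of_iso (toNatTrans α) i).1 h'

/-- Both functors send the colimit cocone to a colimit cocone, and the component at the colimit is
the map induced by the invertible components on the diagram. -/
lemma isClosedUnderColimitsOfShape_isIsoOn [PreservesFiniteColimits (toFunctor Y)]
    [PreservesFiniteColimits (toFunctor Z)] (J : Type v) [SmallCategory J] [FinCategory J] :
    (IsIsoOn α).IsClosedUnderColimitsOfShape J where
  colimitsOfShape_le := by
    rintro M ⟨p⟩
    choose h₁ h₂ using p.prop_diag_obj
    have hM : IsFinitelyPresentable.{v} M :=
      ObjectProperty.prop_of_isColimit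
        (ObjectProperty.isFinitelyPresentable.{v} (VFun V Aᵒᵖ)) p.isColimit h₁
    refine ⟨hM, ?_⟩
    let P := ObjectProperty.isFinitelyPresentable.{v} (VFun V Aᵒᵖ)
    let F : J ⥤ FPMod V A := P.lift p.diag h₁
    let c : Cocone F :=
      { pt := ⟨M, hM⟩
        ι := { app := fun j => P.homMk (p.ι.app j)
               naturality := fun i j f => by
                ext1
                exact p.ι.naturality f } }
    have hc : IsColimit c := isColimitOfReflects P.ι p.isColimit
    have (j : J) : IsIso ((Functor.whiskerLeft F (toNatTrans α)).app j) := h₂ j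
    have := NatIso.isIso_of_isIso_app (Functor.whiskerLeft F (toNatTrans α))
    let h := (IsColimit.coconePointsIsoOfNatIso (isColimitOfPreserves (toFunctor Y) hc)
      (isColimitOfPreserves (toFunctor Z) hc) (asIso (Functor.whiskerLeft F (toNatTrans α))))
    have e : α.app ⟨M, hM⟩ = h.hom := by
      refine (isColimitOfPreserves (toFunctor Y) hc).hom_ext fun j => ?_
      refine Eq.trans ?_ (IsColimit.comp_coconePointsIsoOfNatIso_hom
        (isColimitOfPreserves (toFunctor Y) hc) (isColimitOfPreserves (toFunctor Z) hc)
        (asIso (Functor.whiskerLeft F (toNatTrans α))) j).symm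
      exact (toNatTrans α).naturality (c.ι.app j)
    rw [e]
    exact h.isIso_hom

end

lemma isIso_tensorRestrict [PreservesFiniteColimits (toFunctor X)] : IsIso X.tensorRestrict := by
  have h (M : VFun V Aᵒᵖ) (hM : IsFinitelyPresentable.{v} M) : IsIsoOn X.tensorRestrict M := by
    refine isFinitelyPresentable_induction _
      (isClosedUnderColimitsOfShape_isIsoOn X.tensorRestrict) (fun a d e _ => ?_) M hM
    have := X.isIso_tensorRestrict_rep a.unop
    exact ⟨(fpTens d e (rep V a.unop)).property,
      (fpTensorData d e (rep V a.unop)).isIso_app X.tensorRestrict⟩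
  have (M : FPMod V A) : IsIso (X.tensorRestrict.app M) := (h M.obj M.property).2
  exact isIso_of_isIso_app X.tensorRestrict this

variable {X} in
lemma IsRightExact.exists_iso_tensorFunctor (hX : X.IsRightExact) :
    ∃ N : VFun V A, Nonempty (X ≅ tensorFunctor N) := by
  have := hX.preservesFiniteColimits
  have := X.isIso_tensorRestrict
  exact ⟨X.restrict, ⟨(asIso X.tensorRestrict).symm⟩⟩

end GenMod

/-! ### Finitely presented quotients need only finitely many relations. -/

section FiniteQuotients

variable {D : Type*} [Category* D] [Abelian D] {I : Type v} {G : I → D} {P : D}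
  (n : ∀ i, G i ⟶ P)

/-- The quotient of an object by the images of finitely many morphisms. -/
def finiteQuotient (s : Finset I) : D := cokernel (Sigma.desc fun i : s => n i)

/-- The projection to the quotient. -/
def finiteQuotientπ (s : Finset I) : P ⟶ finiteQuotient n s := cokernel.π _

instance (s : Finset I) : Epi (finiteQuotientπ n s) :=
  inferInstanceAs (Epi (cokernel.π _))

lemma finiteQuotient_condition {s : Finset I} {i : I} (hi : i ∈ s) :
    n i ≫ finiteQuotientπ n s = 0 := by
  have h := Sigma.ι (fun i : s => G i) ⟨i, hi⟩ ≫= cokernel.condition (Sigma.desc fun i : s => n i)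
  rwa [Sigma.ι_desc_assoc, comp_zero] at h

variable {n} in
/-- The universal property of the quotient. -/
def finiteQuotientDesc {s : Finset I} {T : D} (φ : P ⟶ T) (h : ∀ i ∈ s, n i ≫ φ = 0) :
    finiteQuotient n s ⟶ T :=
  cokernel.desc _ φ (Sigma.hom_ext _ _ fun i => by
    rw [Sigma.ι_desc_assoc, comp_zero]
    exact h i i.2)

variable {n} in
lemma finiteQuotientπ_desc {s : Finset I} {T : D} (φ : P ⟶ T) (h : ∀ i ∈ s, n i ≫ φ = 0) :
    finiteQuotientπ n s ≫ finiteQuotientDesc φ h = φ :=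
  cokernel.π_desc _ _ _

variable {n} in
lemma finiteQuotientπ_desc_assoc {s : Finset I} {T T' : D} (φ : P ⟶ T)
    (h : ∀ i ∈ s, n i ≫ φ = 0) (ψ : T ⟶ T') :
    finiteQuotientπ n s ≫ finiteQuotientDesc φ h ≫ ψ = φ ≫ ψ :=
  cokernel.π_desc_assoc _ _ _ _

/-- The directed system of the quotients by finitely many morphisms. -/
abbrev finiteQuotients : Finset I ⥤ D where
  obj s := finiteQuotient n s
  map {s t} f := finiteQuotientDesc (finiteQuotientπ n t)
    fun _ hi => finiteQuotient_condition n (leOfHom f hi)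
  map_id s := by
    rw [← cancel_epi (finiteQuotientπ n s), finiteQuotientπ_desc, Category.comp_id]
  map_comp {s t u} f g := by
    rw [← cancel_epi (finiteQuotientπ n s), finiteQuotientπ_desc, finiteQuotientπ_desc_assoc,
      finiteQuotientπ_desc]

variable {n} {Y : D} {p : P ⟶ Y} (hn : ∀ i, n i ≫ p = 0)

/-- The cocone under the directed system of finite quotients given by a morphism. -/
abbrev finiteQuotientsCocone : Cocone (finiteQuotients n) where
  pt := Y
  ι :=
    { app := fun s => finiteQuotientDesc p fun i _ => hn i
      naturality := fun s t f => by
        refine (cancel_epi (finiteQuotientπ n s)).1 ?_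
        refine (finiteQuotientπ_desc_assoc (finiteQuotientπ n t)
          (fun _ hi => finiteQuotient_condition n (leOfHom f hi)) _).trans ?_
        refine (finiteQuotientπ_desc p fun i _ => hn i).trans ?_
        exact ((congrArg (finiteQuotientπ n s ≫ ·) (Category.comp_id _)).trans
          (finiteQuotientπ_desc p fun i _ => hn i)).symm }

lemma finiteQuotientπ_cocone (c : Cocone (finiteQuotients n)) {s t : Finset I} (h : s ⊆ t) :
    finiteQuotientπ n s ≫ c.ι.app s = finiteQuotientπ n t ≫ c.ι.app t := by
  rw [← c.w (homOfLE h)]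
  exact finiteQuotientπ_desc_assoc (finiteQuotientπ n t)
    (fun _ hi => finiteQuotient_condition n (h hi)) (c.ι.app t)

variable [Epi p] (h : ∀ {T : D} (φ : P ⟶ T), (∀ i, n i ≫ φ = 0) → ∃ ψ, p ≫ ψ = φ)

/-- The quotient by a family of morphisms is the directed colimit of the finite quotients. -/
def isColimitFiniteQuotientsCocone : IsColimit (finiteQuotientsCocone hn) := by
  -- Stage ∅ is P modulo nothing, so its leg gives a morphism out of P. This morphism kills n i
  -- because it also factors through stage {i}.
  have key (c : Cocone (finiteQuotients n)) :
      ∃ ψ : Y ⟶ c.pt, p ≫ ψ = finiteQuotientπ n ∅ ≫ c.ι.app ∅ :=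
    h _ fun i => by
      rw [finiteQuotientπ_cocone c (Finset.empty_subset {i})]
      refine (Category.assoc _ _ _).symm.trans ?_
      exact (congrArg (· ≫ _)
        (finiteQuotient_condition n (Finset.mem_singleton_self i))).trans zero_comp
  exact
    { desc := fun c => (key c).choose
      fac := fun c s => by
        refine (cancel_epi (finiteQuotientπ n s)).1 ?_
        refine (finiteQuotientπ_desc_assoc p (fun i _ => hn i) _).trans
          ((key c).choose_spec.trans ?_)
        exact finiteQuotientπ_cocone c (Finset.empty_subset s)
      uniq := fun c m hm => by
        refine (cancel_epi p).1 (Eq.trans ?_ (key c).choose_spec.symm)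
        rw [← hm ∅]
        exact (finiteQuotientπ_desc_assoc p (fun i _ => hn i) m).symm }

include hn h in
/-- If a finitely presented object is the quotient of a finitely presented object by a family of
morphisms, then finitely many of these morphisms suffice. -/
lemma exists_finset_of_isFinitelyPresentable [IsFinitelyPresentable.{v} P]
    [IsFinitelyPresentable.{v} Y] :
    ∃ s : Finset I, ∀ {T : D} (φ : P ⟶ T), (∀ i ∈ s, n i ≫ φ = 0) → ∃ ψ, p ≫ ψ = φ := by
  have hc := isColimitFiniteQuotientsCocone hn h
  -- Finite presentation of Y lifts its identity to a map σ into a finite stage.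
  obtain ⟨s, σ, hσ⟩ := IsFinitelyPresentable.exists_hom_of_isColimit hc (𝟙 Y)
  have hσ' : p ≫ σ ≫ (finiteQuotientsCocone hn).ι.app s =
      finiteQuotientπ n s ≫ (finiteQuotientsCocone hn).ι.app s := by
    rw [hσ]
    exact (Category.comp_id _).trans (finiteQuotientπ_desc p fun i _ => hn i).symm
  -- The projection of P and p followed by σ agree in the colimit, hence at a later stage t since P
  -- is finitely presented. The relations in t therefore suffice.
  obtain ⟨t, u, v, hu⟩ := IsFinitelyPresentable.exists_eq_of_isColimit hc (p ≫ σ)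
    (finiteQuotientπ n s) ((Category.assoc _ _ _).trans hσ')
  refine ⟨t, fun φ hφ => ⟨σ ≫ (finiteQuotients n).map u ≫ finiteQuotientDesc φ hφ, ?_⟩⟩
  have h' := hu =≫ finiteQuotientDesc φ hφ
  rw [Category.assoc, Category.assoc, Category.assoc] at h'
  refine h'.trans ((finiteQuotientπ_desc_assoc (finiteQuotientπ n t)
    (fun _ hi => finiteQuotient_condition n (leOfHom v hi)) _).trans ?_)
  exact finiteQuotientπ_desc φ hφ

end FiniteQuotients

section

open Cardinal

attribute [local instance] fact_isRegular_aleph0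

/-- A zero object is a colimit of the empty diagram. -/
lemma isFinitelyPresentable_of_isZero {D : Type*} [Category* D] [LocallySmall.{v} D] {X : D}
    (h : IsZero X) : IsFinitelyPresentable.{v} X := by
  have := isClosedUnderColimitsOfShape_isCardinalPresentable (C := D) (κ := ℵ₀)
    (J := Discrete PEmpty.{1}) ((hasCardinalLT_aleph0_iff _).2 inferInstance)
  exact ObjectProperty.prop_of_isColimit (isCardinalPresentable D ℵ₀)
    (c := asEmptyCocone X) h.isInitial fun j => j.1.elim

end

namespace VFun.TensorData

variable {V : Type u} [Category.{v} V] [MonoidalCategory V] [SymmetricCategory V]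
  [MonoidalClosed V] {C : Type w} [EnrichedCategory V C] {d e : V} [ExactPairing e d] {c c' : C}
  (D : TensorData d e c c')

lemma elem_app {F G : VFun V C} (x : e ⟶ F.obj c) (f : F ⟶ G) :
    D.elem x ≫ f.app c' = D.elem (x ≫ f.app c) := by
  rw [elem, elem, Category.assoc, Category.assoc, D.retr_naturality, comp_whiskerRight_assoc]

lemma elem_injective {F : VFun V C} {x y : e ⟶ F.obj c} (h : D.elem x = D.elem y) : x = y := by
  rw [← D.elem_recover x, h, D.elem_recover]

end VFun.TensorData

/-! ### Corepresentable generalised modules as test objects. -/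

namespace GenMod

open VFun

variable {V : Type u} [Category.{v} V] [Abelian V] [IsGrothendieckAbelian.{v} V]
  [MonoidalCategory V] [SymmetricCategory V] [MonoidalClosed V]
  {A : Type w} [EnrichedCategory V A] [IsSkeletallySmall V A]

/-- The morphism of corepresentable generalised modules given by a morphism of finitely presented
modules. -/
def corepMap {K L : FPMod V A} (f : K ⟶ L) : corep V L ⟶ corep V K :=
  corepHom (F := corep V K) (eHomEquiv V f)

lemma corepMap_corepHom {X : GenMod V A} {K L : FPMod V A} (f : K ⟶ L) (x : 𝟙_ V ⟶ X.obj K) :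
    corepMap f ≫ corepHom x = corepHom (x ≫ X.map f) := by
  refine (corepHom_comp _ _).trans (congrArg corepHom ?_)
  rw [corepHom_app, leftUnitor_inv_naturality_assoc, whisker_exchange_assoc, GenMod.map,
    VFun.mapElem, rightUnitor_inv_naturality_assoc, unitors_inv_equal]

lemma exists_corepMap {K L : FPMod V A} (f : corep V L ⟶ corep V K) : ∃ g, corepMap g = f := by
  refine ⟨(eHomEquiv V).symm (eId V L ≫ f.app L), ?_⟩
  rw [corepMap, Equiv.apply_symm_apply]
  exact corepHom_eId f

lemma eId_corepMap {K L : FPMod V A} (f : K ⟶ L) : eId V L ≫ (corepMap f).app L = eHomEquiv V f :=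
  eId_corepHom _

lemma corepMap_injective {K L : FPMod V A} {f g : K ⟶ L} (h : corepMap f = corepMap g) :
    f = g := by
  apply (eHomEquiv V).injective
  rw [← eId_corepMap, h, eId_corepMap]

@[simp]
lemma corepMap_id (K : FPMod V A) : corepMap (𝟙 K) = 𝟙 _ := by
  refine Eq.trans ?_ (corepHom_eId (𝟙 (corep V K)))
  rw [corepMap, eHomEquiv_id]
  exact congrArg corepHom (Category.comp_id _).symm

lemma corepMap_comp {K L M : FPMod V A} (f : K ⟶ L) (g : L ⟶ M) :
    corepMap (f ≫ g) = corepMap g ≫ corepMap f := by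
  refine ((corepMap_corepHom (X := corep V K) g (eHomEquiv V f)).trans
    (congrArg corepHom ?_)).symm
  rw [eHomEquiv_comp, GenMod.map, VFun.mapElem, corep_act, MonoidalCategory.tensorHom_def,
    rightUnitor_inv_naturality_assoc, unitors_inv_equal, Category.assoc]

lemma corepMap_add {K L : FPMod V A} (f g : K ⟶ L) :
    corepMap (f + g) = corepMap f + corepMap g := by
  refine corep_hom_ext (F := corep V K) ?_
  refine (eId_corepMap _).trans ((eHomEquiv_add f g).trans ?_)
  rw [add_app]
  exact (congrArg₂ (· + ·) (eId_corepMap f).symm (eId_corepMap g).symm).trans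
    (Preadditive.comp_add _ _ _ _ _ _).symm

/-- The contravariant Yoneda embedding of the finitely presented modules. -/
@[simps]
def corepFunctor : (FPMod V A)ᵒᵖ ⥤ GenMod V A where
  obj K := corep V K.unop
  map f := corepMap f.unop
  map_id K := corepMap_id K.unop
  map_comp f g := corepMap_comp g.unop f.unop

instance : (corepFunctor (V := V) (A := A)).Additive where
  map_add := corepMap_add _ _

@[simp]
lemma corepMap_zero (K L : FPMod V A) : corepMap (0 : K ⟶ L) = 0 :=
  corepFunctor.map_zero (op L) (op K)

variable [HasDualizableGenerators V]

section Biproduct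

variable {J : Type*} [Finite J] {K : J → FPMod V A}

open Classical in
/-- The morphism from the functor corepresented by a finite sum given by its components. -/
def corepDesc {X : GenMod V A} (a : ∀ j, corep V (K j) ⟶ X) : corep V (⨁ K) ⟶ X :=
  letI := Fintype.ofFinite J
  ∑ j, corepMap (biproduct.ι K j) ≫ a j

/-- The embedding is contravariant and additive, so the projections of the biproduct become the
inclusions of a finite sum of corepresentables. Thus finitely many corepresentables may be replaced
by one. -/
lemma corepMap_π_desc {X : GenMod V A} (a : ∀ j, corep V (K j) ⟶ X) (j : J) :
    corepMap (biproduct.π K j) ≫ corepDesc a = a j := by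
  classical
  let _ := Fintype.ofFinite J
  rw [corepDesc, Preadditive.comp_sum, Finset.sum_eq_single j]
  · rw [← Category.assoc, ← corepMap_comp, biproduct.ι_π_self, corepMap_id, Category.id_comp]
  · intro i _ hi
    rw [← Category.assoc, ← corepMap_comp, biproduct.ι_π_ne _ hi, corepMap_zero, zero_comp]
  · exact fun h => (h (Finset.mem_univ j)).elim

lemma corepDesc_comp {X Y : GenMod V A} (a : ∀ j, corep V (K j) ⟶ X) (f : X ⟶ Y) :
    corepDesc a ≫ f = corepDesc fun j => a j ≫ f := by
  rw [corepDesc, corepDesc, Preadditive.sum_comp]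
  simp

lemma corepDesc_zero {X : GenMod V A} : corepDesc (fun j => (0 : corep V (K j) ⟶ X)) = 0 := by
  simp [corepDesc]

end Biproduct

section Separating

lemma comp_app_eq_zero {X Y : GenMod V A} {φ : X ⟶ Y} {K : FPMod V A} {x : 𝟙_ V ⟶ X.obj K}
    (h : corepHom x ≫ φ = 0) : x ≫ φ.app K = 0 :=
  (congrArg (· ≫ _) (eId_corepHom x).symm).trans ((Category.assoc _ _ _).trans
    ((congrArg (fun t => eId V K ≫ Hom.app t K) h).trans comp_zero))

/-- The generators of V need not include the unit, but an element of X(K) over a dualizable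
generator is an ordinary element of X at the tensor of K with its dual, which is again in mod A. -/
lemma eq_zero_of_corep {X Y : GenMod V A} {φ : X ⟶ Y}
    (h : ∀ (K : FPMod V A) (u : corep V K ⟶ X), u ≫ φ = 0) : φ = 0 := by
  obtain ⟨ι, g, hd, hg⟩ := HasDualizableGenerators.exists_generators (V := V)
  ext K
  refine hg _ _ ?_
  rintro _ ⟨i⟩ x
  obtain ⟨d, ⟨_⟩⟩ := hd i
  let D := fpTensorData d (g i) K
  refine D.elem_injective ?_
  rw [← D.elem_app, ← D.elem_app]
  exact (comp_app_eq_zero (h _ (corepHom (D.elem x)))).trans comp_zero.symm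

/-- The same test with a small set of corepresentables, as is needed to index a directed system of
finite quotients. -/
lemma eq_zero_of_skeleton {X Y : GenMod V A} {φ : X ⟶ Y} {S : Type*} {σ : S → FPMod V A}
    {r : FPMod V A → S} (e : ∀ K, ElemIso (V := V) K (σ (r K)))
    (h : ∀ (s : S) (u : 𝟙_ V ⟶ X.obj (σ s)), corepHom u ≫ φ = 0) : φ = 0 := by
  refine eq_zero_of_corep fun K u => corep_hom_ext ?_
  have key : φ.app K = X.mapElem (e K).hom ≫ φ.app _ ≫ Y.mapElem (e K).inv := by
    rw [← φ.mapElem_naturality, ← Category.assoc, mapElem_hom_inv, Category.id_comp]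
  have h' := comp_app_eq_zero (h (r K) ((eId V K ≫ u.app K) ≫ X.mapElem (e K).hom))
  rw [comp_app, key, ← Category.assoc, ← Category.assoc, ← Category.assoc, h', zero_comp]
  exact comp_zero.symm

/-- Lifts are required only after an epimorphic refinement r, as corepresentables need not be
projective. -/
lemma epi_of_corep {P Y : GenMod V A} (p : P ⟶ Y)
    (h : ∀ (K : FPMod V A) (u : corep V K ⟶ Y), ∃ (K' : FPMod V A) (r : corep V K' ⟶ corep V K)
      (v : corep V K' ⟶ P), Epi r ∧ v ≫ p = r ≫ u) : Epi p := by
  refine Preadditive.epi_of_cancel_zero _ fun φ hφ => eq_zero_of_corep fun K u => ?_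
  obtain ⟨K', r, v, _, hv⟩ := h K u
  rw [← cancel_epi r, ← reassoc_of% hv, hφ, comp_zero, comp_zero]

lemma exact_of_corep {S : ShortComplex (GenMod V A)}
    (h : ∀ (K : FPMod V A) (u : corep V K ⟶ S.X₂), u ≫ S.g = 0 →
      ∃ (K' : FPMod V A) (r : corep V K' ⟶ corep V K)
        (v : corep V K' ⟶ S.X₁), Epi r ∧ v ≫ S.f = r ≫ u) : S.Exact := by
  rw [S.exact_iff_epi_kernel_lift]
  refine epi_of_corep _ fun K u => ?_
  obtain ⟨K', r, v, hr, hv⟩ := h K (u ≫ kernel.ι S.g) (by simp)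
  refine ⟨K', r, v, hr, ?_⟩
  rw [← cancel_mono (kernel.ι S.g), Category.assoc, kernel.lift_ι, hv, Category.assoc]

lemma mono_of_corep {K : FPMod V A} {Y : GenMod V A} (i : corep V K ⟶ Y)
    (h : ∀ (L : FPMod V A) (u : corep V L ⟶ corep V K), u ≫ i = 0 → u = 0) : Mono i := by
  refine Preadditive.mono_of_kernel_zero (eq_zero_of_corep fun L u => ?_)
  exact h L _ (by simp)

end Separating

section Lifting

open scoped ZeroObject

/-- A jointly epimorphic family presents 0 as a quotient of the unit; since the unit and 0 are
finitely presented, finitely many members already do so. -/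
lemma exists_finset_of_unit {I : Type v} {G : I → V} {n : ∀ i, G i ⟶ 𝟙_ V}
    (h : ∀ {T : V} (φ : 𝟙_ V ⟶ T), (∀ i, n i ≫ φ = 0) → φ = 0) :
    ∃ s : Finset I, ∀ {T : V} (φ : 𝟙_ V ⟶ T), (∀ i ∈ s, n i ≫ φ = 0) → φ = 0 := by
  have := isFinitelyPresentable_of_isZero (isZero_zero V)
  obtain ⟨s, hs⟩ := exists_finset_of_isFinitelyPresentable (n := n) (p := (0 : _ ⟶ (0 : V)))
    (fun _ => comp_zero) fun φ hφ => ⟨0, by rw [h φ hφ, comp_zero]⟩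
  refine ⟨s, fun φ hφ => ?_⟩
  obtain ⟨ψ, hψ⟩ := hs φ hφ
  rw [← hψ, zero_comp]

/-- The element x of Y(K) given by u lifts to P(K) over the pullback, which covers the unit.
Finitely many generators mapping to the pullback still cover it, and dualizability turns them into
corepresentables at tensors of K; their finite sum is the refinement. -/
lemma exists_lift {P Y : GenMod V A} (p : P ⟶ Y) [Epi p] {K : FPMod V A} (u : corep V K ⟶ Y) :
    ∃ (K' : FPMod V A) (r : corep V K' ⟶ corep V K) (v : corep V K' ⟶ P),
      Epi r ∧ v ≫ p = r ≫ u := by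
  obtain ⟨ι, g, hd, hg⟩ := HasDualizableGenerators.exists_generators (V := V)
  choose d hd' using hd
  have D (i : ι) : ExactPairing (g i) (d i) := (hd' i).some
  let x : 𝟙_ V ⟶ Y.obj K := eId V K ≫ u.app K
  have : Epi (p.app K) := inferInstance
  let I := Σ i : ι, (g i ⟶ pullback x (p.app K))
  obtain ⟨s, hs⟩ := exists_finset_of_unit (I := I)
    (n := fun i => i.2 ≫ pullback.fst x (p.app K)) fun {T} φ h => by
      rw [← cancel_epi (pullback.fst x (p.app K)), comp_zero]
      refine hg _ _ ?_
      rintro _ ⟨i⟩ y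
      rw [comp_zero, ← Category.assoc]
      exact h ⟨i, y⟩
  let D' (i : I) := fpTensorData (d i.1) (g i.1) K
  let q (i : s) : corep V (fpTens (d i.1.1) (g i.1.1) K) ⟶ corep V K :=
    corepHom ((D' i.1).elem (F := corep V K) (i.1.2 ≫ pullback.fst x (p.app K) ≫ eId V K))
  let q' (i : s) : corep V (fpTens (d i.1.1) (g i.1.1) K) ⟶ P :=
    corepHom ((D' i.1).elem (i.1.2 ≫ pullback.snd x (p.app K)))
  refine ⟨⨁ fun i : s => fpTens (d i.1.1) (g i.1.1) K, corepDesc q, corepDesc q', ?_, ?_⟩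
  -- By Yoneda a morphism out of `corep V K` is an element of T(K), and vanishing of such an element
  -- can be tested on the finite cover of the unit.
  · refine Preadditive.epi_of_cancel_zero _ fun {T} φ hφ => corep_hom_ext ?_
    refine Eq.trans ?_ comp_zero.symm
    refine hs _ fun i hi => ?_
    refine (D' i).elem_injective (F := T) ?_
    have h := corepMap_π_desc q ⟨i, hi⟩ =≫ φ
    rw [Category.assoc, hφ, comp_zero] at h
    have h' := comp_app_eq_zero h.symm
    rw [(D' i).elem_app (F := corep V K), Category.assoc, Category.assoc] at h'
    rw [← Category.assoc] at h'
    refine h'.trans ?_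
    rw [TensorData.elem, MonoidalPreadditive.zero_whiskerRight, zero_comp, comp_zero]
  · rw [corepDesc_comp, corepDesc_comp]
    congr 1
    ext1 i
    refine (corepHom_comp _ _).trans (Eq.trans ?_ (corepHom_comp _ _).symm)
    congr 1
    rw [(D' i.1).elem_app, (D' i.1).elem_app, Category.assoc, Category.assoc, Category.assoc,
      ← pullback.condition]

end Lifting

end GenMod

/-! ### Finitely presented generalised modules are coherent. -/

namespace GenMod

open VFun

variable {V : Type u} [Category.{v} V] [Abelian V] [IsGrothendieckAbelian.{v} V]
  [MonoidalCategory V] [SymmetricCategory V] [MonoidalClosed V] [HasDualizableGenerators V]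
  {A : Type w} [EnrichedCategory V A] [IsSkeletallySmall V A]

open scoped ZeroObject

/-- The relations are all elements of the kernel at the objects of a small skeleton; they present Y.
Finite presentation reduces them to finitely many, which one corepresentable gathers. -/
lemma exists_corep_exact {P Y : GenMod V A} (p : P ⟶ Y) [Epi p]
    (hP : IsFinitelyPresentable.{v} P) (hY : IsFinitelyPresentable.{v} Y) :
    ∃ (M : FPMod V A) (m : corep V M ⟶ P) (h : m ≫ p = 0), (ShortComplex.mk m p h).Exact := by
  obtain ⟨S, σ, r, he⟩ := exists_elemIso V (FPMod V A)
  let I := Σ s : S, { x : 𝟙_ V ⟶ P.obj (σ s) // x ≫ p.app (σ s) = 0 }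
  let n (i : I) : corep V (σ i.1) ⟶ P := corepHom i.2.1
  have hn (i : I) : n i ≫ p = 0 :=
    (corepHom_comp _ _).trans (corep_hom_ext ((eId_corepHom _).trans
      (i.2.2.trans comp_zero.symm)))
  obtain ⟨s, hs⟩ := exists_finset_of_isFinitelyPresentable (n := n) (p := p) hn fun {T} φ hφ => by
    have h : kernel.ι p ≫ φ = 0 := eq_zero_of_skeleton (fun K => (he K).some) fun s u => by
      have hu : (u ≫ (kernel.ι p).app (σ s)) ≫ p.app (σ s) = 0 := by
        rw [Category.assoc, ← comp_app, kernel.condition]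
        exact comp_zero
      rw [← Category.assoc, corepHom_comp]
      exact hφ ⟨s, _, hu⟩
    exact ⟨Abelian.epiDesc p φ h, Abelian.comp_epiDesc p φ h⟩
  have h : corepDesc (fun i : s => n i) ≫ p = 0 := by
    rw [corepDesc_comp]
    simp [hn, corepDesc_zero]
  refine ⟨_, corepDesc fun i : s => n i, h, ShortComplex.exact_of_g_is_cokernel _ ?_⟩
  have key {T : GenMod V A} (φ : P ⟶ T) (hφ : corepDesc (fun i : s => n i) ≫ φ = 0) :
      ∃ ψ, p ≫ ψ = φ := hs φ fun i hi => by
    have := corepMap_π_desc (fun i : s => n i) ⟨i, hi⟩ =≫ φ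
    rw [Category.assoc, hφ, comp_zero] at this
    exact this.symm
  exact CokernelCofork.IsColimit.ofπ' p h fun φ hφ => ⟨(key φ hφ).choose, (key φ hφ).choose_spec⟩

/-- The previous covering of a kernel is applied to Y → 0, whose kernel is Y. -/
lemma exists_epi_corep (Y : GenMod V A) (hY : IsFinitelyPresentable.{v} Y) :
    ∃ (L : FPMod V A) (p : corep V L ⟶ Y), Epi p := by
  obtain ⟨L, p, h, hp⟩ := exists_corep_exact (0 : Y ⟶ 0) hY
    (isFinitelyPresentable_of_isZero (isZero_zero _))
  exact ⟨L, p, (ShortComplex.exact_iff_epi _ rfl).1 hp⟩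

lemma isFinitelyPresentable_of_exact {S : ShortComplex (GenMod V A)} (hS : S.Exact) [Epi S.g]
    (h₁ : IsFinitelyPresentable.{v} S.X₁) (h₂ : IsFinitelyPresentable.{v} S.X₂) :
    IsFinitelyPresentable.{v} S.X₃ :=
  ObjectProperty.prop_of_isColimit (ObjectProperty.isFinitelyPresentable.{v} (GenMod V A))
    hS.gIsCokernel (by rintro (_ | _) <;> assumption)

/-- The kernel of a morphism from a corepresentable functor to a finitely presented generalised
module is covered by a corepresentable functor. -/
lemma exists_corep_kernel {Y : GenMod V A} (hY : IsFinitelyPresentable.{v} Y) {K : FPMod V A}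
    (u : corep V K ⟶ Y) :
    ∃ (M : FPMod V A) (m : corep V M ⟶ corep V K) (h : m ≫ u = 0),
      (ShortComplex.mk m u h).Exact := by
  obtain ⟨L, p, _⟩ := exists_epi_corep Y hY
  obtain ⟨M, m, hm, hmp⟩ := exists_corep_exact p (isFinitelyPresentable_corep L) hY
  obtain ⟨K', q, q', _, hq⟩ := exists_lift p u
  obtain ⟨φ₁, rfl⟩ := exists_corepMap q'
  obtain ⟨φ₂, rfl⟩ := exists_corepMap m
  -- The pushout in mod A corepresents the pullback of q' and m. Since m covers ker p, this pullback
  -- covers the kernel of q' ≫ p = q ≫ u, and then q carries it onto ker u.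
  have hQ : corepMap (pushout.inl φ₁ φ₂) ≫ corepMap φ₁ =
      corepMap (pushout.inr φ₁ φ₂) ≫ corepMap φ₂ := by
    rw [← corepMap_comp, ← corepMap_comp, pushout.condition]
  have h₀ : (corepMap (pushout.inl φ₁ φ₂) ≫ q) ≫ u = 0 := by
    rw [Category.assoc, ← hq, reassoc_of% hQ, hm, comp_zero]
  refine ⟨pushout φ₁ φ₂, corepMap (pushout.inl φ₁ φ₂) ≫ q, h₀, exact_of_corep ?_⟩
  intro N x hx
  obtain ⟨N', r, x', _, hx'⟩ := exists_lift q x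
  have hx'' : (x' ≫ corepMap φ₁) ≫ p = 0 := by
    rw [Category.assoc, hq, reassoc_of% hx']
    exact (congrArg (r ≫ ·) hx).trans comp_zero
  have : Epi (kernel.lift p _ hm) := (ShortComplex.exact_iff_epi_kernel_lift _).1 hmp
  obtain ⟨N'', r', y, _, hy⟩ := exists_lift (kernel.lift p _ hm) (kernel.lift p _ hx'')
  have hy' : y ≫ corepMap φ₂ = (r' ≫ x') ≫ corepMap φ₁ := by
    have := hy =≫ kernel.ι p
    rwa [Category.assoc, Category.assoc, kernel.lift_ι, kernel.lift_ι, ← Category.assoc] at this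
  obtain ⟨a, ha⟩ := exists_corepMap (r' ≫ x')
  obtain ⟨b, rfl⟩ := exists_corepMap y
  rw [← ha, ← corepMap_comp, ← corepMap_comp] at hy'
  refine ⟨N'', r' ≫ r, corepMap (pushout.desc a b (corepMap_injective hy'.symm)),
    epi_comp _ _, ?_⟩
  change _ ≫ corepMap _ ≫ q = _
  rw [← Category.assoc, ← corepMap_comp, pushout.inl_desc, ha, Category.assoc, Category.assoc,
    hx']

/-- Z is the sum of the images of all morphisms from corepresentables, because these separate.
Finitely many images suffice, and their sources combine into one corepresentable. -/
lemma exists_epi_corep_of_isFinitelyGenerated {Z : GenMod V A} (hZ : IsFinitelyGenerated Z) :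
    ∃ (L : FPMod V A) (p : corep V L ⟶ Z), Epi p := by
  let s : Set (Subobject Z) :=
    { W | ∃ (K : FPMod V A) (u : corep V K ⟶ Z), W = imageSubobject u }
  obtain ⟨t, hts, ht, ht'⟩ := hZ s ⟨fun _ _ => le_top, fun W hW => by
    have h : cokernel.π W.arrow = 0 := eq_zero_of_corep fun K u => by
      have := hW ⟨K, u, rfl⟩
      rw [← imageSubobject_arrow_comp u, ← Subobject.ofLE_arrow this, Category.assoc,
        Category.assoc, cokernel.condition, comp_zero, comp_zero]
    have : Epi W.arrow := Abelian.epi_of_cokernel_π_eq_zero _ h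
    have := isIso_of_mono_of_epi W.arrow
    exact (Subobject.eq_top_of_isIso_arrow W).ge⟩
  have := ht.to_subtype
  choose K u hu using fun W : t => hts W.2
  refine ⟨⨁ K, corepDesc u, ?_⟩
  have h : imageSubobject (corepDesc u) = ⊤ := top_unique (ht'.2 fun W hW => by
    refine (hu ⟨W, hW⟩).le.trans ?_
    rw [← corepMap_π_desc u ⟨W, hW⟩]
    exact imageSubobject_comp_le _ _)
  have := (Subobject.isIso_iff_mk_eq_top _).2 ((Subobject.mk_arrow _).trans h)
  rw [← imageSubobject_arrow_comp (corepDesc u)]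
  exact epi_comp _ _

theorem isCoherent_of_isFinitelyPresentable {Y : GenMod V A} (hY : IsFinitelyPresentable.{v} Y) :
    IsCoherent.{v} Y := by
  refine ⟨hY, fun Z i _ hZ => ?_⟩
  obtain ⟨L, p, _⟩ := exists_epi_corep_of_isFinitelyGenerated hZ
  obtain ⟨M, m, h, hm⟩ := exists_corep_kernel hY (p ≫ i)
  have h' : m ≫ p = 0 := by
    rw [← cancel_mono i, Category.assoc, h, zero_comp]
  -- As i is a monomorphism, p and p ≫ i have the same kernel, so Z is the cokernel of a map between
  -- corepresentables.
  have hm' : (ShortComplex.mk m p h').Exact :=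
    let φ : ShortComplex.mk m p h' ⟶ ShortComplex.mk m (p ≫ i) h :=
      { τ₁ := 𝟙 _, τ₂ := 𝟙 _, τ₃ := i }
    have : Epi φ.τ₁ := inferInstanceAs (Epi (𝟙 _))
    have : IsIso φ.τ₂ := inferInstanceAs (IsIso (𝟙 _))
    have : Mono φ.τ₃ := inferInstanceAs (Mono i)
    (ShortComplex.exact_iff_of_epi_of_isIso_of_mono φ).2 hm
  exact isFinitelyPresentable_of_exact hm' (isFinitelyPresentable_corep M)
    (isFinitelyPresentable_corep L)

end GenMod

/-! ### Coh-injectivity and right exactness. -/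

namespace GenMod

open VFun

variable {V : Type u} [Category.{v} V] [Abelian V] [IsGrothendieckAbelian.{v} V]
  [MonoidalCategory V] [SymmetricCategory V] [MonoidalClosed V] [HasDualizableGenerators V]
  {A : Type w} [EnrichedCategory V A] [IsSkeletallySmall V A] (X : GenMod V A)

lemma toHomCorep_homPre {K L : FPMod V A} (f : K ⟶ L) :
    toHomCorep X K ≫ homPre X (corepMap f) = X.map f ≫ toHomCorep X L := by
  refine homObj_hom_ext' fun M => ?_
  have h := X.mapElem_act (c := K) (c' := L) (d := M) (eHomEquiv V f)
  rw [MonoidalCategory.whiskerLeft_comp, MonoidalCategory.whiskerLeft_comp, Category.assoc,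
    Category.assoc, homPre_ev, toHomCorep_ev, whisker_exchange_assoc, toHomCorep_ev,
    BraidedCategory.braiding_naturality_left_assoc,
    BraidedCategory.braiding_naturality_right_assoc, GenMod.map, h, corepMap, corepHom_app,
    corep_act]

lemma homPre_comp {Y Y' Y'' : GenMod V A} (f : Y ⟶ Y') (g : Y' ⟶ Y'') :
    homPre X (f ≫ g) = homPre X g ≫ homPre X f :=
  (homFunctor X).map_comp g.op f.op

lemma homPre_zero (Y Y' : GenMod V A) : homPre X (0 : Y ⟶ Y') = 0 :=
  homObj_hom_ext' fun c => by
    rw [homPre_ev, VFun.zero_app, MonoidalPreadditive.zero_whiskerRight,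
      MonoidalPreadditive.whiskerLeft_zero, zero_comp, zero_comp]

instance : (homFunctor X).PreservesZeroMorphisms where
  map_zero _ _ := X.homPre_zero _ _

lemma homPre_comp_eq_zero {Y Y' Y'' : GenMod V A} {f : Y ⟶ Y'} {g : Y' ⟶ Y''} (h : f ≫ g = 0) :
    homPre X g ≫ homPre X f = 0 := by
  rw [← homPre_comp, h, homPre_zero]

lemma homPre_exact {S : ShortComplex (GenMod V A)} (hS : S.Exact) [Epi S.g] :
    (ShortComplex.mk (homPre X S.g) (homPre X S.f) (X.homPre_comp_eq_zero S.zero)).Exact ∧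
      Mono (homPre X S.g) := by
  have : Mono S.op.f := inferInstanceAs (Mono S.g.op)
  have h₁ := hS.op.map_of_mono_of_preservesKernel (homFunctor X) inferInstance inferInstance
  have h₂ : Mono ((homFunctor X).map S.op.f) := inferInstance
  exact ⟨h₁, h₂⟩

instance mono_homPre {Y Y' : GenMod V A} (p : Y ⟶ Y') [Epi p] : Mono (homPre X p) :=
  inferInstanceAs (Mono ((homFunctor X).map p.op))

/-- The Yoneda isomorphisms identify the two complexes. -/
lemma exact_homPre_corepMap_iff {K L M : FPMod V A} {f : K ⟶ L} {g : L ⟶ M}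
    (h : X.map f ≫ X.map g = 0) (h' : homPre X (corepMap f) ≫ homPre X (corepMap g) = 0) :
    (ShortComplex.mk _ _ h').Exact ↔ (ShortComplex.mk _ _ h).Exact :=
  (ShortComplex.exact_iff_of_iso (ShortComplex.isoMk (S₁ := ShortComplex.mk _ _ h)
    (S₂ := ShortComplex.mk _ _ h') (homCorepIso X K).symm (homCorepIso X L).symm
    (homCorepIso X M).symm (X.toHomCorep_homPre f) (X.toHomCorep_homPre g))).symm

lemma epi_map_of_epi_homPre {K L : FPMod V A} (f : K ⟶ L) [Epi (homPre X (corepMap f))] :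
    Epi (X.map f) := by
  have h : X.map f = (homCorepIso X K).inv ≫ homPre X (corepMap f) ≫ (homCorepIso X L).hom := by
    rw [← Category.assoc, ← Iso.comp_inv_eq]
    exact (X.toHomCorep_homPre f).symm
  rw [h]
  infer_instance

lemma mono_corepMap {K L : FPMod V A} (f : K ⟶ L) [Epi f] : Mono (corepMap f) :=
  mono_of_corep _ fun N u hu => by
    obtain ⟨t, rfl⟩ := exists_corepMap u
    rw [← corepMap_comp, ← corepMap_zero] at hu
    have h : t = 0 := by rw [← cancel_epi f, corepMap_injective hu, comp_zero]
    rw [h, corepMap_zero]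

/-- A test morphism from `corep V N` is a map t : L → N, and the universal property of the cokernel
factors t through g when f ≫ t = 0. -/
lemma exact_corepMap {K L M : FPMod V A} {f : K ⟶ L} {g : L ⟶ M} {h₀ : f ≫ g = 0}
    (hc : IsColimit (CokernelCofork.ofπ g h₀)) (h : corepMap g ≫ corepMap f = 0) :
    (ShortComplex.mk (corepMap g) (corepMap f) h).Exact :=
  exact_of_corep fun N (u : corep V N ⟶ corep V L) (hu : u ≫ corepMap f = 0) => by
    obtain ⟨t, rfl⟩ := exists_corepMap u
    rw [← corepMap_comp, ← corepMap_zero] at hu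
    obtain ⟨l, hl⟩ := CokernelCofork.IsColimit.desc' hc t (corepMap_injective hu)
    have hl' : g ≫ l = t := hl
    refine ⟨N, 𝟙 _, corepMap l, inferInstance, ?_⟩
    rw [Category.id_comp, ← hl', corepMap_comp]

lemma isFinitelyPresentable_cokernel {Y Y' : GenMod V A} (f : Y ⟶ Y')
    (h : IsFinitelyPresentable.{v} Y) (h' : IsFinitelyPresentable.{v} Y') :
    IsFinitelyPresentable.{v} (cokernel f) :=
  isFinitelyPresentable_of_exact (S := ShortComplex.mk _ _ (cokernel.condition f))
    (ShortComplex.exact_cokernel f) h h'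

variable {X}

lemma IsCohInjective.shortExact_cokernel (hX : X.IsCohInjective) {Y Y' : GenMod V A} (f : Y ⟶ Y')
    [Mono f] (h : IsFinitelyPresentable.{v} Y) (h' : IsFinitelyPresentable.{v} Y') :
    (ShortComplex.mk (homPre X (cokernel.π f)) (homPre X f)
      (X.homPre_comp_eq_zero (cokernel.condition f))).ShortExact := by
  obtain ⟨_, _, _, _, hs⟩ := hX (ShortComplex.mk _ _ (cokernel.condition f))
    { exact := ShortComplex.exact_cokernel f, mono_f := inferInstance, epi_g := inferInstance }
    (isCoherent_of_isFinitelyPresentable h) (isCoherent_of_isFinitelyPresentable h')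
    (isCoherent_of_isFinitelyPresentable (isFinitelyPresentable_cokernel f h h'))
  exact hs

/-- The sequence is cut at the cokernel of its first map, which is finitely presented and embeds
into the third term. Coh-injectivity applies to the two resulting short exact sequences. -/
lemma IsCohInjective.exact_homPre (hX : X.IsCohInjective) {S : ShortComplex (GenMod V A)}
    (hS : S.Exact) [Mono S.f] (h₁ : IsFinitelyPresentable.{v} S.X₁)
    (h₂ : IsFinitelyPresentable.{v} S.X₂) (h₃ : IsFinitelyPresentable.{v} S.X₃) :
    (ShortComplex.mk (homPre X S.g) (homPre X S.f) (X.homPre_comp_eq_zero S.zero)).Exact ∧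
      Epi (homPre X S.f) := by
  have hj : Mono (cokernel.desc _ _ S.zero) := (ShortComplex.exact_iff_mono_cokernel_desc _).1 hS
  have hs₁ := hX.shortExact_cokernel S.f h₁ h₂
  have hs₂ := hX.shortExact_cokernel (cokernel.desc _ _ S.zero)
    (isFinitelyPresentable_cokernel S.f h₁ h₂) h₃
  refine ⟨?_, hs₁.epi_g⟩
  let φ : ShortComplex.mk (homPre X S.g) (homPre X S.f) (X.homPre_comp_eq_zero S.zero) ⟶
      ShortComplex.mk (homPre X (cokernel.π S.f)) (homPre X S.f)
        (X.homPre_comp_eq_zero (cokernel.condition _)) :=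
    { τ₁ := homPre X (cokernel.desc _ _ S.zero)
      τ₂ := 𝟙 _
      τ₃ := 𝟙 _
      comm₁₂ := by
        refine Eq.trans ?_ (Category.comp_id _).symm
        refine (X.homPre_comp _ _).symm.trans ?_
        rw [cokernel.π_desc] }
  have : Epi φ.τ₁ := hs₂.epi_g
  have : IsIso φ.τ₂ := inferInstanceAs (IsIso (𝟙 _))
  have : Mono φ.τ₃ := inferInstanceAs (Mono (𝟙 _))
  exact (ShortComplex.exact_iff_of_epi_of_isIso_of_mono φ).2 hs₁.exact

lemma IsCohInjective.isRightExact (hX : X.IsCohInjective) : X.IsRightExact := by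
  intro K L M f g h hexact hepi
  have h₀ : f ≫ g = 0 := by
    ext1
    exact h
  have : Epi g := (ObjectProperty.isFinitelyPresentable.{v} (VFun V Aᵒᵖ)).ι.epi_of_epi_map hepi
  have : Mono (corepMap g) := mono_corepMap g
  have h₁ : corepMap g ≫ corepMap f = 0 := by rw [← corepMap_comp, h₀, corepMap_zero]
  obtain ⟨h₂, h₃⟩ := hX.exact_homPre (exact_corepMap (isCokernelOfExact h₀ hexact hepi) h₁)
    (isFinitelyPresentable_corep M) (isFinitelyPresentable_corep L) (isFinitelyPresentable_corep K)
  have h₄ : X.map f ≫ X.map g = 0 := by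
    have := (toFunctor X).map_comp f g
    rw [h₀, Functor.map_zero] at this
    exact this.symm
  exact ⟨h₄, (X.exact_homPre_corepMap_iff h₄ _).1 h₂, X.epi_map_of_epi_homPre g⟩

/-- Z is the image of `corepMap f` for some f : L → M. An element of [Z, X], restricted to `corep V
M`, dies on the corepresentable of coker f. By exactness of X(L) → X(M) → X(coker f) it comes,
locally, from [corep L, X]. -/
lemma IsRightExact.epi_homPre_of_mono_corep (hX : X.IsRightExact) {Z : GenMod V A}
    {L M : FPMod V A} (ι : Z ⟶ corep V L) [Mono ι] (e : corep V M ⟶ Z) [Epi e] :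
    Epi (homPre X ι) := by
  obtain ⟨f, hf⟩ := exists_corepMap (e ≫ ι)
  obtain ⟨h, hexact, -⟩ := hX.exact_cokernel f
  have h₀ := cokernel.condition f
  have h₁ : homPre X (corepMap f) ≫ homPre X (corepMap (cokernel.π f)) = 0 :=
    X.homPre_comp_eq_zero (by rw [← corepMap_comp, h₀, corepMap_zero])
  have h₂ := (X.exact_homPre_corepMap_iff h h₁).2 hexact
  have h₃ : corepMap (cokernel.π f) ≫ e = 0 := by
    rw [← cancel_mono ι, Category.assoc, ← hf, ← corepMap_comp, h₀, corepMap_zero, zero_comp]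
  rw [epi_iff_surjective_up_to_refinements]
  intro T a
  have ha : (a ≫ homPre X e) ≫ homPre X (corepMap (cokernel.π f)) = 0 := by
    rw [Category.assoc, X.homPre_comp_eq_zero h₃, comp_zero]
  obtain ⟨T', π, hπ, (b : T' ⟶ homObj (corep V L) X), hb⟩ :=
    h₂.exact_up_to_refinements (a ≫ homPre X e) ha
  refine ⟨T', π, hπ, b, ?_⟩
  have hb' : π ≫ a ≫ homPre X e = b ≫ homPre X (corepMap f) := hb
  rw [← cancel_mono (homPre X e), Category.assoc, Category.assoc, hb', ← homPre_comp, hf]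

lemma IsRightExact.isCohInjective (hX : X.IsRightExact) : X.IsCohInjective := by
  intro S hS _ hS₂ hS₃
  have := hS.mono_f
  have := hS.epi_g
  obtain ⟨h₁, h₂⟩ := X.homPre_exact hS.exact
  refine ⟨inferInstance, inferInstance, inferInstance, X.homPre_comp_eq_zero S.zero,
    { exact := h₁, mono_f := h₂, epi_g := ?_ }⟩
  change Epi (homPre X S.f)
  -- The kernel of p ≫ g is the preimage of the first term under the cover p of the middle one. It
  -- is covered by a corepresentable because the third term is finitely presented, so extension
  -- along its inclusion is already known.
  obtain ⟨L, p, _⟩ := exists_epi_corep S.X₂ hS₂.1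
  obtain ⟨M, m, hm, hm'⟩ := exists_corep_kernel hS₃.1 (p ≫ S.g)
  have he : Epi (kernel.lift _ m hm) := (ShortComplex.exact_iff_epi_kernel_lift _).1 hm'
  have hι := hX.epi_homPre_of_mono_corep (kernel.ι (p ≫ S.g)) (kernel.lift _ m hm)
  obtain ⟨t, ht⟩ : ∃ t : kernel (p ≫ S.g) ⟶ S.X₁, t ≫ S.f = kernel.ι (p ≫ S.g) ≫ p :=
    ⟨hS.exact.lift (kernel.ι (p ≫ S.g) ≫ p) (by simp), hS.exact.lift_f _ _⟩
  -- The map t is the base change of p along the monomorphism of the sequence.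
  have ht' : Epi t := by
    rw [epi_iff_surjective_up_to_refinements]
    intro T y
    obtain ⟨T', π, hπ, x, hx⟩ := surjective_up_to_refinements_of_epi p (y ≫ S.f)
    refine ⟨T', π, hπ, kernel.lift _ x (by rw [← reassoc_of% hx, S.zero, comp_zero, comp_zero]), ?_⟩
    rw [← cancel_mono S.f, Category.assoc, Category.assoc, ht, kernel.lift_ι_assoc, hx]
  rw [epi_iff_surjective_up_to_refinements]
  intro T a
  obtain ⟨T', π, hπ, b', hb'⟩ := surjective_up_to_refinements_of_epi
    (homPre X (kernel.ι (p ≫ S.g))) (a ≫ homPre X t)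
  obtain ⟨h₃, h₄⟩ := X.homPre_exact (S := ShortComplex.mk _ _ (kernel.condition p))
    (ShortComplex.exact_kernel p)
  let κ : kernel p ⟶ kernel (p ≫ S.g) := kernel.lift _ (kernel.ι p) (by simp)
  have hκ : κ ≫ kernel.ι _ = kernel.ι p := kernel.lift_ι _ _ _
  have hκt : κ ≫ t = 0 := by
    rw [← cancel_mono S.f, Category.assoc, ht, reassoc_of% hκ, kernel.condition, zero_comp]
  -- The extension b' restricts on the preimage to the given element pulled back along t, and t
  -- kills ker p. Hence b' vanishes on ker p and descends along p to the middle term.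
  have hb'' : b' ≫ homPre X (kernel.ι p) = 0 := by
    rw [← hκ, homPre_comp, ← reassoc_of% hb', X.homPre_comp_eq_zero hκt, comp_zero, comp_zero]
  obtain ⟨b, hb⟩ : ∃ b : T' ⟶ homObj S.X₂ X, b ≫ homPre X p = b' :=
    ⟨h₃.lift b' hb'', h₃.lift_f _ _⟩
  refine ⟨T', π, hπ, b, ?_⟩
  rw [← cancel_mono (homPre X t), Category.assoc, Category.assoc, ← homPre_comp, ht, homPre_comp,
    reassoc_of% hb, hb']

end GenMod

end

end EnrichedModule

theorem mainTheorem6 (V : Type u) [Category.{v} V] [Abelian V] [IsGrothendieckAbelian.{v} V]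
    [MonoidalCategory V] [SymmetricCategory V] [MonoidalClosed V]
    [EnrichedModule.HasDualizableGenerators V]
    (A : Type w) [EnrichedCategory V A] [EnrichedModule.IsSkeletallySmall V A]
    (X : EnrichedModule.GenMod V A) :
    [X.IsCohInjective,
      X.IsRightExact,
      ∃ N : EnrichedModule.VFun V A, Nonempty (X ≅ EnrichedModule.VFun.tensorFunctor N)].TFAE := by
  tfae_have 1 → 2 := fun h => h.isRightExact
  tfae_have 2 → 1 := fun h => h.isCohInjective
  tfae_have 2 → 3 := fun h => h.exists_iso_tensorFunctor
  tfae_have 3 → 2 := fun ⟨_, ⟨α⟩⟩ => EnrichedModule.GenMod.isRightExact_of_iso_tensorFunctor α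
  tfae_finish
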